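/- Let $d\ge 1$, let $\mathbb{T}^d=\mathbb{R}^d/\mathbb{Z}^d$, and let $\mathbb{E}$ be either $(0,\infty)$ or $[0,\infty)$. Let $\mathcal{M}_{ac}(\mathbb{T}^d)$ be the set of finite positive measures $\mathbf{m}$ on $\mathbb{T}^d$ that are absolutely continuous with respect to Lebesgue measure, with density $m\in L^1(\mathbb{T}^d)$. Let $h:\mathcal{M}_{ac}(\mathbb{T}^d)\to C(\mathbb{T}^d)$, $H=H(x,p,M,m,\theta):\mathbb{T}^d\times\mathbb{R}^d\times\mathbb{R}^{d\times d}\times\mathbb{E}\times\mathbb{R}\to\mathbb{R}$, let $g:\mathbb{T}^d\times\mathbb{E}\times\mathbb{R}\to\mathbb{R}$ be continuous and $\gamma>1$. Assume the following, where in (g), (g-ei) and (H1) the measures $\mathbf m$ are those elements of $\mathcal{M}_{ac}(\mathbb{T}^d)$ whose density takes its values in $\mathbb{E}$ a.e., and the integrals in (g) and (g-ei) take values in $[-\infty,\infty]$. (h) For every integer $\kappa>\frac d2+1$, the map $m\mapsto h(\mathbf m)$, defined on the nonnegative elements of $W^{\kappa,2}(\mathbb{T}^d)$, takes values in $W^{\kappa,2}(\mathbb{T}^d)$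 and is Fréchet differentiable (relative to this cone) from $W^{\kappa,2}(\mathbb{T}^d)$ to $W^{\kappa,2}(\mathbb{T}^d)$. (g) $g=g_1+g_2$ with Borel functions $g_1,g_2$ on $\mathbb{T}^d\times\mathbb{E}\times\mathbb{R}$ such that, for all $\mathbf m$, $g_2(x,m(x),h(\mathbf m)(x))\ge 0$ for a.e. $x$; there is $c>0$ with $\int_{\mathbb{T}^d} g_2(x,m,h(\mathbf m))\,dx\le c\,(1+\int_{\mathbb{T}^d} m\,dx)$ for all $\mathbf m$; for every $\delta>0$ there is $C_\delta>0$ with $$\max\Big\{\int_{\mathbb{T}^d} g_1(x,m,h(\mathbf m))\,dx,\ \int_{\mathbb{T}^d} m\,dx\Big\}\le\delta\int_{\mathbb{T}^d} m\,g_1(x,m,h(\mathbf m))\,dx+C_\delta\quad\text{for all }\mathbf m;$$ and there is $R\ge 0$ with $\int_{\mathbb{T}^d} m\,g_1(x,m,h(\mathbf m))\,dx\ge -R$ for all $\mathbf m$. (g-ei) If $\sup_j\int_{\mathbb{T}^d} m_j\,g_1(x,m_j,h(\mathbf m_j))\,dx<\infty$ for a sequence $(\mathbf m_j)$, then a subsequence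 of $(m_j)$ converges weakly in $L^1(\mathbb{T}^d)$. (H1) There are $0\le\tau<1$ and $C_1,C_2,C_3,C_4>0$ such that, for all $(x,p,M,m,\theta)\in\mathbb{T}^d\times\mathbb{R}^d\times\mathbb{R}^{d\times d}\times\mathbb{E}\times\mathbb{R}$, $$-H+D_pH\cdot p+D_MH:M\ \ge\ \tfrac1{C_1}m^{-\tau}|p|^\gamma+C_2\,g(x,m,\theta)-C_1,$$ and, for all $\mathbf m$ and all $u\in W^{1,\gamma}(\mathbb{T}^d)$ whose weak second derivative $D^2u$ is an integrable function, whenever the functions integrated below are integrable, $$-C_3\int_{\mathbb{T}^d} g(x,m,h(\mathbf m))\,dx+\tfrac1{C_1}\int_{\mathbb{T}^d}|Du|^\gamma m^{-\tau}\,dx-C_1\le\int_{\mathbb{T}^d} H(x,Du,D^2u,m,h(\mathbf m))\,dx$$ $$\le -C_4\int_{\mathbb{T}^d} g(x,m,h(\mathbf m))\,dx+C_1\Big(1+\int_{\mathbb{T}^d}|Du|^\gamma m^{-\tau}\,dx\Big).$$ (H2) $H$ is of class $C^\infty$ on $\mathbb{T}^d\times\mathbb{R}^d\times\mathbb{R}^{d\times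 d}\times\mathbb{E}\times\mathbb{R}$. (H3) The operator $$A\begin{bmatrix}\eta\\v\end{bmatrix}=\begin{bmatrix}-v-H(x,Dv,D^2v,\eta,h(\boldsymbol\eta))\\ \eta-\operatorname{div}\big(\eta D_pH(x,Dv,D^2v,\eta,h(\boldsymbol\eta))\big)+\sum_{i,j}\big(\eta D_{M_{ij}}H(x,Dv,D^2v,\eta,h(\boldsymbol\eta))\big)_{x_ix_j}-1\end{bmatrix}$$ is monotone on $C^\infty(\mathbb{T}^d;\mathbb{E})\times C^\infty(\mathbb{T}^d)$ with respect to the inner product of $L^2(\mathbb{T}^d)\times L^2(\mathbb{T}^d)$. Then the stationary mean-field game $$-u-H(x,Du,D^2u,m,h(\mathbf m))=0,\qquad m-\operatorname{div}(mD_pH)+\sum_{i,j}(mD_{M_{ij}}H)_{x_ix_j}=1\quad\text{on }\mathbb{T}^d$$ has a weak solution, that is, there is $(m,u)\in\mathcal{D}'(\mathbb{T}^d)\times\mathcal{D}'(\mathbb{T}^d)$ with $m\ge0$ and $$\left\langle\begin{bmatrix}\eta\\v\end{bmatrix}-\begin{bmatrix}m\\u\end{bmatrix},A\begin{bmatrix}\eta\\v\end{bmatrix}\right\rangle\ge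 0\qquad\text{for all }(\eta,v)\in C^\infty(\mathbb{T}^d;\mathbb{E})\times C^\infty(\mathbb{T}^d),$$ the pairing being that of $\mathcal{D}'(\mathbb{T}^d)^2$ with $C^\infty(\mathbb{T}^d)^2$. Moreover, $m$ is the density of a measure in $\mathcal{M}_{ac}(\mathbb{T}^d)$, $\int_{\mathbb{T}^d}m\,dx=1$, and $u\in W^{1,\gamma}(\mathbb{T}^d)$. -/

import Mathlib

open MeasureTheory Set Filter Topology
open scoped ContDiff ENNReal

noncomputable section

namespace MFG

/-- The torus `ℝ^d / ℤ^d`; its `volume` is Lebesgue measure, of total mass one. -/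
abbrev Torus (d : ℕ) : Type := UnitAddTorus (Fin d)

/-- The quotient map `ℝ^d → ℝ^d / ℤ^d`. -/
def proj {d : ℕ} (y : Fin d → ℝ) : Torus d := fun i => (y i : UnitAddCircle)

/-- `d × d` matrices, as a normed space (finite-dimensional, so the choice of norm is immaterial
for smoothness). -/
abbrev Mat (d : ℕ) : Type := Fin d → Fin d → ℝ

/-! ### Smooth functions and partial derivatives on the torus -/

/-- The partial derivative `∂f/∂x_i` at a point of the torus. -/
def pderiv {d : ℕ} (i : Fin d) (f : Torus d → ℝ) (x : Torus d) : ℝ :=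
  deriv (fun t : ℝ => f (x + Pi.single i (t : UnitAddCircle))) 0

/-- `C^∞(𝕋^d)`: functions whose periodic lift to `ℝ^d` is smooth. -/
def SmoothFun (d : ℕ) : Submodule ℝ C(Torus d, ℝ) where
  carrier := {f | ContDiff ℝ ∞ (fun y : Fin d → ℝ => f (proj y))}
  zero_mem' := by simpa using contDiff_const
  add_mem' := by
    intro f g hf hg
    simp only [Set.mem_ofPred_eq] at hf hg
    exact hf.add hg
  smul_mem' := by
    intro c f hf
    simp only [Set.mem_ofPred_eq] at hf
    exact contDiff_const.smul hf

instance (d : ℕ) : CoeFun (SmoothFun d) (fun _ => Torus d → ℝ) := ⟨fun f => f.1⟩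

lemma isOpenQuotientMap_proj (d : ℕ) : IsOpenQuotientMap (proj (d := d)) :=
  IsOpenQuotientMap.piMap (f := fun (_ : Fin d) (t : ℝ) => (t : UnitAddCircle))
    (fun _ => QuotientAddGroup.isOpenQuotientMap_mk)

lemma pderiv_proj {d : ℕ} (i : Fin d) (f : SmoothFun d) (y : Fin d → ℝ) :
    pderiv i f (proj y) = fderiv ℝ (fun z : Fin d → ℝ => f (proj z)) y (Pi.single i 1) := by
  have hf' : ContDiff ℝ ∞ (fun z : Fin d → ℝ => f (proj z)) := f.2
  have hf : Differentiable ℝ (fun z : Fin d → ℝ => f (proj z)) := hf'.differentiable (by simp)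
  have h1 : (fun t : ℝ => f (proj y + Pi.single i (t : UnitAddCircle)))
      = fun t : ℝ => (fun z : Fin d → ℝ => f (proj z)) (y + t • Pi.single i (1 : ℝ)) := by
    funext t
    congr 1
    funext j
    by_cases hj : j = i
    · subst hj; simp [proj]
    · simp [proj, hj]
  unfold pderiv
  rw [h1]
  exact ((hf y).hasFDerivAt.hasLineDerivAt _).deriv

lemma contDiff_pderiv {d : ℕ} (i : Fin d) (f : SmoothFun d) :
    ContDiff ℝ ∞ (fun y : Fin d → ℝ => pderiv i f (proj y)) := by
  simp_rw [pderiv_proj]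
  have hf : ContDiff ℝ ∞ (fun z : Fin d → ℝ => f (proj z)) := f.2
  exact (hf.fderiv_right (m := ∞) (by simp)).clm_apply contDiff_const

/-- The partial derivative as an operator on `C^∞(𝕋^d)`. -/
def dpartial {d : ℕ} (i : Fin d) (f : SmoothFun d) : SmoothFun d :=
  ⟨⟨pderiv i f, (isOpenQuotientMap_proj d).continuous_comp_iff.1 (contDiff_pderiv i f).continuous⟩,
    contDiff_pderiv i f⟩

/-- The iterated derivative `∂_{i₁} ⋯ ∂_{i_k} f` along a list `[i₁, …, i_k]` of directions. -/
def iterPartial {d : ℕ} (l : List (Fin d)) (f : SmoothFun d) : SmoothFun d :=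
  l.foldr dpartial f

lemma integrable_smooth {d : ℕ} (f : SmoothFun d) : Integrable (f : Torus d → ℝ) :=
  f.1.continuous.integrable_of_hasCompactSupport (HasCompactSupport.of_compactSpace _)

/-! ### Distributions on the torus -/

/-- `𝒟'(𝕋^d)`: linear functionals on `C^∞(𝕋^d)` with
`|T φ| ≤ C max_{|l| ≤ N} ‖∂^l φ‖_∞` for some `N` and `C`. -/
structure TorusDistribution (d : ℕ) where
  toFun : SmoothFun d →ₗ[ℝ] ℝ
  cont : ∃ (N : ℕ) (C : ℝ), ∀ (φ : SmoothFun d) (B : ℝ),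
    (∀ l : List (Fin d), l.length ≤ N → ∀ x, |iterPartial l φ x| ≤ B) → |toFun φ| ≤ C * B

/-- The distribution `T` is nonnegative. -/
def TorusDistribution.Nonneg {d : ℕ} (T : TorusDistribution d) : Prop :=
  ∀ φ : SmoothFun d, (∀ x, 0 ≤ φ x) → 0 ≤ T.toFun φ

/-- The distribution `T` is the integrable function `f`. -/
def TorusDistribution.IsFun {d : ℕ} (T : TorusDistribution d) (f : Torus d → ℝ) : Prop :=
  Integrable f ∧ ∀ φ : SmoothFun d, T.toFun φ = ∫ x, f x * φ x

/-! ### Weak derivatives and Sobolev spaces -/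

/-- `w` is the weak derivative `∂_{i₁} ⋯ ∂_{i_k} f`, `l = [i₁, …, i_k]`. -/
def IsWeakDeriv {d : ℕ} (l : List (Fin d)) (f w : Torus d → ℝ) : Prop :=
  ∀ φ : SmoothFun d, ∫ x, f x * iterPartial l φ x = (-1) ^ l.length * ∫ x, w x * φ x

/-- `u ∈ W^{1,γ}(𝕋^d)` with weak gradient `Du`. -/
structure IsSobolevOne {d : ℕ} (γ : ℝ) (u : Torus d → ℝ)
    (Du : Torus d → EuclideanSpace ℝ (Fin d)) : Prop where
  memLp : MemLp u (ENNReal.ofReal γ)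
  memLp_grad : ∀ i, MemLp (fun x => Du x i) (ENNReal.ofReal γ)
  weak : ∀ i, IsWeakDeriv [i] u (fun x => Du x i)

/-- Sequences of at most `κ` directions, indexing the partial derivatives of order at most `κ`. -/
abbrev SobolevIndex (d κ : ℕ) : Type := Σ k : Fin (κ + 1), (Fin k → Fin d)

/-- The index of the derivative of order zero. -/
def SobolevIndex.zero (d κ : ℕ) : SobolevIndex d κ := ⟨0, fun j => j.elim0⟩

lemma integrable_mul_smooth {d : ℕ} (f : Lp ℝ 2 (volume : Measure (Torus d))) (φ : SmoothFun d) :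
    Integrable (fun x => f x * φ x) := by
  have hφ : MemLp (φ : Torus d → ℝ) 2 := by
    exact φ.1.continuous.memLp_of_hasCompactSupport (HasCompactSupport.of_compactSpace _)
  exact (Lp.memLp f).integrable_mul hφ

/-- `W^{κ,2}(𝕋^d)`: a function in `L²` together with its weak derivatives of order at most `κ`
(which it determines), all of them in `L²`. The norm inherited from the `ℓ²` sum is
`(∑_{k ≤ κ} ∫ |D^k f|²)^{1/2}`. -/
def Sobolev (d κ : ℕ) :
    Submodule ℝ (PiLp 2 (fun _ : SobolevIndex d κ => Lp ℝ 2 (volume : Measure (Torus d)))) where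
  carrier := {F | ∀ a : SobolevIndex d κ,
    IsWeakDeriv (List.ofFn a.2) (F (SobolevIndex.zero d κ)) (F a)}
  zero_mem' := by
    intro a φ
    have h : ∀ ψ : SmoothFun d,
        ∫ x, (0 : Lp ℝ 2 (volume : Measure (Torus d))) x * ψ x = 0 := by
      intro ψ
      rw [integral_eq_zero_of_ae]
      filter_upwards [Lp.coeFn_zero ℝ 2 (volume : Measure (Torus d))] with x hx
      rw [hx]; simp
    simp only [PiLp.zero_apply]
    rw [h, h, mul_zero]
  add_mem' := by
    intro F G hF hG a φ
    have h : ∀ (f g : Lp ℝ 2 (volume : Measure (Torus d))) (ψ : SmoothFun d),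
        ∫ x, (f + g) x * ψ x = (∫ x, f x * ψ x) + ∫ x, g x * ψ x := by
      intro f g ψ
      rw [← integral_add (integrable_mul_smooth f ψ) (integrable_mul_smooth g ψ)]
      refine integral_congr_ae ?_
      filter_upwards [Lp.coeFn_add f g] with x hx
      rw [hx, Pi.add_apply, add_mul]
    simp only [PiLp.add_apply]
    rw [h, h, hF a φ, hG a φ, mul_add]
  smul_mem' := by
    intro c F hF a φ
    have h : ∀ (f : Lp ℝ 2 (volume : Measure (Torus d))) (ψ : SmoothFun d),
        ∫ x, (c • f) x * ψ x = c * ∫ x, f x * ψ x := by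
      intro f ψ
      rw [← integral_const_mul]
      refine integral_congr_ae ?_
      filter_upwards [Lp.coeFn_smul c f] with x hx
      rw [hx, Pi.smul_apply, smul_eq_mul, mul_assoc]
    simp only [PiLp.smul_apply]
    rw [h, h, hF a φ]
    ring

/-- The function underlying an element of `W^{κ,2}(𝕋^d)`. -/
def sobolevFn {d κ : ℕ} (F : Sobolev d κ) : Torus d → ℝ := F.1 (SobolevIndex.zero d κ)

lemma integrable_sobolevFn {d κ : ℕ} (F : Sobolev d κ) : Integrable (sobolevFn F) :=
  (Lp.memLp (F.1 (SobolevIndex.zero d κ))).integrable (by norm_num)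

/-! ### Absolutely continuous measures -/

/-- `ℳ_ac(𝕋^d)`: finite positive measures, absolutely continuous with respect to Lebesgue
measure. -/
def Mac (d : ℕ) : Type :=
  {μ : Measure (Torus d) // IsFiniteMeasure μ ∧ μ ≪ (volume : Measure (Torus d))}

/-- The density of an absolutely continuous measure. -/
def Mac.dens {d : ℕ} (μ : Mac d) (x : Torus d) : ℝ :=
  (μ.1.rnDeriv (volume : Measure (Torus d)) x).toReal

/-- The measure with density `f` (used for `f ≥ 0`). -/
def Mac.ofDensity {d : ℕ} (f : Torus d → ℝ) (hf : Integrable f) : Mac d :=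
  ⟨volume.withDensity (fun x => ENNReal.ofReal (f x)),
    isFiniteMeasure_withDensity_ofReal hf.2, withDensity_absolutelyContinuous _ _⟩

/-- The density of `μ` takes its values in `E` (almost everywhere). -/
def Mac.ValuedIn {d : ℕ} (μ : Mac d) (E : Set ℝ) : Prop := ∀ᵐ x, μ.dens x ∈ E

/-- The Lebesgue integral over the torus with values in `[-∞, ∞]`; it is `-∞` when the positive
and the negative part both have infinite integral. -/
def extIntegral {d : ℕ} (f : Torus d → ℝ) : EReal :=
  ((∫⁻ x, ENNReal.ofReal (f x) : ℝ≥0∞) : EReal) - ((∫⁻ x, ENNReal.ofReal (-f x) : ℝ≥0∞) : EReal)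

/-! ### The Hamiltonian and the operator `A` -/

/-- A Hamiltonian `H(x, p, M, m, θ)`. Only its values for `m ∈ E` matter. -/
abbrev Hamiltonian (d : ℕ) : Type :=
  Torus d → EuclideanSpace ℝ (Fin d) → Mat d → ℝ → ℝ → ℝ

/-- `∂H/∂p_i`. -/
def DpH {d : ℕ} (H : Hamiltonian d) (i : Fin d) (x : Torus d) (p : EuclideanSpace ℝ (Fin d))
    (M : Mat d) (m θ : ℝ) : ℝ :=
  fderiv ℝ (fun q => H x q M m θ) p (EuclideanSpace.single i 1)

/-- `∂H/∂M_{ij}`. -/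
def DMH {d : ℕ} (H : Hamiltonian d) (i j : Fin d) (x : Torus d) (p : EuclideanSpace ℝ (Fin d))
    (M : Mat d) (m θ : ℝ) : ℝ :=
  fderiv ℝ (fun N : Mat d => H x p N m θ) M (Pi.single i (Pi.single j 1))

/-- The gradient of a smooth function. -/
def grad {d : ℕ} (v : SmoothFun d) (x : Torus d) : EuclideanSpace ℝ (Fin d) :=
  WithLp.toLp 2 (fun i => pderiv i v x)

/-- The Hessian of a smooth function. -/
def hess {d : ℕ} (v : SmoothFun d) (x : Torus d) : Mat d :=
  fun i j => pderiv i (pderiv j v) x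

/-- The measure `η dx`, for smooth `η ≥ 0`. -/
def smoothMeasure {d : ℕ} (η : SmoothFun d) : Mac d := Mac.ofDensity η (integrable_smooth η)

/-- First component of `A(η, v)`: `-v - H(x, Dv, D²v, η, h(η))`. -/
def A₁ {d : ℕ} (H : Hamiltonian d) (h : Mac d → C(Torus d, ℝ)) (η v : SmoothFun d)
    (x : Torus d) : ℝ :=
  -v x - H x (grad v x) (hess v x) (η x) (h (smoothMeasure η) x)

/-- Second component of `A(η, v)`: `η - div(η D_pH) + (η D_{M_ij}H)_{x_i x_j} - 1`. -/
def A₂ {d : ℕ} (H : Hamiltonian d) (h : Mac d → C(Torus d, ℝ)) (η v : SmoothFun d)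
    (x : Torus d) : ℝ :=
  η x
    - ∑ i, pderiv i
        (fun y => η y * DpH H i y (grad v y) (hess v y) (η y) (h (smoothMeasure η) y)) x
    + ∑ i, ∑ j, pderiv i (pderiv j
        (fun y => η y * DMH H i j y (grad v y) (hess v y) (η y) (h (smoothMeasure η) y))) x
    - 1

/-- `(m, u) ∈ 𝒟' × 𝒟'` is a weak solution: `m ≥ 0` and, for all smooth `(η, v)` with `η` valued
in `E`, `A(η, v)` is smooth and `⟨(η, v) - (m, u), A(η, v)⟩ ≥ 0`. -/
def IsWeakSolution {d : ℕ} (E : Set ℝ) (H : Hamiltonian d) (h : Mac d → C(Torus d, ℝ))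
    (m u : TorusDistribution d) : Prop :=
  m.Nonneg ∧
  ∀ η v : SmoothFun d, (∀ x, η x ∈ E) →
    ∃ a b : SmoothFun d, (∀ x, a x = A₁ H h η v x) ∧ (∀ x, b x = A₂ H h η v x) ∧
      0 ≤ ((∫ x, η x * a x) - m.toFun a) + ((∫ x, v x * b x) - u.toFun b)

/-! ### Assumptions -/

/-- Assumption on the nonlocal operator `h`: for every integer `κ > d/2 + 1`, it maps nonnegative
elements of `W^{κ,2}` to `W^{κ,2}`, in a Fréchet differentiable way. -/
def HypNonlocal {d : ℕ} (h : Mac d → C(Torus d, ℝ)) : Prop :=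
  ∀ κ : ℕ, (d : ℝ) / 2 + 1 < κ →
    ∃ hκ : Sobolev d κ → Sobolev d κ,
      (∀ F : Sobolev d κ, 0 ≤ᵐ[volume] sobolevFn F →
        sobolevFn (hκ F) =ᵐ[volume] h (Mac.ofDensity (sobolevFn F) (integrable_sobolevFn F))) ∧
      DifferentiableOn ℝ hκ {F | 0 ≤ᵐ[volume] sobolevFn F}

/-- Assumptions on `g = g₁ + g₂`. -/
structure HypG {d : ℕ} (E : Set ℝ) (h : Mac d → C(Torus d, ℝ))
    (g g₁ g₂ : Torus d → ℝ → ℝ → ℝ) : Prop where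
  continuousOn : ContinuousOn (fun z : Torus d × ℝ × ℝ => g z.1 z.2.1 z.2.2) {z | z.2.1 ∈ E}
  measurable₁ : Measurable (fun z : Torus d × E × ℝ => g₁ z.1 z.2.1 z.2.2)
  measurable₂ : Measurable (fun z : Torus d × E × ℝ => g₂ z.1 z.2.1 z.2.2)
  sum : ∀ x, ∀ m ∈ E, ∀ θ, g x m θ = g₁ x m θ + g₂ x m θ
  nonneg : ∀ μ : Mac d, μ.ValuedIn E → ∀ᵐ x, 0 ≤ g₂ x (μ.dens x) (h μ x)
  bound₂ : ∃ c : ℝ, 0 < c ∧ ∀ μ : Mac d, μ.ValuedIn E →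
    ∫⁻ x, ENNReal.ofReal (g₂ x (μ.dens x) (h μ x)) ≤ ENNReal.ofReal (c * (1 + ∫ x, μ.dens x))
  upper : ∀ δ : ℝ, 0 < δ → ∃ C : ℝ, 0 < C ∧ ∀ μ : Mac d, μ.ValuedIn E →
    max (extIntegral fun x => g₁ x (μ.dens x) (h μ x)) ((∫ x, μ.dens x : ℝ) : EReal) ≤
      (δ : EReal) * (extIntegral fun x => μ.dens x * g₁ x (μ.dens x) (h μ x)) + (C : EReal)
  lower : ∃ R : ℝ, 0 ≤ R ∧ ∀ μ : Mac d, μ.ValuedIn E →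
    ((-R : ℝ) : EReal) ≤ extIntegral fun x => μ.dens x * g₁ x (μ.dens x) (h μ x)

/-- A bound on `∫ m_j g₁(x, m_j, h(m_j))` gives a subsequence of `(m_j)` converging weakly
in `L¹`. -/
def HypCompact {d : ℕ} (E : Set ℝ) (h : Mac d → C(Torus d, ℝ))
    (g₁ : Torus d → ℝ → ℝ → ℝ) : Prop :=
  ∀ μ : ℕ → Mac d, (∀ j, (μ j).ValuedIn E) →
    (∃ B : ℝ, ∀ j,
      (extIntegral fun x => (μ j).dens x * g₁ x ((μ j).dens x) (h (μ j) x)) ≤ (B : EReal)) →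
    ∃ s : ℕ → ℕ, StrictMono s ∧ ∃ m : Torus d → ℝ, Integrable m ∧
      ∀ f : Torus d → ℝ, Measurable f → (∃ K : ℝ, ∀ x, |f x| ≤ K) →
        Tendsto (fun j => ∫ x, (μ (s j)).dens x * f x) atTop (𝓝 (∫ x, m x * f x))

/-- Growth of the Hamiltonian, with exponent `γ`. The second pair of bounds is required for those
`(m, u)` for which its integrals are finite. -/
def HypGrowth {d : ℕ} (E : Set ℝ) (H : Hamiltonian d) (h : Mac d → C(Torus d, ℝ))
    (g : Torus d → ℝ → ℝ → ℝ) (γ : ℝ) : Prop :=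
  1 < γ ∧ ∃ τ C₁ C₂ C₃ C₄ : ℝ, 0 ≤ τ ∧ τ < 1 ∧ 0 < C₁ ∧ 0 < C₂ ∧ 0 < C₃ ∧ 0 < C₄ ∧
    (∀ x p M, ∀ m ∈ E, ∀ θ,
      1 / C₁ * (m ^ (-τ) * ‖p‖ ^ γ) + C₂ * g x m θ - C₁ ≤
        -H x p M m θ + ∑ i, DpH H i x p M m θ * p i + ∑ i, ∑ j, DMH H i j x p M m θ * M i j) ∧
    (∀ (μ : Mac d) (u : Torus d → ℝ) (Du : Torus d → EuclideanSpace ℝ (Fin d))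
      (D2u : Torus d → Mat d), μ.ValuedIn E → IsSobolevOne γ u Du →
      (∀ i j, Integrable (fun x => D2u x i j) ∧
        IsWeakDeriv [i] (fun x => Du x j) (fun x => D2u x i j)) →
      Integrable (fun x => g x (μ.dens x) (h μ x)) →
      Integrable (fun x => ‖Du x‖ ^ γ * μ.dens x ^ (-τ)) →
      Integrable (fun x => H x (Du x) (D2u x) (μ.dens x) (h μ x)) →
      -C₃ * (∫ x, g x (μ.dens x) (h μ x)) + 1 / C₁ * (∫ x, ‖Du x‖ ^ γ * μ.dens x ^ (-τ)) - C₁ ≤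
          ∫ x, H x (Du x) (D2u x) (μ.dens x) (h μ x) ∧
        ∫ x, H x (Du x) (D2u x) (μ.dens x) (h μ x) ≤
          -C₄ * (∫ x, g x (μ.dens x) (h μ x))
            + C₁ * (1 + ∫ x, ‖Du x‖ ^ γ * μ.dens x ^ (-τ)))

/-- `H` is of class `C^∞` on `𝕋^d × ℝ^d × ℝ^{d×d} × E × ℝ`. -/
def HypSmooth {d : ℕ} (E : Set ℝ) (H : Hamiltonian d) : Prop :=
  ContDiffOn ℝ ∞
    (fun z : (Fin d → ℝ) × EuclideanSpace ℝ (Fin d) × Mat d × ℝ × ℝ =>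
      H (proj z.1) z.2.1 z.2.2.1 z.2.2.2.1 z.2.2.2.2)
    {z | z.2.2.2.1 ∈ E}

/-- `A` is monotone with respect to the inner product of `L² × L²`. -/
def HypMonotone {d : ℕ} (E : Set ℝ) (H : Hamiltonian d) (h : Mac d → C(Torus d, ℝ)) : Prop :=
  ∀ η v η' v' : SmoothFun d, (∀ x, η x ∈ E) → (∀ x, η' x ∈ E) →
    0 ≤ (∫ x, (A₁ H h η v x - A₁ H h η' v' x) * (η x - η' x))
      + ∫ x, (A₂ H h η v x - A₂ H h η' v' x) * (v x - v' x)

end MFG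

end

open MeasureTheory Set Filter Topology
open scoped ContDiff ENNReal

noncomputable section

namespace MFG

/-! ### Calculus on the torus -/

/-! The weak formulation is Minty's form of the variational inequality for the monotone operator
`A`. For a fixed smooth test pair `(η, v)` it is affine in the unknown `(m, u)`, so it survives weak
limits, and no equation has to be solved exactly. What is needed is a bounded sequence satisfying
the inequality at more and more test pairs.

Finitely many test pairs: on the convex hull of finitely many smooth pairs `A` is monotone and
hemicontinuous. A finite matrix game (separation of convex sets) and compactness of the simplex give
a Minty point, and hemicontinuity turns it into a Stampacchia point `z = (m, u)`, that is `⟨A z, p -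
z⟩ ≥ 0` at every vertex `p` (`exists_stdSimplex_nonneg`, `exists_minty`, `exists_stampacchia`,
`Regular.exists_solution`). Monotonicity then gives `⟨A p, p - z⟩ ≥ 0`. For this, `A` must take
smooth values and be continuous along segments; the nonlocal term is controlled through Fourier
decay and the Sobolev embedding (`contDiff_of_weakDeriv`, `continuous_nonlocal_segment`).

Bounds: the Stampacchia inequality is stronger than Minty's, because it involves `A z` itself.
Keeping the pairs `(1, 0)`, `(2, 0)`, `(1/2, 0)` among the vertices and using (g) and (H1), one
bounds `∫ m g₁`, `∫ |Du|^γ` and `|∫ u|` independently of the other vertices (`apriori`). The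
Poincaré inequality then bounds `u` in `W^{1,γ}`.

Limits: (g-ei) yields a subsequence of the densities converging weakly in `L¹`. For `u`, convex
combinations of tails nearly minimising the strictly convex functional `∑ ∫ √(1 + f²)` over `u` and
its partial derivatives converge in `L¹` (`exists_convex_tendsto`); convex combinations are harmless
because the inequality is affine. A test pair enters only through one number and two continuous
functions, an element of a second countable space, so countably many test pairs suffice
(`Regular.exists_weak_limit`). Finally, testing with `η = 1` and all constants `v` forces the mass
to be one (`Regular.mass_eq_one`). -/

instance : IsProbabilityMeasure (volume : Measure UnitAddCircle) :=
  ⟨by simp⟩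

variable {d : ℕ}

lemma proj_add (y z : Fin d → ℝ) : proj (y + z) = proj y + proj z := rfl

lemma continuous_proj : Continuous (proj (d := d)) := (isOpenQuotientMap_proj d).continuous

lemma proj_surjective : Function.Surjective (proj (d := d)) := (isOpenQuotientMap_proj d).surjective

/-- Every translation of the torus is by a vector of the unit cube; this is what makes the constant
in the Poincaré inequality finite. -/
lemma exists_proj_eq (x : Torus d) : ∃ t : Fin d → ℝ, (∀ i, |t i| ≤ 1) ∧ proj t = x := by
  have h : ∀ i, ∃ s : ℝ, |s| ≤ 1 ∧ (s : UnitAddCircle) = x i := by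
    intro i
    obtain ⟨⟨s, hs⟩, h⟩ := (AddCircle.equivIco (1 : ℝ) 0).symm.surjective (x i)
    refine ⟨s, ?_, h⟩
    simp only [zero_add, mem_Ico] at hs
    rw [abs_le]; constructor <;> linarith [hs.1, hs.2]
  choose t ht ht' using h
  exact ⟨t, ht, funext ht'⟩

lemma integrable_of_continuous {f : Torus d → ℝ} (hf : Continuous f) : Integrable f :=
  hf.integrable_of_hasCompactSupport (HasCompactSupport.of_compactSpace _)

lemma continuous_smooth (f : SmoothFun d) : Continuous (f : Torus d → ℝ) := f.1.continuous

/-- The smooth function given by a function with smooth periodic lift. -/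
def smoothOfLift (f : Torus d → ℝ) (hf : ContDiff ℝ ∞ (fun y : Fin d → ℝ => f (proj y))) :
    SmoothFun d :=
  ⟨⟨f, (isOpenQuotientMap_proj d).continuous_comp_iff.1 hf.continuous⟩, hf⟩

@[simp] lemma smoothOfLift_apply (f : Torus d → ℝ)
    (hf : ContDiff ℝ ∞ (fun y : Fin d → ℝ => f (proj y))) (x : Torus d) :
    smoothOfLift f hf x = f x := rfl

@[ext] lemma SmoothFun.ext' {f g : SmoothFun d} (h : ∀ x, f x = g x) : f = g :=
  Subtype.ext (ContinuousMap.ext h)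

@[simp] lemma SmoothFun.add_apply (f g : SmoothFun d) (x : Torus d) : (f + g) x = f x + g x := rfl
@[simp] lemma SmoothFun.sub_apply (f g : SmoothFun d) (x : Torus d) : (f - g) x = f x - g x := rfl
@[simp] lemma SmoothFun.smul_apply (c : ℝ) (f : SmoothFun d) (x : Torus d) :
    (c • f) x = c * f x := rfl
@[simp] lemma SmoothFun.zero_apply (x : Torus d) : (0 : SmoothFun d) x = 0 := rfl

lemma contDiff_lift (f : SmoothFun d) : ContDiff ℝ ∞ (fun y : Fin d → ℝ => f (proj y)) := f.2

/-- Constants as smooth functions. -/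
def smoothConst (d : ℕ) (c : ℝ) : SmoothFun d := smoothOfLift (fun _ => c) contDiff_const

@[simp] lemma smoothConst_apply (c : ℝ) (x : Torus d) : smoothConst d c x = c := rfl

/-- Products of smooth functions. -/
def smoothMul (f g : SmoothFun d) : SmoothFun d :=
  smoothOfLift (fun x => f x * g x) ((contDiff_lift f).mul (contDiff_lift g))

@[simp] lemma smoothMul_apply (f g : SmoothFun d) (x : Torus d) : smoothMul f g x = f x * g x := rfl

@[simp] lemma dpartial_apply (i : Fin d) (f : SmoothFun d) (x : Torus d) :
    dpartial i f x = pderiv i f x := rfl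

lemma differentiable_lift (f : SmoothFun d) :
    Differentiable ℝ (fun y : Fin d → ℝ => f (proj y)) :=
  (contDiff_lift f).differentiable (by simp)

lemma dpartial_add (i : Fin d) (f g : SmoothFun d) :
    dpartial i (f + g) = dpartial i f + dpartial i g := by
  ext x
  obtain ⟨y, rfl⟩ := proj_surjective x
  simp only [SmoothFun.add_apply, dpartial_apply, pderiv_proj]
  rw [fderiv_fun_add (differentiable_lift f y) (differentiable_lift g y)]
  rfl

lemma dpartial_smul (i : Fin d) (c : ℝ) (f : SmoothFun d) :
    dpartial i (c • f) = c • dpartial i f := by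
  ext x
  obtain ⟨y, rfl⟩ := proj_surjective x
  simp only [SmoothFun.smul_apply, dpartial_apply, pderiv_proj]
  rw [fderiv_const_mul (differentiable_lift f y)]
  rfl

lemma dpartial_mul (i : Fin d) (f g : SmoothFun d) :
    dpartial i (smoothMul f g) = smoothMul f (dpartial i g) + smoothMul (dpartial i f) g := by
  ext x
  obtain ⟨y, rfl⟩ := proj_surjective x
  simp only [SmoothFun.add_apply, smoothMul_apply, dpartial_apply, pderiv_proj]
  rw [fderiv_fun_mul (differentiable_lift f y) (differentiable_lift g y)]
  simp [mul_comm]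

lemma dpartial_const (i : Fin d) (c : ℝ) : dpartial i (smoothConst d c) = 0 := by
  ext x
  simp [pderiv]

/-- The partial derivative as a linear map. -/
def dpartialₗ (i : Fin d) : SmoothFun d →ₗ[ℝ] SmoothFun d where
  toFun := dpartial i
  map_add' := dpartial_add i
  map_smul' := dpartial_smul i

lemma hasDerivAt_along (f : SmoothFun d) (x : Torus d) (t : Fin d → ℝ) (s : ℝ) :
    HasDerivAt (fun s : ℝ => f (x + proj (s • t))) (∑ i, t i * pderiv i f (x + proj (s • t))) s := by
  obtain ⟨y, rfl⟩ := proj_surjective x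
  simp_rw [← proj_add, pderiv_proj]
  have h1 : HasDerivAt (fun s : ℝ => y + s • t) t s := by
    simpa using ((hasDerivAt_id s).smul_const t).const_add y
  have h2 := (differentiable_lift f (y + s • t)).hasFDerivAt.comp_hasDerivAt s h1
  have h4 : ∀ L : (Fin d → ℝ) →L[ℝ] ℝ, L t = ∑ i, t i * L (Pi.single i 1) := by
    intro L
    conv_lhs => rw [pi_eq_sum_univ' t]
    simp [map_sum]
  rw [h4] at h2
  exact h2

lemma continuous_along (f : Torus d → ℝ) (hf : Continuous f) (t : Fin d → ℝ) :
    Continuous (fun p : Torus d × ℝ => f (p.1 + proj (p.2 • t))) :=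
  hf.comp (continuous_fst.add (continuous_proj.comp (continuous_snd.smul continuous_const)))

lemma sub_eq_integral_along (f : SmoothFun d) (x : Torus d) (t : Fin d → ℝ) :
    f (x + proj t) - f x = ∫ s in (0 : ℝ)..1, ∑ i, t i * pderiv i f (x + proj (s • t)) := by
  rw [intervalIntegral.integral_eq_sub_of_hasDerivAt (fun s _ => hasDerivAt_along f x t s)]
  · have : proj (0 : Fin d → ℝ) = 0 := rfl
    simp [this]
  · apply Continuous.intervalIntegrable
    refine continuous_finsetSum _ fun i _ => continuous_const.mul ?_
    exact (continuous_along _ (continuous_smooth (dpartial i f)) t).comp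
      (continuous_const.prodMk continuous_id)

/-- Fubini and translation invariance: each slice in `s` has the same integral as `G`. -/
lemma integral_along (G : Torus d → ℝ) (hG : Continuous G) (t : Fin d → ℝ) :
    ∫ x, ∫ s in (0 : ℝ)..1, G (x + proj (s • t)) = ∫ x, G x := by
  rw [← intervalIntegral_integral_swap]
  · simp_rw [integral_add_right_eq_self]
    simp
  · have hc := continuous_along G hG t
    have : IsFiniteMeasure ((volume : Measure ℝ).restrict (uIoc 0 1)) :=
      ⟨by simp [uIoc_of_le]⟩
    obtain ⟨K, hK⟩ := (isCompact_univ (X := Torus d)).exists_bound_of_continuousOn hG.continuousOn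
    refine Integrable.of_bound (C := K) ?_ ?_
    · exact (hc.comp continuous_swap).aestronglyMeasurable
    · exact Eventually.of_forall fun p => hK _ (mem_univ _)

lemma integral_pderiv (i : Fin d) (f : SmoothFun d) : ∫ x, pderiv i f x = 0 := by
  have h := integral_along (pderiv i f) (continuous_smooth (dpartial i f)) (Pi.single i 1)
  rw [← h]
  have h2 : ∀ x, ∫ s in (0 : ℝ)..1, pderiv i f (x + proj (s • Pi.single i 1)) = 0 := by
    intro x
    have h3 := sub_eq_integral_along f x (Pi.single i 1)
    -- A full turn in direction `i` returns to the starting point, so the derivative has mean zero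
    -- on each closed line.
    have h4 : proj (Pi.single i (1 : ℝ) : Fin d → ℝ) = 0 := by
      funext j
      by_cases hj : j = i
      · subst hj
        simp [proj]
      · simp [proj, hj]
    rw [h4, add_zero, sub_self] at h3
    refine Eq.trans ?_ h3.symm
    congr 1
    funext s
    simp only [Pi.single_apply, ite_mul, one_mul, zero_mul, Finset.sum_ite_eq', Finset.mem_univ,
      if_true]
  simp [h2]

/-- Integration by parts. -/
lemma integral_mul_pderiv (i : Fin d) (f g : SmoothFun d) :
    ∫ x, f x * pderiv i g x = - ∫ x, pderiv i f x * g x := by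
  have h := integral_pderiv i (smoothMul f g)
  have h2 : ∀ x, pderiv i (smoothMul f g) x = f x * pderiv i g x + pderiv i f x * g x := fun x =>
    congrArg (fun k : SmoothFun d => k x) (dpartial_mul i f g)
  simp_rw [h2] at h
  have h3 : Integrable fun x => f x * pderiv i g x := integrable_smooth (smoothMul f (dpartial i g))
  have h4 : Integrable fun x => pderiv i f x * g x := integrable_smooth (smoothMul (dpartial i f) g)
  rw [integral_add h3 h4] at h
  linarith

/-- Integration by parts moves the outermost derivative first, and it becomes the innermost one on
`f`. Hence the reversed list, which avoids commuting derivatives. -/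
lemma isWeakDeriv_smooth (l : List (Fin d)) (f : SmoothFun d) :
    IsWeakDeriv l f (iterPartial l.reverse f) := by
  induction l generalizing f with
  | nil => intro φ; simp [iterPartial]
  | cons i l ih =>
    intro φ
    have h1 : iterPartial (i :: l) φ = dpartial i (iterPartial l φ) := rfl
    have h2 : iterPartial (i :: l).reverse f = iterPartial l.reverse (dpartial i f) := by
      simp [iterPartial, List.foldr_append]
    rw [h1, h2]
    simp only [dpartial_apply]
    rw [integral_mul_pderiv]
    have := ih (dpartial i f) φ
    simp only [dpartial_apply] at this
    rw [this, List.length_cons, pow_succ]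
    ring

/-! ### Translation estimates and the Poincaré inequality in `L^γ`. -/

lemma convexOn_norm_rpow {F : Type*} [NormedAddCommGroup F] [NormedSpace ℝ F] {γ : ℝ} (hγ : 1 ≤ γ) :
    ConvexOn ℝ univ (fun x : F => ‖x‖ ^ γ) := by
  refine ⟨convex_univ, fun x _ y _ a b ha hb hab => ?_⟩
  have h1 : ‖a • x + b • y‖ ≤ a • ‖x‖ + b • ‖y‖ :=
    (convexOn_norm convex_univ).2 (mem_univ x) (mem_univ y) ha hb hab
  exact (Real.rpow_le_rpow (norm_nonneg _) h1 (by linarith)).trans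
    ((convexOn_rpow hγ).2 (norm_nonneg x) (norm_nonneg y) ha hb hab)

lemma continuous_grad (u : SmoothFun d) : Continuous (grad u) :=
  (PiLp.continuous_toLp 2 _).comp
    (continuous_pi fun i => continuous_smooth (dpartial i u))

lemma rpow_abs_integral_le {Ω : Type*} [MeasurableSpace Ω] {μ : Measure Ω} [IsProbabilityMeasure μ]
    {γ : ℝ} (hγ : 1 ≤ γ) {f : Ω → ℝ} (hf : Integrable f μ) (hf' : Integrable (fun x => |f x| ^ γ) μ) :
    |∫ x, f x ∂μ| ^ γ ≤ ∫ x, |f x| ^ γ ∂μ := by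
  have hcont : Continuous (fun x : ℝ => ‖x‖ ^ γ) :=
    continuous_norm.rpow_const fun _ => Or.inr (by linarith)
  exact (convexOn_norm_rpow (F := ℝ) hγ).map_integral_le hcont.continuousOn isClosed_univ
    (Eventually.of_forall fun _ => mem_univ _) hf hf'

/-- Translations move a smooth function, in `L^γ`, by at most a multiple of its gradient. -/
lemma integral_rpow_translate_sub_le {γ : ℝ} (hγ : 1 < γ) (u : SmoothFun d) (y : Torus d) :
    ∫ x, |u (x + y) - u x| ^ γ ≤ (d : ℝ) ^ γ * ∫ x, ‖grad u x‖ ^ γ := by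
  have hγ0 : (0 : ℝ) ≤ γ := by linarith
  obtain ⟨t, ht, rfl⟩ := exists_proj_eq y
  have hG : Continuous (fun x => ((d : ℝ) * ‖grad u x‖) ^ γ) :=
    (continuous_const.mul (continuous_grad u).norm).rpow_const fun _ => Or.inr hγ0
  have hcu := continuous_smooth u
  have hprob : IsProbabilityMeasure ((volume : Measure ℝ).restrict (Ioc 0 1)) := ⟨by simp⟩
  -- Jensen on `[0, 1]` for the line integral of the derivative. The factor `d` comes from `|t i| ≤
  -- 1` and from bounding each partial derivative by the norm of the gradient.
  have key : ∀ x, |u (x + proj t) - u x| ^ γ ≤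
      ∫ s in (0 : ℝ)..1, ((d : ℝ) * ‖grad u (x + proj (s • t))‖) ^ γ := by
    intro x
    have hc : Continuous fun s : ℝ => ∑ i, t i * pderiv i u (x + proj (s • t)) := by
      refine continuous_finsetSum _ fun i _ => continuous_const.mul ?_
      exact (continuous_along (pderiv i u) (continuous_smooth (dpartial i u)) t).comp
        (f := fun s : ℝ => (x, s)) (continuous_const.prodMk continuous_id)
    have hc' : Continuous fun s : ℝ => |∑ i, t i * pderiv i u (x + proj (s • t))| ^ γ :=
      hc.abs.rpow_const fun _ => Or.inr hγ0
    have hc'' : Continuous fun s : ℝ => ((d : ℝ) * ‖grad u (x + proj (s • t))‖) ^ γ :=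
      (continuous_along (fun x => ((d : ℝ) * ‖grad u x‖) ^ γ) hG t).comp
        (f := fun s : ℝ => (x, s)) (continuous_const.prodMk continuous_id)
    rw [sub_eq_integral_along, intervalIntegral.integral_of_le zero_le_one,
      intervalIntegral.integral_of_le zero_le_one]
    have hI := rpow_abs_integral_le (μ := (volume : Measure ℝ).restrict (Ioc 0 1)) hγ.le
      hc.integrableOn_Ioc hc'.integrableOn_Ioc
    refine hI.trans ?_
    refine integral_mono (μ := (volume : Measure ℝ).restrict (Ioc 0 1)) hc'.integrableOn_Ioc
      hc''.integrableOn_Ioc fun s => ?_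
    refine Real.rpow_le_rpow (abs_nonneg _) ?_ hγ0
    refine (Finset.abs_sum_le_sum_abs _ _).trans ?_
    have : ∀ i ∈ Finset.univ, |t i * pderiv i u (x + proj (s • t))| ≤
        ‖grad u (x + proj (s • t))‖ := by
      intro i _
      rw [abs_mul]
      have h2 : |pderiv i u (x + proj (s • t))| ≤ ‖grad u (x + proj (s • t))‖ :=
        PiLp.norm_apply_le (grad u (x + proj (s • t))) i
      nlinarith [ht i, abs_nonneg (t i), abs_nonneg (pderiv i u (x + proj (s • t)))]
    simpa using Finset.sum_le_card_nsmul _ _ _ this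
  calc ∫ x, |u (x + proj t) - u x| ^ γ
      ≤ ∫ x, ∫ s in (0 : ℝ)..1, ((d : ℝ) * ‖grad u (x + proj (s • t))‖) ^ γ := by
        refine integral_mono ?_ ?_ key
        · exact integrable_of_continuous ((((hcu.comp (continuous_id.add continuous_const)).sub
            hcu).abs).rpow_const fun _ => Or.inr hγ0)
        · refine integrable_of_continuous ?_
          exact intervalIntegral.continuous_parametric_intervalIntegral_of_continuous'
            (continuous_along (fun x => ((d : ℝ) * ‖grad u x‖) ^ γ) hG t) 0 1
    _ = ∫ x, ((d : ℝ) * ‖grad u x‖) ^ γ := integral_along (fun x => ((d : ℝ) * ‖grad u x‖) ^ γ) hG t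
    _ = (d : ℝ) ^ γ * ∫ x, ‖grad u x‖ ^ γ := by
        rw [← integral_const_mul]
        congr 1
        funext x
        rw [Real.mul_rpow (by positivity) (norm_nonneg _)]

/-- Poincaré inequality on the torus, in `L^γ`. -/
lemma integral_rpow_sub_mean_le {γ : ℝ} (hγ : 1 < γ) (u : SmoothFun d) :
    ∫ x, |u x - ∫ y, u y| ^ γ ≤ (d : ℝ) ^ γ * ∫ x, ‖grad u x‖ ^ γ := by
  have hγ0 : (0 : ℝ) ≤ γ := by linarith
  have hcu := continuous_smooth u
  have hc2 : Continuous (fun p : Torus d × Torus d => |u (p.1 + p.2) - u p.1| ^ γ) :=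
    (((hcu.comp (continuous_fst.add continuous_snd)).sub (hcu.comp continuous_fst)).abs).rpow_const
      fun _ => Or.inr hγ0
  -- The mean of `u` is the average of its translates, so Jensen reduces Poincaré to the translation
  -- estimate, uniform in `y`.
  have h1 : ∀ x, |u x - ∫ y, u y| ^ γ ≤ ∫ y, |u (x + y) - u x| ^ γ := by
    intro x
    have hi : Integrable (fun y => u (x + y) - u x) :=
      integrable_of_continuous ((hcu.comp (continuous_const.add continuous_id)).sub continuous_const)
    have hi' : Integrable (fun y => |u (x + y) - u x| ^ γ) :=
      integrable_of_continuous (hc2.comp (continuous_const.prodMk continuous_id))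
    have h2 := rpow_abs_integral_le hγ.le hi hi'
    have hi0 : Integrable (fun y => u (x + y)) :=
      integrable_of_continuous (hcu.comp (continuous_const.add continuous_id))
    rwa [integral_sub hi0 (integrable_const _), integral_add_left_eq_self (fun y => u y) x, integral_const,
      probReal_univ, one_smul, abs_sub_comm] at h2
  have hi3 : Integrable (fun p : Torus d × Torus d => |u (p.1 + p.2) - u p.1| ^ γ)
      (volume.prod volume) :=
    hc2.integrable_of_hasCompactSupport (HasCompactSupport.of_compactSpace _)
  calc ∫ x, |u x - ∫ y, u y| ^ γ ≤ ∫ x, ∫ y, |u (x + y) - u x| ^ γ := by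
        refine integral_mono ?_ hi3.integral_prod_left h1
        exact integrable_of_continuous ((hcu.sub continuous_const).abs.rpow_const
          fun _ => Or.inr hγ0)
    _ = ∫ y, ∫ x, |u (x + y) - u x| ^ γ := integral_integral_swap hi3
    _ ≤ ∫ _y : Torus d, (d : ℝ) ^ γ * ∫ x, ‖grad u x‖ ^ γ :=
        integral_mono hi3.integral_prod_right (integrable_const _)
          fun y => integral_rpow_translate_sub_le hγ u y
    _ = _ := by simp

/-! ### Fourier series and the Sobolev embedding -/

/-- `mFourierCoeff` integrates against the product of normalised Haar measures; on a circle of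
length one this is Lebesgue measure. -/
lemma volume_torus_eq :
    (volume : Measure (Torus d)) =
      Measure.pi fun _ => (AddCircle.haarAddCircle : Measure UnitAddCircle) := by
  have h : (volume : Measure UnitAddCircle) = AddCircle.haarAddCircle := by
    rw [AddCircle.volume_eq_smul_haarAddCircle]; simp
  rw [volume_pi, h]

/-- The linear form `y ↦ ∑ nᵢ yᵢ`. -/
def phase (n : Fin d → ℤ) : (Fin d → ℝ) →L[ℝ] ℝ :=
  ∑ i, (n i : ℝ) • ContinuousLinearMap.proj i

lemma phase_apply (n : Fin d → ℤ) (y : Fin d → ℝ) : phase n y = ∑ i, n i * y i := by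
  simp [phase]

lemma norm_phase_le (n : Fin d → ℤ) : ‖phase n‖ ≤ d * ‖n‖ := by
  refine ContinuousLinearMap.opNorm_le_bound _ (by positivity) fun y => ?_
  rw [phase_apply]
  refine (norm_sum_le _ _).trans ?_
  have : ∀ i ∈ Finset.univ, ‖(n i : ℝ) * y i‖ ≤ ‖n‖ * ‖y‖ := by
    intro i _
    rw [norm_mul]
    gcongr
    · exact norm_le_pi_norm n i
    · exact norm_le_pi_norm y i
  refine (Finset.sum_le_card_nsmul _ _ _ this).trans ?_
  simp [mul_assoc]

lemma mFourier_proj (n : Fin d → ℤ) (y : Fin d → ℝ) :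
    UnitAddTorus.mFourier n (proj y) = Complex.exp (((2 * Real.pi * phase n y : ℝ) : ℂ) * Complex.I) := by
  simp only [UnitAddTorus.mFourier, ContinuousMap.coe_mk, proj, fourier_coe_apply, phase_apply]
  rw [← Complex.exp_sum]
  congr 1
  push_cast
  rw [Finset.mul_sum, Finset.sum_mul]
  refine Finset.sum_congr rfl fun i _ => ?_
  ring

lemma contDiff_cos_phase (n : Fin d → ℤ) :
    ContDiff ℝ ∞ (fun y : Fin d → ℝ => (UnitAddTorus.mFourier n (proj y)).re) := by
  simp_rw [mFourier_proj, Complex.exp_ofReal_mul_I_re]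
  exact Real.contDiff_cos.comp (contDiff_const.mul (phase n).contDiff)

lemma contDiff_sin_phase (n : Fin d → ℤ) :
    ContDiff ℝ ∞ (fun y : Fin d → ℝ => (UnitAddTorus.mFourier n (proj y)).im) := by
  simp_rw [mFourier_proj, Complex.exp_ofReal_mul_I_im]
  exact Real.contDiff_sin.comp (contDiff_const.mul (phase n).contDiff)

/-- `cos (2π n·x)`. -/
def cosMode (n : Fin d → ℤ) : SmoothFun d :=
  smoothOfLift (fun x => (UnitAddTorus.mFourier n x).re) (contDiff_cos_phase n)

/-- `sin (2π n·x)`. -/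
def sinMode (n : Fin d → ℤ) : SmoothFun d :=
  smoothOfLift (fun x => (UnitAddTorus.mFourier n x).im) (contDiff_sin_phase n)

lemma cosMode_proj (n : Fin d → ℤ) (y : Fin d → ℝ) :
    cosMode n (proj y) = Real.cos (2 * Real.pi * phase n y) := by
  simp only [cosMode, smoothOfLift_apply, mFourier_proj, Complex.exp_ofReal_mul_I_re]

lemma sinMode_proj (n : Fin d → ℤ) (y : Fin d → ℝ) :
    sinMode n (proj y) = Real.sin (2 * Real.pi * phase n y) := by
  simp only [sinMode, smoothOfLift_apply, mFourier_proj, Complex.exp_ofReal_mul_I_im]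

lemma abs_cosMode_le (n : Fin d → ℤ) (x : Torus d) : |cosMode n x| ≤ 1 := by
  obtain ⟨y, rfl⟩ := proj_surjective x
  rw [cosMode_proj]; exact Real.abs_cos_le_one _

lemma abs_sinMode_le (n : Fin d → ℤ) (x : Torus d) : |sinMode n x| ≤ 1 := by
  obtain ⟨y, rfl⟩ := proj_surjective x
  rw [sinMode_proj]; exact Real.abs_sin_le_one _

lemma phase_single (n : Fin d → ℤ) (i : Fin d) : phase n (Pi.single i 1) = n i := by
  rw [phase_apply]; simp [Pi.single_apply]

lemma dpartial_cosMode (n : Fin d → ℤ) (i : Fin d) :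
    dpartial i (cosMode n) = (-(2 * Real.pi * n i)) • sinMode n := by
  ext x
  obtain ⟨y, rfl⟩ := proj_surjective x
  rw [dpartial_apply, pderiv_proj, SmoothFun.smul_apply, sinMode_proj]
  simp_rw [cosMode_proj]
  have h := (((phase n).hasFDerivAt (x := y)).const_mul (2 * Real.pi)).cos
  rw [h.fderiv]
  simp [phase_single]
  ring

lemma dpartial_sinMode (n : Fin d → ℤ) (i : Fin d) :
    dpartial i (sinMode n) = (2 * Real.pi * n i) • cosMode n := by
  ext x
  obtain ⟨y, rfl⟩ := proj_surjective x
  rw [dpartial_apply, pderiv_proj, SmoothFun.smul_apply, cosMode_proj]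
  simp_rw [sinMode_proj]
  have h := (((phase n).hasFDerivAt (x := y)).const_mul (2 * Real.pi)).sin
  rw [h.fderiv]
  simp [phase_single]
  ring

/-- Even orders keep cosine and sine modes separate: each is an eigenfunction of `∂ᵢ²`, although
`∂ᵢ` exchanges them. -/
lemma iterPartial_replicate_two_mul {i : Fin d} {c : ℝ} {φ : SmoothFun d}
    (hφ : dpartial i (dpartial i φ) = c • φ) (k : ℕ) :
    iterPartial (List.replicate (2 * k) i) φ = c ^ k • φ := by
  induction k with
  | zero => simp [iterPartial]
  | succ k ih =>
    have : iterPartial (List.replicate (2 * (k + 1)) i) φ =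
        dpartial i (dpartial i (iterPartial (List.replicate (2 * k) i) φ)) := by
      rw [show 2 * (k + 1) = 2 * k + 1 + 1 by ring, List.replicate_succ, List.replicate_succ]
      rfl
    rw [this, ih, dpartial_smul, dpartial_smul, hφ, smul_smul, pow_succ]

lemma dpartial_dpartial_cosMode (n : Fin d → ℤ) (i : Fin d) :
    dpartial i (dpartial i (cosMode n)) = (-(2 * Real.pi * n i) ^ 2) • cosMode n := by
  rw [dpartial_cosMode, dpartial_smul, dpartial_sinMode, smul_smul]
  congr 1; ring

lemma dpartial_dpartial_sinMode (n : Fin d → ℤ) (i : Fin d) :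
    dpartial i (dpartial i (sinMode n)) = (-(2 * Real.pi * n i) ^ 2) • sinMode n := by
  rw [dpartial_sinMode, dpartial_smul, dpartial_cosMode, smul_smul]
  congr 1; ring

/-- The weak derivative tested against an eigenfunction produces the eigenvalue to the power `k` as
a factor of the Fourier integral. -/
lemma pow_mul_abs_integral_le {i : Fin d} {a : ℝ} {φ : SmoothFun d}
    (hφ : dpartial i (dpartial i φ) = (-a ^ 2) • φ) (hb : ∀ x, |φ x| ≤ 1) {k : ℕ}
    {f w : Torus d → ℝ} (hw : Integrable w) (h : IsWeakDeriv (List.replicate (2 * k) i) f w) :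
    |a| ^ (2 * k) * |∫ x, f x * φ x| ≤ ∫ x, |w x| := by
  have h1 := h φ
  rw [iterPartial_replicate_two_mul hφ] at h1
  simp only [SmoothFun.smul_apply, List.length_replicate] at h1
  have h2 : ∫ x, f x * ((-a ^ 2) ^ k * φ x) = (-a ^ 2) ^ k * ∫ x, f x * φ x := by
    rw [← integral_const_mul]; congr 1; funext x; ring
  rw [h2] at h1
  have h3 := congrArg abs h1
  rw [abs_mul, abs_mul, abs_pow, abs_neg, abs_pow, ← pow_mul, abs_pow, abs_neg, abs_one, one_pow,
    one_mul] at h3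
  rw [h3]
  refine (abs_integral_le_integral_abs).trans ?_
  refine integral_mono_of_nonneg (Eventually.of_forall fun x => abs_nonneg _) hw.abs
    (Eventually.of_forall fun x => ?_)
  simp only [abs_mul]
  nlinarith [hb x, abs_nonneg (w x)]

/-- The Fourier coefficients of a continuous real function. -/
def fcoeff (f : C(Torus d, ℝ)) (n : Fin d → ℤ) : ℂ :=
  ((∫ x, f x * cosMode n x : ℝ) : ℂ) - ((∫ x, f x * sinMode n x : ℝ) : ℂ) * Complex.I

/-- A continuous real function, regarded as complex-valued. -/
def toComplex (f : C(Torus d, ℝ)) : C(Torus d, ℂ) := ⟨fun x => (f x : ℂ), by fun_prop⟩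

lemma mFourierCoeff_eq_fcoeff (f : C(Torus d, ℝ)) (n : Fin d → ℤ) :
    UnitAddTorus.mFourierCoeff (toComplex f) n = fcoeff f n := by
  have h1 : UnitAddTorus.mFourierCoeff (toComplex f) n =
      ∫ x : Torus d, UnitAddTorus.mFourier (-n) x • toComplex f x := by
    rw [volume_torus_eq]; rfl
  rw [h1, fcoeff]
  have hc : Integrable fun x => f x * cosMode n x :=
    integrable_of_continuous (f.continuous.mul (continuous_smooth _))
  have hs : Integrable fun x => f x * sinMode n x :=
    integrable_of_continuous (f.continuous.mul (continuous_smooth _))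
  rw [← integral_complex_ofReal, ← integral_complex_ofReal, ← integral_mul_const,
    ← integral_sub hc.ofReal (hs.ofReal.mul_const _)]
  congr 1
  funext x
  rw [UnitAddTorus.mFourier_neg]
  simp only [toComplex, ContinuousMap.coe_mk, cosMode, sinMode, smoothOfLift_apply]
  apply Complex.ext <;> simp [mul_comm]

lemma norm_fcoeff_le (f : C(Torus d, ℝ)) (n : Fin d → ℤ) :
    ‖fcoeff f n‖ ≤ |∫ x, f x * cosMode n x| + |∫ x, f x * sinMode n x| := by
  refine (norm_sub_le _ _).trans ?_
  simp

/-- Decay of the Fourier coefficients. -/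
lemma norm_fcoeff_le_of_weakDeriv {f : C(Torus d, ℝ)} {k : ℕ} {w : Fin d → Torus d → ℝ} {W : ℝ}
    (hw : ∀ i, Integrable (w i)) (h : ∀ i, IsWeakDeriv (List.replicate (2 * k) i) f (w i))
    (hW : ∀ i, ∫ x, |w i x| ≤ W) (hW0 : ∫ x, |f x| ≤ W) (n : Fin d → ℤ) :
    ‖fcoeff f n‖ ≤ 2 * W * (max 1 (‖n‖ ^ (2 * k)))⁻¹ := by
  have hfi : Integrable f := integrable_of_continuous f.continuous
  have hmode : ∀ φ : SmoothFun d, (∀ x, |φ x| ≤ 1) →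
      (∀ i, dpartial i (dpartial i φ) = (-(2 * Real.pi * n i) ^ 2) • φ) →
      max 1 (‖n‖ ^ (2 * k)) * |∫ x, f x * φ x| ≤ W := by
    intro φ hb hφ
    rw [max_mul_of_nonneg _ _ (abs_nonneg _), max_le_iff]
    have h0 : |∫ x, f x * φ x| ≤ W := by
      refine (abs_integral_le_integral_abs).trans (le_trans ?_ hW0)
      refine integral_mono_of_nonneg (Eventually.of_forall fun x => abs_nonneg _) hfi.abs
        (Eventually.of_forall fun x => ?_)
      simp only [abs_mul]
      nlinarith [hb x, abs_nonneg (f x)]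
    refine ⟨by rwa [one_mul], ?_⟩
    rcases isEmpty_or_nonempty (Fin d) with he | he
    · have : ‖n‖ ≤ 1 := by simp [Subsingleton.elim n 0]
      refine le_trans ?_ h0
      have := pow_le_one₀ (n := 2 * k) (norm_nonneg n) this
      nlinarith [abs_nonneg (∫ x, f x * φ x)]
    -- The direction realising the sup norm of `n`, so that `2π|nᵢ|` dominates `‖n‖`.
    · obtain ⟨i, hi⟩ := Finite.exists_max fun i => ‖n i‖
      have hn : ‖n‖ ≤ |2 * Real.pi * n i| := by
        have h1 : ‖n‖ ≤ ‖n i‖ := (pi_norm_le_iff_of_nonneg (norm_nonneg _)).2 hi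
        have h2 : ‖n i‖ = |(n i : ℝ)| := by rw [Int.norm_eq_abs]
        rw [abs_mul, abs_of_pos (by positivity : (0 : ℝ) < 2 * Real.pi)]
        nlinarith [abs_nonneg (n i : ℝ), Real.pi_gt_three]
      have h1 := (pow_mul_abs_integral_le (hφ i) hb (hw i) (h i)).trans (hW i)
      refine le_trans ?_ h1
      gcongr
  have hpos : 0 < max 1 (‖n‖ ^ (2 * k)) := lt_max_of_lt_left one_pos
  have h1 := hmode (cosMode n) (abs_cosMode_le n) (dpartial_dpartial_cosMode n)
  have h2 := hmode (sinMode n) (abs_sinMode_le n) (dpartial_dpartial_sinMode n)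
  rw [← div_eq_mul_inv, le_div_iff₀ hpos]
  have := norm_fcoeff_le f n
  nlinarith

/-- Comparison with the convergent lattice series `∑ ‖n‖^{-r}`, `r > d`, over `ℤ^d` inside `ℝ^d`. -/
lemma summable_weight {r : ℕ} (hr : d < r) :
    Summable fun n : Fin d → ℤ => (max 1 (‖n‖ ^ r))⁻¹ := by
  let b := Pi.basisFun ℝ (Fin d)
  let L := Submodule.span ℤ (Set.range b)
  have hfin : Module.finrank ℤ L = d := by
    simpa using Module.finrank_eq_card_basis (b.restrictScalars ℤ)
  have h1 := ZLattice.summable_norm_pow_inv L r (by rw [hfin]; exact hr)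
  let e : (Fin d → ℤ) → L := fun n => ⟨fun i => (n i : ℝ), by
    have : (fun i => (n i : ℝ)) = ∑ i, n i • b i := by
      funext j
      simp [b, Pi.single_apply]
    rw [this]
    exact Submodule.sum_mem _ fun i _ =>
      Submodule.smul_mem _ _ (Submodule.subset_span (mem_range_self i))⟩
  have he : Function.Injective e := by
    intro n m h
    funext i
    have h' : ((n i : ℤ) : ℝ) = (m i : ℤ) := congrFun (congrArg Subtype.val h) i
    exact_mod_cast h'
  have h2 := h1.comp_injective he
  have h3 : ∀ n : Fin d → ℤ, ‖e n‖ = ‖n‖ := by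
    intro n
    simp only [e, Pi.norm_def, Submodule.coe_norm]
    rfl
  -- The origin is added separately: its weight is `1`, whereas its term in the lattice series is
  -- `0` since `0⁻¹ = 0`.
  have h4 : Summable fun n : Fin d → ℤ => if n = 0 then (1 : ℝ) else 0 :=
    summable_of_ne_finset_zero (s := {0}) fun n hn => by
      rw [Finset.mem_singleton] at hn
      simp [hn]
  refine (h4.add h2).of_nonneg_of_le (fun n => by positivity) fun n => ?_
  simp only [Function.comp_apply, h3]
  by_cases hn : n = 0
  · simp only [hn, if_true]
    have : (max 1 (‖(0 : Fin d → ℤ)‖ ^ r))⁻¹ ≤ 1 := inv_le_one_of_one_le₀ (le_max_left _ _)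
    have h5 : 0 ≤ ‖(0 : Fin d → ℤ)‖⁻¹ ^ r := by positivity
    linarith
  · simp only [hn, if_false, zero_add, inv_pow]
    have : 0 < ‖n‖ := norm_pos_iff.2 hn
    gcongr
    exact le_max_right _ _

lemma hasSum_fcoeff {f : C(Torus d, ℝ)} (hs : Summable (fcoeff f)) (x : Torus d) :
    HasSum (fun n => fcoeff f n • UnitAddTorus.mFourier n x) (f x : ℂ) := by
  have h1 : UnitAddTorus.mFourierCoeff (toComplex f) = fcoeff f :=
    funext (mFourierCoeff_eq_fcoeff f)
  have h2 := UnitAddTorus.hasSum_mFourier_series_apply_of_summable (f := toComplex f)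
    (by rw [h1]; exact hs) x
  rw [h1] at h2
  exact h2

/-- The Sobolev embedding into `C⁰`, with explicit derivatives. -/
lemma abs_le_of_weakDeriv : ∃ C : ℝ, 0 ≤ C ∧ ∀ (f : C(Torus d, ℝ)) (w : Fin d → Torus d → ℝ) (W : ℝ),
    (∀ i, Integrable (w i)) → (∀ i, IsWeakDeriv (List.replicate (2 * (d + 1)) i) f (w i)) →
    (∀ i, ∫ x, |w i x| ≤ W) → (∫ x, |f x| ≤ W) → ∀ x, |f x| ≤ C * W := by
  have hsum := summable_weight (d := d) (r := 2 * (d + 1)) (by omega)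
  refine ⟨2 * ∑' n : Fin d → ℤ, (max 1 (‖n‖ ^ (2 * (d + 1))))⁻¹,
    mul_nonneg zero_le_two (tsum_nonneg fun n => by positivity), ?_⟩
  intro f w W hw h hW hW0 x
  have hb := norm_fcoeff_le_of_weakDeriv hw h hW hW0
  have hs2 := hsum.mul_left (2 * W)
  have hs : Summable (fcoeff f) := Summable.of_norm_bounded hs2 hb
  have h1 := hasSum_fcoeff hs x
  have h2 : ‖(f x : ℂ)‖ ≤ ∑' n : Fin d → ℤ, 2 * W * (max 1 (‖n‖ ^ (2 * (d + 1))))⁻¹ := by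
    rw [← h1.tsum_eq]
    refine tsum_of_norm_bounded hs2.hasSum fun n => ?_
    rw [norm_smul]
    have h3 : ‖UnitAddTorus.mFourier n x‖ ≤ 1 :=
      ((UnitAddTorus.mFourier n).norm_coe_le_norm x).trans UnitAddTorus.mFourier_norm.le
    calc ‖fcoeff f n‖ * ‖UnitAddTorus.mFourier n x‖ ≤ ‖fcoeff f n‖ * 1 := by gcongr
      _ ≤ _ := by rw [mul_one]; exact hb n
  rw [tsum_mul_left, Complex.norm_real, Real.norm_eq_abs] at h2
  linarith

lemma norm_iteratedFDeriv_mode_le (n : Fin d → ℤ) (j : ℕ) (y : Fin d → ℝ) :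
    ‖iteratedFDeriv ℝ j (fun y : Fin d → ℝ => UnitAddTorus.mFourier n (proj y)) y‖ ≤
      (2 * Real.pi * d * ‖n‖) ^ j := by
  have hE : ∀ c : ℂ, ContDiff ℝ ∞ (fun t : ℝ => Complex.exp (c * t)) := fun c =>
    Complex.contDiff_exp.comp (contDiff_const.mul Complex.ofRealCLM.contDiff)
  have hD : ∀ (j : ℕ) (c : ℂ), iteratedDeriv j (fun t : ℝ => Complex.exp (c * t)) =
      fun t : ℝ => c ^ j * Complex.exp (c * t) := by
    intro j c
    induction j with
    | zero => simp
    | succ j ih =>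
      rw [iteratedDeriv_succ, ih]
      funext t
      have h1 : HasDerivAt (fun t : ℝ => c * (t : ℂ)) c t := by
        simpa using (Complex.ofRealCLM.hasDerivAt (x := t)).const_mul c
      rw [(h1.cexp.const_mul (c ^ j)).deriv, pow_succ]
      ring
  set c : ℂ := ((2 * Real.pi : ℝ) : ℂ) * Complex.I with hc
  have hfun : (fun y : Fin d → ℝ => UnitAddTorus.mFourier n (proj y)) =
      (fun t : ℝ => Complex.exp (c * t)) ∘ phase n := by
    funext y
    rw [mFourier_proj, Function.comp_apply]
    congr 1
    rw [hc]; push_cast; ring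
  rw [hfun, ContinuousLinearMap.iteratedFDeriv_comp_right (phase n) ((hE c).of_le (m := j) (by exact_mod_cast le_top)) y le_rfl]
  refine (ContinuousMultilinearMap.norm_compContinuousLinearMap_le _ _).trans ?_
  rw [norm_iteratedFDeriv_eq_norm_iteratedDeriv, hD]
  have h5 : ‖c ^ j * Complex.exp (c * (phase n y : ℝ))‖ = (2 * Real.pi) ^ j := by
    rw [norm_mul, norm_pow]
    have h6 : c * (phase n y : ℝ) = ((2 * Real.pi * phase n y : ℝ) : ℂ) * Complex.I := by
      rw [hc]; push_cast; ring
    rw [h6, Complex.norm_exp_ofReal_mul_I, mul_one]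
    congr 1
    rw [hc, norm_mul, Complex.norm_I, mul_one, Complex.norm_real, Real.norm_eq_abs,
      abs_of_pos (by positivity)]
  rw [h5, Finset.prod_const, Finset.card_univ, Fintype.card_fin, ← mul_pow]
  have := norm_phase_le n
  rw [mul_assoc (2 * Real.pi)]
  gcongr

/-- A continuous function with integrable weak derivatives of all orders is smooth. -/
lemma contDiff_of_weakDeriv {f : C(Torus d, ℝ)}
    (h : ∀ (k : ℕ) (i : Fin d), ∃ w : Torus d → ℝ, Integrable w ∧
      IsWeakDeriv (List.replicate (2 * k) i) f w) :
    ContDiff ℝ ∞ (fun y : Fin d → ℝ => f (proj y)) := by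
  choose w hw hd using h
  have hdecay : ∀ k : ℕ, ∃ W : ℝ, 0 ≤ W ∧ ∀ n, ‖fcoeff f n‖ ≤ W * (max 1 (‖n‖ ^ (2 * k)))⁻¹ := by
    intro k
    have hnn : ∀ i, 0 ≤ ∫ x, |w k i x| := fun i => integral_nonneg fun x => abs_nonneg _
    have hn0 : 0 ≤ ∫ x, |f x| := integral_nonneg fun x => abs_nonneg _
    refine ⟨2 * ((∑ i, ∫ x, |w k i x|) + ∫ x, |f x|),
      mul_nonneg zero_le_two (add_nonneg (Finset.sum_nonneg fun i _ => hnn i) hn0), ?_⟩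
    refine norm_fcoeff_le_of_weakDeriv (hw k) (hd k) (fun i => ?_) ?_
    · have := Finset.single_le_sum (f := fun i => ∫ x, |w k i x|) (fun i _ => hnn i)
        (Finset.mem_univ i)
      linarith
    · have := Finset.sum_nonneg (s := Finset.univ) fun i _ => hnn i
      linarith
  choose W hW0 hW using hdecay
  have hsum := summable_weight (d := d) (r := 2 * (d + 1)) (by omega)
  have hs : Summable (fcoeff f) := Summable.of_norm_bounded (hsum.mul_left (W (d + 1))) (hW (d + 1))
  have hmode : ∀ n : Fin d → ℤ, ContDiff ℝ ∞
      (fun y : Fin d → ℝ => UnitAddTorus.mFourier n (proj y)) := by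
    intro n
    simp_rw [mFourier_proj]
    exact Complex.contDiff_exp.comp ((Complex.ofRealCLM.contDiff.comp
      (contDiff_const.mul (phase n).contDiff)).mul contDiff_const)
  have hc : ContDiff ℝ ∞ (fun y : Fin d → ℝ =>
      ∑' n, fcoeff f n • UnitAddTorus.mFourier n (proj y)) := by
    -- The `j`-th derivative of a mode grows like `‖n‖ ^ j`. Using the coefficient decay of order
    -- `2(j + d + 1)` pays for this growth and still leaves the summable weight of order `2(d + 1)`.
    refine contDiff_tsum (N := ⊤)
      (v := fun j n => W (j + (d + 1)) * (2 * Real.pi * d) ^ j * (max 1 (‖n‖ ^ (2 * (d + 1))))⁻¹)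
      (fun n => (hmode n).const_smul _) (fun j _ => hsum.mul_left _) ?_
    intro j n y _
    have h1 : iteratedFDeriv ℝ j (fun y => fcoeff f n • UnitAddTorus.mFourier n (proj y)) y =
        fcoeff f n • iteratedFDeriv ℝ j (fun y => UnitAddTorus.mFourier n (proj y)) y :=
      iteratedFDeriv_const_smul_apply'
        ((hmode n).of_le (m := j) (by exact_mod_cast le_top)).contDiffAt
    rw [h1, norm_smul]
    have h2 := norm_iteratedFDeriv_mode_le n j y
    have h3 := hW (j + (d + 1)) n
    have hm : 0 < max 1 (‖n‖ ^ (2 * (d + 1))) := lt_max_of_lt_left one_pos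
    have hm' : 0 < max 1 (‖n‖ ^ (2 * (j + (d + 1)))) := lt_max_of_lt_left one_pos
    have h4 : (max 1 (‖n‖ ^ (2 * (j + (d + 1)))))⁻¹ * ‖n‖ ^ j ≤
        (max 1 (‖n‖ ^ (2 * (d + 1))))⁻¹ := by
      rw [inv_mul_le_iff₀ hm', ← div_eq_mul_inv, le_div_iff₀ hm]
      rcases le_total ‖n‖ 1 with hn | hn
      · have e1 : ‖n‖ ^ (2 * (d + 1)) ≤ 1 := pow_le_one₀ (norm_nonneg _) hn
        have e2 : ‖n‖ ^ j ≤ 1 := pow_le_one₀ (norm_nonneg _) hn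
        rw [max_eq_left e1, mul_one]
        exact e2.trans (le_max_left _ _)
      · have e1 : 1 ≤ ‖n‖ ^ (2 * (d + 1)) := one_le_pow₀ hn
        rw [max_eq_right e1, ← pow_add]
        refine le_trans ?_ (le_max_right _ _)
        exact pow_le_pow_right₀ hn (by omega)
    calc ‖fcoeff f n‖ * ‖iteratedFDeriv ℝ j (fun y => UnitAddTorus.mFourier n (proj y)) y‖
        ≤ (W (j + (d + 1)) * (max 1 (‖n‖ ^ (2 * (j + (d + 1)))))⁻¹) *
          (2 * Real.pi * d * ‖n‖) ^ j := by
          gcongr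
          exact mul_nonneg (hW0 _) (by positivity)
      _ = W (j + (d + 1)) * (2 * Real.pi * d) ^ j *
          ((max 1 (‖n‖ ^ (2 * (j + (d + 1)))))⁻¹ * ‖n‖ ^ j) := by ring
      _ ≤ _ := by
          have := hW0 (j + (d + 1))
          gcongr
  have hre := Complex.reCLM.contDiff.comp hc
  convert hre using 1
  funext y
  simp only [Function.comp_apply, (hasSum_fcoeff hs (proj y)).tsum_eq, Complex.reCLM_apply,
    Complex.ofReal_re]

/-! ### The nonlocal operator on smooth densities -/

lemma iterPartial_add (l : List (Fin d)) (f g : SmoothFun d) :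
    iterPartial l (f + g) = iterPartial l f + iterPartial l g := by
  induction l with
  | nil => rfl
  | cons i l ih =>
    change dpartial i (iterPartial l (f + g)) = _
    rw [ih, dpartial_add]; rfl

lemma iterPartial_smul (l : List (Fin d)) (c : ℝ) (f : SmoothFun d) :
    iterPartial l (c • f) = c • iterPartial l f := by
  induction l with
  | nil => rfl
  | cons i l ih =>
    change dpartial i (iterPartial l (c • f)) = _
    rw [ih, dpartial_smul]; rfl

/-- A smooth function as an element of `L²`. -/
def smoothToLp (f : SmoothFun d) : Lp ℝ 2 (volume : Measure (Torus d)) :=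
  ContinuousMap.toLp 2 volume ℝ f.1

lemma smoothToLp_ae (f : SmoothFun d) : smoothToLp f =ᵐ[volume] f :=
  ContinuousMap.coeFn_toLp volume f.1

/-- A smooth function as an element of `W^{κ,2}`. -/
def smoothToSobolev (κ : ℕ) : SmoothFun d →ₗ[ℝ] Sobolev d κ where
  toFun f := ⟨WithLp.toLp 2 fun a => smoothToLp (iterPartial (List.ofFn a.2).reverse f), by
    intro a φ
    have h := isWeakDeriv_smooth (List.ofFn a.2) f φ
    have h0 : iterPartial (List.ofFn (SobolevIndex.zero d κ).2).reverse f = f := by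
      simp [SobolevIndex.zero, iterPartial]
    have e1 : ∀ (g ψ : SmoothFun d), ∫ x, smoothToLp g x * ψ x = ∫ x, g x * ψ x := fun g ψ =>
      integral_congr_ae ((smoothToLp_ae g).mul (ae_eq_refl _))
    simp only [h0, e1]
    exact h⟩
  map_add' f g := by
    apply Subtype.ext
    ext a : 1
    simp only [iterPartial_add]
    exact map_add (ContinuousMap.toLp 2 volume ℝ) _ _
  map_smul' c f := by
    apply Subtype.ext
    ext a : 1
    simp only [iterPartial_smul]
    exact map_smul (ContinuousMap.toLp 2 volume ℝ) _ _

lemma sobolevFn_smoothToSobolev (κ : ℕ) (f : SmoothFun d) :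
    sobolevFn (smoothToSobolev κ f) =ᵐ[volume] f := by
  have h0 : iterPartial (List.ofFn (SobolevIndex.zero d κ).2).reverse f = f := by
    simp [SobolevIndex.zero, iterPartial]
  have h1 : sobolevFn (smoothToSobolev κ f) =
      smoothToLp (iterPartial (List.ofFn (SobolevIndex.zero d κ).2).reverse f) := rfl
  rw [h1, h0]
  exact smoothToLp_ae f

lemma Mac.ofDensity_congr {f g : Torus d → ℝ} (hf : Integrable f) (hg : Integrable g)
    (h : f =ᵐ[volume] g) : Mac.ofDensity f hf = Mac.ofDensity g hg := by
  apply Subtype.ext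
  refine withDensity_congr_ae ?_
  filter_upwards [h] with x hx
  rw [hx]

lemma integral_abs_le_norm (f : Lp ℝ 2 (volume : Measure (Torus d))) : ∫ x, |f x| ≤ ‖f‖ := by
  have h1 : Integrable f := (Lp.memLp f).integrable (by norm_num)
  have h2 : ∫ x, |f x| = (eLpNorm f 1 volume).toReal := by
    rw [eLpNorm_one_eq_lintegral_enorm, ← integral_norm_eq_lintegral_enorm h1.1]
    rfl
  rw [h2, Lp.norm_def]
  refine ENNReal.toReal_mono (Lp.eLpNorm_ne_top f) ?_
  exact eLpNorm_le_eLpNorm_of_exponent_le (by norm_num) h1.1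

/-- Indices of the pure derivatives. -/
lemma isWeakDeriv_of_sobolev {κ k : ℕ} (hk : k ≤ κ) (F : Sobolev d κ) {f : Torus d → ℝ}
    (hf : sobolevFn F =ᵐ[volume] f) (i : Fin d) :
    IsWeakDeriv (List.replicate k i) f (F.1 ⟨⟨k, by omega⟩, fun _ => i⟩) := by
  intro φ
  have h := F.2 ⟨⟨k, by omega⟩, fun _ => i⟩ φ
  rw [List.ofFn_const] at h
  rw [← h]
  exact integral_congr_ae (hf.symm.mul (ae_eq_refl _))

lemma contDiff_of_sobolev {f : C(Torus d, ℝ)}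
    (h : ∀ κ : ℕ, (d : ℝ) / 2 + 1 < κ → ∃ F : Sobolev d κ, sobolevFn F =ᵐ[volume] f) :
    ContDiff ℝ ∞ (fun y : Fin d → ℝ => f (proj y)) := by
  refine contDiff_of_weakDeriv fun k i => ?_
  -- This order admits `2k` derivatives and also exceeds `d/2 + 1`.
  obtain ⟨F, hF⟩ := h (2 * k + d + 2) (by push_cast; have : (0 : ℝ) ≤ d := by positivity
                                          have : (0 : ℝ) ≤ k := by positivity
                                          linarith)
  exact ⟨_, (Lp.memLp _).integrable (by norm_num),
    isWeakDeriv_of_sobolev (k := 2 * k) (by omega) F hF i⟩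

/-- The Sobolev embedding `W^{2d+2,2} ⊂ C⁰`. -/
lemma exists_abs_le_norm_sobolev (d : ℕ) : ∃ C : ℝ, 0 ≤ C ∧
    ∀ (F : Sobolev d (2 * (d + 1))) (f : C(Torus d, ℝ)), sobolevFn F =ᵐ[volume] f →
      ∀ x, |f x| ≤ C * ‖F‖ := by
  obtain ⟨C, hC, h⟩ := abs_le_of_weakDeriv (d := d)
  refine ⟨C, hC, fun F f hF => h f
    (fun i => F.1 ⟨⟨2 * (d + 1), by omega⟩, fun _ => i⟩) ‖F‖ ?_ ?_ ?_ ?_⟩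
  · exact fun i => (Lp.memLp _).integrable (by norm_num)
  · exact isWeakDeriv_of_sobolev le_rfl F hF
  · exact fun i => (integral_abs_le_norm _).trans (PiLp.norm_apply_le F.1 _)
  · have h1 : ∫ x, |f x| = ∫ x, |sobolevFn F x| := by
      refine integral_congr_ae ?_
      filter_upwards [hF] with x hx
      rw [hx]
    rw [h1]
    exact (integral_abs_le_norm _).trans (PiLp.norm_apply_le F.1 _)

/-- The Sobolev representative of `η` equals `η` only almost everywhere, which suffices because a
measure depends on its density only up to null sets. -/
lemma nonlocal_ae {h : Mac d → C(Torus d, ℝ)} {κ : ℕ} {hκ : Sobolev d κ → Sobolev d κ}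
    (hh : ∀ F : Sobolev d κ, 0 ≤ᵐ[volume] sobolevFn F →
        sobolevFn (hκ F) =ᵐ[volume] h (Mac.ofDensity (sobolevFn F) (integrable_sobolevFn F)))
    {η : SmoothFun d} (hη : ∀ x, 0 ≤ η x) :
    sobolevFn (hκ (smoothToSobolev κ η)) =ᵐ[volume] h (smoothMeasure η) := by
  have h1 := sobolevFn_smoothToSobolev κ η
  have h2 := hh (smoothToSobolev κ η) (by filter_upwards [h1] with x hx; rw [hx]; exact hη x)
  rwa [Mac.ofDensity_congr _ (integrable_smooth η) h1] at h2

lemma contDiff_nonlocal {h : Mac d → C(Torus d, ℝ)} (hyp : HypNonlocal h) {η : SmoothFun d}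
    (hη : ∀ x, 0 ≤ η x) :
    ContDiff ℝ ∞ (fun y : Fin d → ℝ => h (smoothMeasure η) (proj y)) := by
  refine contDiff_of_sobolev fun κ hκ => ?_
  obtain ⟨k, hk, -⟩ := hyp κ hκ
  exact ⟨_, nonlocal_ae hk hη⟩

lemma sobolevFn_sub {κ : ℕ} (F G : Sobolev d κ) :
    sobolevFn (F - G) =ᵐ[volume] fun x => sobolevFn F x - sobolevFn G x :=
  Lp.coeFn_sub (F.1 (SobolevIndex.zero d κ)) (G.1 (SobolevIndex.zero d κ))

/-- `h` is continuous along segments of smooth nonnegative densities. -/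
lemma continuous_nonlocal_segment {h : Mac d → C(Torus d, ℝ)} (hyp : HypNonlocal h)
    (η δ : SmoothFun d) (S : Set ℝ) (hS : ∀ t ∈ S, ∀ x, 0 ≤ (η + t • δ) x) :
    Continuous fun t : S => h (smoothMeasure (η + (t : ℝ) • δ)) := by
  obtain ⟨C, hC, hsup⟩ := exists_abs_le_norm_sobolev d
  obtain ⟨hκ, hk, hdiff⟩ := hyp (2 * (d + 1)) (by
    push_cast; have : (0 : ℝ) ≤ d := by positivity
    linarith)
  set Φ : S → Sobolev d (2 * (d + 1)) := fun t =>
    hκ (smoothToSobolev _ (η + (t : ℝ) • δ)) with hΦ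
  -- The segment is affine in `W^{2d+2,2}` and stays in the cone of nonnegative elements, where
  -- differentiability gives continuity. The Sobolev embedding then upgrades this to the sup norm.
  have hΦc : Continuous Φ := by
    refine hdiff.continuousOn.comp_continuous ?_ ?_
    · simp only [map_add, map_smul]
      exact continuous_const.add (continuous_subtype_val.smul continuous_const)
    · intro t
      simp only [mem_ofPred_eq]
      filter_upwards [sobolevFn_smoothToSobolev (2 * (d + 1)) (η + (t : ℝ) • δ)] with x hx
      rw [hx]
      exact hS t t.2 x
  rw [continuous_iff_continuousAt]
  intro t₀
  rw [ContinuousAt, tendsto_iff_norm_sub_tendsto_zero]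
  have hlim : Tendsto (fun t => C * ‖Φ t - Φ t₀‖) (𝓝 t₀) (𝓝 0) := by
    have := (tendsto_iff_norm_sub_tendsto_zero.1 (hΦc.tendsto t₀)).const_mul C
    simpa using this
  refine squeeze_zero (fun _ => norm_nonneg _) (fun t => ?_) hlim
  rw [ContinuousMap.norm_le _ (by positivity)]
  refine hsup _ (h (smoothMeasure (η + (t : ℝ) • δ)) - h (smoothMeasure (η + (t₀ : ℝ) • δ))) ?_
  filter_upwards [sobolevFn_sub (Φ t) (Φ t₀), nonlocal_ae hk (hS t t.2),
    nonlocal_ae hk (hS t₀ t₀.2)] with x h1 h2 h3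
  rw [h1, ContinuousMap.sub_apply, ← h2, ← h3]

/-! ### Regularity of the Hamiltonian and of the operator `A` -/

/-- `(y, p, M, m, θ)`, with the space variable in `ℝ^d`. -/
abbrev JetSpace (d : ℕ) : Type :=
  (Fin d → ℝ) × EuclideanSpace ℝ (Fin d) × Mat d × ℝ × ℝ

/-- A Hamiltonian as a function on `JetSpace`. -/
def liftH (K : Hamiltonian d) (z : JetSpace d) : ℝ :=
  K (proj z.1) z.2.1 z.2.2.1 z.2.2.2.1 z.2.2.2.2

/-- The jets with `m ∈ E`. -/
def jetDomain (d : ℕ) (E : Set ℝ) : Set (JetSpace d) := {z | z.2.2.2.1 ∈ E}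

/-- `E` is one of the two half-lines. -/
def IsHalfLine (E : Set ℝ) : Prop := E = Ioi 0 ∨ E = Ici 0

lemma IsHalfLine.convex {E : Set ℝ} (hE : IsHalfLine E) : Convex ℝ E := by
  rcases hE with rfl | rfl
  · exact convex_Ioi 0
  · exact convex_Ici 0

lemma IsHalfLine.pos_mem {E : Set ℝ} (hE : IsHalfLine E) {r : ℝ} (hr : 0 < r) : r ∈ E := by
  rcases hE with rfl | rfl
  · exact hr
  · exact hr.le

lemma IsHalfLine.nonneg {E : Set ℝ} (hE : IsHalfLine E) {r : ℝ} (hr : r ∈ E) : 0 ≤ r := by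
  rcases hE with rfl | rfl
  · exact le_of_lt hr
  · exact hr

/-- When `E` is closed the domain has a boundary, so derivatives of `H` are taken within it. They
are unique because the domain is convex with nonempty interior. -/
lemma uniqueDiffOn_jetDomain {E : Set ℝ} (hE : IsHalfLine E) :
    UniqueDiffOn ℝ (jetDomain d E) := by
  refine uniqueDiffOn_convex ?_ ?_
  · intro z hz w hw a b ha hb hab
    exact hE.convex hz hw ha hb hab
  · refine ⟨(0, 0, 0, 1, 0), ?_⟩
    have ho : IsOpen {z : JetSpace d | z.2.2.2.1 ∈ Ioi (0 : ℝ)} :=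
      isOpen_Ioi.preimage (by fun_prop : Continuous fun z : JetSpace d => z.2.2.2.1)
    have hs : {z : JetSpace d | z.2.2.2.1 ∈ Ioi (0 : ℝ)} ⊆ jetDomain d E :=
      fun z hz => hE.pos_mem hz
    exact interior_maximal hs ho (by simp)

lemma contDiffOn_fderivWithin_apply {E : Set ℝ} (hE : IsHalfLine E) {K : Hamiltonian d}
    (hK : ContDiffOn ℝ ∞ (liftH K) (jetDomain d E)) (e : JetSpace d) :
    ContDiffOn ℝ ∞ (fun z => fderivWithin ℝ (liftH K) (jetDomain d E) z e) (jetDomain d E) :=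
  (hK.fderivWithin (uniqueDiffOn_jetDomain hE) (m := ∞) (by simp)).clm_apply contDiffOn_const

/-- Varying `p` alone keeps `m` fixed and never leaves the domain. So the full derivative in `p` is
a directional value of the derivative within the domain, even at `m = 0`, and inherits its
smoothness. -/
lemma DpH_eq {E : Set ℝ} {K : Hamiltonian d}
    (hK : ContDiffOn ℝ ∞ (liftH K) (jetDomain d E)) (i : Fin d) {z : JetSpace d}
    (hz : z ∈ jetDomain d E) :
    liftH (DpH K i) z =
      fderivWithin ℝ (liftH K) (jetDomain d E) z (0, EuclideanSpace.single i 1, 0, 0, 0) := by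
  have h1 := ((hK.differentiableOn (by simp)) z hz).hasFDerivWithinAt
  have h2 : HasFDerivAt (fun q : EuclideanSpace ℝ (Fin d) =>
      ((z.1, q, z.2.2.1, z.2.2.2.1, z.2.2.2.2) : JetSpace d))
      ((0 : EuclideanSpace ℝ (Fin d) →L[ℝ] (Fin d → ℝ)).prod
        ((ContinuousLinearMap.id ℝ _).prod ((0 : _ →L[ℝ] Mat d).prod
          ((0 : _ →L[ℝ] ℝ).prod (0 : _ →L[ℝ] ℝ))))) z.2.1 :=
    (hasFDerivAt_const _ _).prodMk ((hasFDerivAt_id _).prodMk ((hasFDerivAt_const _ _).prodMk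
      ((hasFDerivAt_const _ _).prodMk (hasFDerivAt_const _ _))))
  have h3 := HasFDerivWithinAt.comp_hasFDerivAt (t := jetDomain d E) z.2.1 (g := liftH K) h1 h2
    (Eventually.of_forall fun q => hz)
  have h4 : liftH (DpH K i) z = fderiv ℝ (liftH K ∘ fun q : EuclideanSpace ℝ (Fin d) =>
      ((z.1, q, z.2.2.1, z.2.2.2.1, z.2.2.2.2) : JetSpace d)) z.2.1
        (EuclideanSpace.single i 1) := rfl
  rw [h4, h3.fderiv]
  rfl

lemma DMH_eq {E : Set ℝ} {K : Hamiltonian d}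
    (hK : ContDiffOn ℝ ∞ (liftH K) (jetDomain d E)) (i j : Fin d) {z : JetSpace d}
    (hz : z ∈ jetDomain d E) :
    liftH (DMH K i j) z =
      fderivWithin ℝ (liftH K) (jetDomain d E) z (0, 0, Pi.single i (Pi.single j 1), 0, 0) := by
  have h1 := ((hK.differentiableOn (by simp)) z hz).hasFDerivWithinAt
  have h2 : HasFDerivAt (fun q : Mat d =>
      ((z.1, z.2.1, q, z.2.2.2.1, z.2.2.2.2) : JetSpace d))
      ((0 : Mat d →L[ℝ] (Fin d → ℝ)).prod
        ((0 : Mat d →L[ℝ] EuclideanSpace ℝ (Fin d)).prod ((ContinuousLinearMap.id ℝ _).prod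
          ((0 : _ →L[ℝ] ℝ).prod (0 : _ →L[ℝ] ℝ))))) z.2.2.1 :=
    (hasFDerivAt_const _ _).prodMk ((hasFDerivAt_const _ _).prodMk ((hasFDerivAt_id _).prodMk
      ((hasFDerivAt_const _ _).prodMk (hasFDerivAt_const _ _))))
  have h3 := HasFDerivWithinAt.comp_hasFDerivAt (t := jetDomain d E) z.2.2.1 (g := liftH K) h1 h2
    (Eventually.of_forall fun q => hz)
  have h4 : liftH (DMH K i j) z = fderiv ℝ (liftH K ∘ fun q : Mat d =>
      ((z.1, z.2.1, q, z.2.2.2.1, z.2.2.2.2) : JetSpace d)) z.2.2.1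
        (Pi.single i (Pi.single j 1)) := rfl
  rw [h4, h3.fderiv]
  rfl

lemma contDiffOn_DpH {E : Set ℝ} (hE : IsHalfLine E) {K : Hamiltonian d}
    (hK : ContDiffOn ℝ ∞ (liftH K) (jetDomain d E)) (i : Fin d) :
    ContDiffOn ℝ ∞ (liftH (DpH K i)) (jetDomain d E) :=
  (contDiffOn_fderivWithin_apply hE hK _).congr fun _ hz => DpH_eq hK i hz

lemma contDiffOn_DMH {E : Set ℝ} (hE : IsHalfLine E) {K : Hamiltonian d}
    (hK : ContDiffOn ℝ ∞ (liftH K) (jetDomain d E)) (i j : Fin d) :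
    ContDiffOn ℝ ∞ (liftH (DMH K i j)) (jetDomain d E) :=
  (contDiffOn_fderivWithin_apply hE hK _).congr fun _ hz => DMH_eq hK i j hz

lemma contDiff_grad (v : SmoothFun d) : ContDiff ℝ ∞ (fun y : Fin d → ℝ => grad v (proj y)) := by
  rw [contDiff_piLp]
  exact fun i => contDiff_pderiv i v

lemma contDiff_hess (v : SmoothFun d) : ContDiff ℝ ∞ (fun y : Fin d → ℝ => hess v (proj y)) := by
  refine contDiff_pi.2 fun i => contDiff_pi.2 fun j => ?_
  exact contDiff_pderiv i (dpartial j v)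

/-- `K` evaluated along `(x, Dv, D²v, η, θ)`. -/
def alongJet (K : Hamiltonian d) (η v : SmoothFun d) (θ : C(Torus d, ℝ)) (x : Torus d) : ℝ :=
  K x (grad v x) (hess v x) (η x) (θ x)

lemma contDiff_alongJet {E : Set ℝ} {K : Hamiltonian d}
    (hK : ContDiffOn ℝ ∞ (liftH K) (jetDomain d E)) {η v : SmoothFun d} {θ : C(Torus d, ℝ)}
    (hη : ∀ x, η x ∈ E) (hθ : ContDiff ℝ ∞ (fun y : Fin d → ℝ => θ (proj y))) :
    ContDiff ℝ ∞ (fun y : Fin d → ℝ => alongJet K η v θ (proj y)) :=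
  hK.comp_contDiff (f := fun y : Fin d → ℝ =>
      ((y, grad v (proj y), hess v (proj y), η (proj y), θ (proj y)) : JetSpace d))
    (contDiff_id.prodMk ((contDiff_grad v).prodMk ((contDiff_hess v).prodMk
      ((contDiff_lift η).prodMk hθ)))) fun y => hη (proj y)

lemma dpartial_comm (i j : Fin d) (f : SmoothFun d) :
    dpartial i (dpartial j f) = dpartial j (dpartial i f) := by
  ext x
  obtain ⟨y, rfl⟩ := proj_surjective x
  have key : ∀ a b : Fin d, dpartial a (dpartial b f) (proj y) =
      fderiv ℝ (fderiv ℝ (fun z : Fin d → ℝ => f (proj z))) y (Pi.single a 1) (Pi.single b 1) := by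
    intro a b
    rw [dpartial_apply, pderiv_proj]
    have h1 : (fun z : Fin d → ℝ => dpartial b f (proj z)) = fun z =>
        fderiv ℝ (fun z : Fin d → ℝ => f (proj z)) z (Pi.single b 1) := by
      funext z
      rw [dpartial_apply, pderiv_proj]
    have h2 : Differentiable ℝ (fderiv ℝ (fun z : Fin d → ℝ => f (proj z))) :=
      ((contDiff_lift f).fderiv_right (m := ∞) (by simp)).differentiable (by simp)
    rw [h1, fderiv_clm_apply (h2 y) (differentiableAt_const _)]
    simp
  rw [key, key]
  have h3 : IsSymmSndFDerivAt ℝ (fun z : Fin d → ℝ => f (proj z)) y :=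
    (contDiff_lift f).contDiffAt.isSymmSndFDerivAt
      (by simpa using WithTop.coe_le_coe.2 (le_top : (2 : ℕ∞) ≤ ⊤))
  exact h3 _ _

lemma hess_apply (v : SmoothFun d) (x : Torus d) (i j : Fin d) :
    hess v x i j = dpartial i (dpartial j v) x := rfl

/-- The data with smooth `H` and `h` for which `A` acts on smooth functions. -/
structure Regular (E : Set ℝ) (H : Hamiltonian d) (h : Mac d → C(Torus d, ℝ)) : Prop where
  half : IsHalfLine E
  smooth : HypSmooth E H
  nonlocal : HypNonlocal h

namespace Regular

variable {E : Set ℝ} {H : Hamiltonian d} {h : Mac d → C(Torus d, ℝ)}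

lemma contDiffOn (R : Regular E H h) : ContDiffOn ℝ ∞ (liftH H) (jetDomain d E) := R.smooth

/-- `K(x, Dv, D²v, η, h(η))` as a smooth function. -/
def jet (R : Regular E H h) {K : Hamiltonian d}
    (hK : ContDiffOn ℝ ∞ (liftH K) (jetDomain d E)) {η : SmoothFun d} (hη : ∀ x, η x ∈ E)
    (v : SmoothFun d) : SmoothFun d :=
  smoothOfLift (alongJet K η v (h (smoothMeasure η)))
    (contDiff_alongJet hK hη (contDiff_nonlocal R.nonlocal fun x => R.half.nonneg (hη x)))

lemma jet_apply (R : Regular E H h) {K : Hamiltonian d}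
    (hK : ContDiffOn ℝ ∞ (liftH K) (jetDomain d E)) {η : SmoothFun d} (hη : ∀ x, η x ∈ E)
    (v : SmoothFun d) (x : Torus d) :
    R.jet hK hη v x = K x (grad v x) (hess v x) (η x) (h (smoothMeasure η) x) := rfl

/-- `A₁` as a smooth function. -/
def smoothA₁ (R : Regular E H h) {η : SmoothFun d} (hη : ∀ x, η x ∈ E) (v : SmoothFun d) :
    SmoothFun d :=
  -v - R.jet R.contDiffOn hη v

lemma smoothA₁_apply (R : Regular E H h) {η : SmoothFun d} (hη : ∀ x, η x ∈ E) (v : SmoothFun d)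
    (x : Torus d) : R.smoothA₁ hη v x = A₁ H h η v x := rfl

/-- `η D_{p_i}H`. -/
def fluxP (R : Regular E H h) {η : SmoothFun d} (hη : ∀ x, η x ∈ E) (v : SmoothFun d)
    (i : Fin d) : SmoothFun d :=
  smoothMul η (R.jet (contDiffOn_DpH R.half R.contDiffOn i) hη v)

/-- `η D_{M_ij}H`. -/
def fluxM (R : Regular E H h) {η : SmoothFun d} (hη : ∀ x, η x ∈ E) (v : SmoothFun d)
    (i j : Fin d) : SmoothFun d :=
  smoothMul η (R.jet (contDiffOn_DMH R.half R.contDiffOn i j) hη v)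

/-- `A₂` as a smooth function. -/
def smoothA₂ (R : Regular E H h) {η : SmoothFun d} (hη : ∀ x, η x ∈ E) (v : SmoothFun d) :
    SmoothFun d :=
  η - ∑ i, dpartial i (R.fluxP hη v i) + ∑ i, ∑ j, dpartial i (dpartial j (R.fluxM hη v i j))
    - smoothConst d 1

end Regular

lemma SmoothFun.sum_apply {ι : Type*} (s : Finset ι) (f : ι → SmoothFun d) (x : Torus d) :
    (∑ i ∈ s, f i) x = ∑ i ∈ s, f i x := by
  let ev : SmoothFun d →+ ℝ := ⟨⟨fun f => f x, rfl⟩, fun _ _ => rfl⟩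
  exact map_sum ev f s

/-- Two integrations by parts reverse the order of differentiation; Schwarz's symmetry restores it.
-/
lemma integral_mul_hess (i j : Fin d) (ψ f : SmoothFun d) :
    ∫ x, ψ x * dpartial i (dpartial j f) x = ∫ x, hess ψ x i j * f x := by
  simp only [dpartial_apply]
  rw [integral_mul_pderiv i ψ (dpartial j f)]
  simp only [dpartial_apply]
  have h2 := integral_mul_pderiv j (dpartial i ψ) f
  simp only [dpartial_apply] at h2
  rw [h2, neg_neg]
  congr 1
  funext x
  rw [hess_apply, dpartial_comm]
  rfl

namespace Regular

variable {E : Set ℝ} {H : Hamiltonian d} {h : Mac d → C(Torus d, ℝ)}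

lemma smoothA₂_apply (R : Regular E H h) {η : SmoothFun d} (hη : ∀ x, η x ∈ E) (v : SmoothFun d)
    (x : Torus d) : R.smoothA₂ hη v x = A₂ H h η v x := by
  simp only [smoothA₂, SmoothFun.sub_apply, SmoothFun.add_apply, SmoothFun.sum_apply,
    smoothConst_apply, A₂]
  rfl

/-- The integrand of the weak form of `⟨(φ, ψ), A(η, v)⟩`. -/
def weakIntegrand (H : Hamiltonian d) (h : Mac d → C(Torus d, ℝ)) (η v φ ψ : SmoothFun d)
    (x : Torus d) : ℝ :=
  φ x * (-v x - alongJet H η v (h (smoothMeasure η)) x) + ψ x * (η x - 1)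
    + ∑ i, pderiv i ψ x * (η x * alongJet (DpH H i) η v (h (smoothMeasure η)) x)
    + ∑ i, ∑ j, hess ψ x i j * (η x * alongJet (DMH H i j) η v (h (smoothMeasure η)) x)

/-- The weak form of `A`. -/
lemma integral_A (R : Regular E H h) {η : SmoothFun d} (hη : ∀ x, η x ∈ E)
    (v φ ψ : SmoothFun d) :
    (∫ x, φ x * R.smoothA₁ hη v x) + ∫ x, ψ x * R.smoothA₂ hη v x =
      ∫ x, weakIntegrand H h η v φ ψ x := by
  have hint : ∀ f g : SmoothFun d, Integrable fun x => f x * g x := fun f g =>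
    integrable_smooth (smoothMul f g)
  have e2 : ∫ x, ψ x * R.smoothA₂ hη v x = (∫ x, ψ x * (η x - 1))
      + (∑ i, ∫ x, pderiv i ψ x * R.fluxP hη v i x)
      + ∑ i, ∑ j, ∫ x, hess ψ x i j * R.fluxM hη v i j x := by
    have : ∀ x, ψ x * R.smoothA₂ hη v x = ψ x * (η - smoothConst d 1 : SmoothFun d) x
        - (∑ i, ψ x * dpartial i (R.fluxP hη v i) x)
        + ∑ i, ∑ j, ψ x * dpartial i (dpartial j (R.fluxM hη v i j)) x := by
      intro x
      simp only [smoothA₂, SmoothFun.sub_apply, SmoothFun.add_apply, SmoothFun.sum_apply,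
        ← Finset.mul_sum]
      ring
    simp_rw [this]
    have i1 : Integrable fun x => ∑ i, ψ x * dpartial i (R.fluxP hη v i) x :=
      integrable_finsetSum _ fun i _ => hint _ _
    have i2 : Integrable fun x => ∑ i, ∑ j, ψ x * dpartial i (dpartial j (R.fluxM hη v i j)) x :=
      integrable_finsetSum _ fun i _ => integrable_finsetSum _ fun j _ => hint _ _
    have i0 : Integrable fun x => ψ x * (η - smoothConst d 1 : SmoothFun d) x := hint _ _
    have i01 : Integrable fun x => ψ x * (η - smoothConst d 1 : SmoothFun d) x -
        ∑ i, ψ x * dpartial i (R.fluxP hη v i) x := i0.sub i1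
    rw [integral_add i01 i2, integral_sub i0 i1, integral_finsetSum _ fun i _ => hint _ _,
      integral_finsetSum _ fun i _ => integrable_finsetSum _ fun j _ => hint _ _]
    have e3 : ∀ i, ∫ x, ψ x * dpartial i (R.fluxP hη v i) x =
        - ∫ x, pderiv i ψ x * R.fluxP hη v i x := fun i => integral_mul_pderiv i _ _
    have e4 : ∀ i, ∫ x, ∑ j, ψ x * dpartial i (dpartial j (R.fluxM hη v i j)) x =
        ∑ j, ∫ x, hess ψ x i j * R.fluxM hη v i j x := by
      intro i
      rw [integral_finsetSum _ fun j _ => hint _ _]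
      exact Finset.sum_congr rfl fun j _ => integral_mul_hess i j _ _
    simp_rw [e3, e4, Finset.sum_neg_distrib, sub_neg_eq_add]
    rfl
  have i0 : Integrable fun x => φ x * R.smoothA₁ hη v x := hint _ _
  have i1 : Integrable fun x => ψ x * (η x - 1) := hint ψ (η - smoothConst d 1)
  have i2 : ∀ i, Integrable fun x => pderiv i ψ x * R.fluxP hη v i x := fun i =>
    hint (dpartial i ψ) _
  have i3 : ∀ i j, Integrable fun x => hess ψ x i j * R.fluxM hη v i j x := fun i j =>
    hint (dpartial i (dpartial j ψ)) _
  have i2' := integrable_finsetSum Finset.univ fun i _ => i2 i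
  have i3' : Integrable fun x => ∑ i, ∑ j, hess ψ x i j * R.fluxM hη v i j x :=
    integrable_finsetSum Finset.univ fun i _ => integrable_finsetSum Finset.univ fun j _ => i3 i j
  have e5 : ∫ x, weakIntegrand H h η v φ ψ x =
      (∫ x, φ x * R.smoothA₁ hη v x) + (∫ x, ψ x * (η x - 1))
      + (∑ i, ∫ x, pderiv i ψ x * R.fluxP hη v i x)
      + ∑ i, ∑ j, ∫ x, hess ψ x i j * R.fluxM hη v i j x := by
    have e6 : ∀ x, weakIntegrand H h η v φ ψ x = φ x * R.smoothA₁ hη v x + ψ x * (η x - 1)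
        + (∑ i, pderiv i ψ x * R.fluxP hη v i x)
        + ∑ i, ∑ j, hess ψ x i j * R.fluxM hη v i j x := fun x => rfl
    simp_rw [e6]
    rw [integral_add ((i0.fun_add i1).fun_add i2') i3',
      integral_add (i0.fun_add i1) i2', integral_add i0 i1,
      integral_finsetSum _ fun i _ => i2 i,
      integral_finsetSum _ fun i _ => integrable_finsetSum _ fun j _ => i3 i j]
    congr 1
    exact Finset.sum_congr rfl fun i _ => integral_finsetSum _ fun j _ => i3 i j
  rw [e2, e5]
  ring

end Regular

/-! ### Hemicontinuity of `A` -/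

lemma grad_add_smul (v δ : SmoothFun d) (t : ℝ) (x : Torus d) :
    grad (v + t • δ) x = grad v x + t • grad δ x := by
  ext i
  have h := congrArg (fun k : SmoothFun d => k x)
    ((dpartialₗ i).map_add v (t • δ))
  rw [LinearMap.map_smul] at h
  exact h

lemma hess_add_smul (v δ : SmoothFun d) (t : ℝ) (x : Torus d) :
    hess (v + t • δ) x = hess v x + t • hess δ x := by
  funext i j
  have h := congrArg (fun k : SmoothFun d => k x)
    ((dpartialₗ i ∘ₗ dpartialₗ j).map_add v (t • δ))
  rw [LinearMap.map_smul] at h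
  exact h

lemma continuous_hess (v : SmoothFun d) : Continuous (hess v) :=
  continuous_pi fun i => continuous_pi fun j => continuous_smooth (dpartial i (dpartial j v))

namespace Regular

variable {E : Set ℝ} {H : Hamiltonian d} {h : Mac d → C(Torus d, ℝ)}

lemma segment_mem (R : Regular E H h) {η η' : SmoothFun d} (hη : ∀ x, η x ∈ E)
    (hη' : ∀ x, η' x ∈ E) {t : ℝ} (ht : t ∈ Icc (0 : ℝ) 1) (x : Torus d) :
    (η + t • (η' - η)) x ∈ E := by
  have h1 : (η + t • (η' - η)) x = (1 - t) • η x + t • η' x := by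
    simp only [SmoothFun.add_apply, SmoothFun.smul_apply, SmoothFun.sub_apply, smul_eq_mul]; ring
  rw [h1]
  exact R.half.convex (hη x) (hη' x) (by linarith [ht.2]) ht.1 (by ring)

lemma continuous_alongJet_segment (R : Regular E H h) {K : Hamiltonian d}
    (hK : ContDiffOn ℝ ∞ (liftH K) (jetDomain d E)) {η η' : SmoothFun d} (hη : ∀ x, η x ∈ E)
    (hη' : ∀ x, η' x ∈ E) (v δ : SmoothFun d) :
    Continuous fun p : Icc (0 : ℝ) 1 × Torus d =>
      alongJet K (η + (p.1 : ℝ) • (η' - η)) (v + (p.1 : ℝ) • δ)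
        (h (smoothMeasure (η + (p.1 : ℝ) • (η' - η)))) p.2 := by
  -- Smoothness of `H` is stated for the periodic lift, so continuity is checked upstairs and
  -- descends along the open quotient map.
  rw [← (IsOpenQuotientMap.id.prodMap (isOpenQuotientMap_proj d)).continuous_comp_iff]
  have hθ := continuous_nonlocal_segment R.nonlocal η (η' - η) (Icc 0 1)
    fun t ht x => R.half.nonneg (R.segment_mem hη hη' ht x)
  have hc : Continuous fun p : Icc (0 : ℝ) 1 × (Fin d → ℝ) =>
      ((p.2, grad (v + (p.1 : ℝ) • δ) (proj p.2), hess (v + (p.1 : ℝ) • δ) (proj p.2),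
        (η + (p.1 : ℝ) • (η' - η)) (proj p.2),
        h (smoothMeasure (η + (p.1 : ℝ) • (η' - η))) (proj p.2)) : JetSpace d) := by
    have hp : Continuous fun p : Icc (0 : ℝ) 1 × (Fin d → ℝ) => proj p.2 :=
      continuous_proj.comp continuous_snd
    have ht : Continuous fun p : Icc (0 : ℝ) 1 × (Fin d → ℝ) => (p.1 : ℝ) :=
      continuous_subtype_val.comp continuous_fst
    refine continuous_snd.prodMk (Continuous.prodMk ?_ (Continuous.prodMk ?_
      (Continuous.prodMk ?_ ?_)))
    · simp_rw [grad_add_smul]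
      exact ((continuous_grad v).comp hp).add (ht.smul ((continuous_grad δ).comp hp))
    · simp_rw [hess_add_smul]
      exact ((continuous_hess v).comp hp).add (ht.smul ((continuous_hess δ).comp hp))
    · exact ((continuous_smooth η).comp hp).add
        (ht.mul ((continuous_smooth (η' - η)).comp hp))
    · exact (hθ.comp continuous_fst).eval hp
  exact hK.continuousOn.comp_continuous hc fun p => R.segment_mem hη hη' p.1.2 (proj p.2)

/-- This is why the weak form is used: all derivatives fall on the fixed test functions `φ`, `ψ`,
and only sup-norm continuity of `h` along the segment is needed. -/
lemma continuous_integral_weakIntegrand (R : Regular E H h) {η η' : SmoothFun d}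
    (hη : ∀ x, η x ∈ E) (hη' : ∀ x, η' x ∈ E) (v δ φ ψ : SmoothFun d) :
    Continuous fun t : Icc (0 : ℝ) 1 =>
      ∫ x, weakIntegrand H h (η + (t : ℝ) • (η' - η)) (v + (t : ℝ) • δ) φ ψ x := by
  have hs : ∀ f : SmoothFun d, Continuous fun p : Icc (0 : ℝ) 1 × Torus d => f p.2 := fun f =>
    (continuous_smooth f).comp continuous_snd
  have ht : Continuous fun p : Icc (0 : ℝ) 1 × Torus d => (p.1 : ℝ) :=
    continuous_subtype_val.comp continuous_fst
  have hseg : ∀ f g : SmoothFun d, Continuous fun p : Icc (0 : ℝ) 1 × Torus d =>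
      (f + (p.1 : ℝ) • g) p.2 := fun f g => (hs f).add (ht.mul (hs g))
  have hc : Continuous (Function.uncurry fun (t : Icc (0 : ℝ) 1) (x : Torus d) =>
      weakIntegrand H h (η + (t : ℝ) • (η' - η)) (v + (t : ℝ) • δ) φ ψ x) := by
    refine Continuous.add (Continuous.add (Continuous.add ?_ ?_) ?_) ?_
    · exact (hs φ).mul ((hseg v δ).neg.sub
        (R.continuous_alongJet_segment R.contDiffOn hη hη' v δ))
    · exact (hs ψ).mul ((hseg η (η' - η)).sub continuous_const)
    · exact continuous_finsetSum _ fun i _ => (hs (dpartial i ψ)).mul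
        ((hseg η (η' - η)).mul (R.continuous_alongJet_segment
          (contDiffOn_DpH R.half R.contDiffOn i) hη hη' v δ))
    · exact continuous_finsetSum _ fun i _ => continuous_finsetSum _ fun j _ =>
        (hs (dpartial i (dpartial j ψ))).mul
        ((hseg η (η' - η)).mul (R.continuous_alongJet_segment
          (contDiffOn_DMH R.half R.contDiffOn i j) hη hη' v δ))
  have := continuous_parametric_integral_of_continuous (μ := (volume : Measure (Torus d))) hc
    (isCompact_univ (X := Torus d))
  simpa using this

end Regular

/-! ### Monotone variational inequalities -/

/-- A matrix game with nonnegative symmetric part has a nonnegative strategy. -/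
lemma exists_stdSimplex_nonneg {n : ℕ} (hn : 0 < n) (a : Fin n → Fin n → ℝ)
    (ha : ∀ k l, 0 ≤ a k l + a l k) :
    ∃ c ∈ stdSimplex ℝ (Fin n), ∀ k, 0 ≤ ∑ l, c l * a k l := by
  by_contra! hcon
  have : Nonempty (Fin n) := ⟨⟨0, hn⟩⟩
  let T : (Fin n → ℝ) →ₗ[ℝ] (Fin n → ℝ) :=
    { toFun := fun c k => ∑ l, c l * a k l
      map_add' := fun c c' => by funext k; simp [add_mul, Finset.sum_add_distrib]
      map_smul' := fun r c => by funext k; simp [Finset.mul_sum, mul_assoc] }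
  have hTc : Continuous T := T.continuous_of_finiteDimensional
  -- If no strategy works, the compact convex image of the simplex misses the nonnegative orthant
  -- and can be strictly separated from it.
  obtain ⟨f, u, w, hfu, huw, hwf⟩ := geometric_hahn_banach_compact_closed
    (s := T '' stdSimplex ℝ (Fin n)) (t := Ici (0 : Fin n → ℝ))
    ((convex_stdSimplex ℝ _).linear_image T) ((isCompact_stdSimplex ℝ _).image hTc)
    (convex_Ici 0) isClosed_Ici (by
      rw [Set.disjoint_left]
      rintro _ ⟨c, hc, rfl⟩ hc'
      obtain ⟨k, hk⟩ := hcon c hc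
      exact absurd (hc' k) (not_le.2 hk))
  set y : Fin n → ℝ := fun k => f (Pi.single k 1) with hy
  have hfy : ∀ z, f z = ∑ k, z k * y k := by
    intro z
    conv_lhs => rw [pi_eq_sum_univ' z]
    simp [map_sum, hy]
  have hw0 : w < 0 := by simpa using hwf 0 (by simp)
  -- The functional is bounded below on a cone, so its coefficients are nonnegative; a negative one
  -- would let a multiple of a basis vector reach the value `w`.
  have hy0 : ∀ k, 0 ≤ y k := by
    intro k
    by_contra hk
    rw [not_le] at hk
    have h1 := hwf ((w / y k) • Pi.single k 1) (by
      intro j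
      have : 0 ≤ w / y k := div_nonneg_of_nonpos hw0.le hk.le
      simp only [Pi.zero_apply, Pi.smul_apply, smul_eq_mul]
      by_cases hj : j = k
      · subst hj; simpa using this
      · simp [hj])
    rw [map_smul, smul_eq_mul, div_mul_cancel₀ _ hk.ne] at h1
    exact lt_irrefl _ h1
  set S := ∑ k, y k with hS
  have hS0 : 0 < S := by
    refine lt_of_le_of_ne (Finset.sum_nonneg fun k _ => hy0 k) fun h0 => ?_
    have h1 : ∀ k, y k = 0 := fun k =>
      (Finset.sum_eq_zero_iff_of_nonneg fun k _ => hy0 k).1 h0.symm k (Finset.mem_univ k)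
    obtain ⟨c, hc⟩ : (stdSimplex ℝ (Fin n)).Nonempty := ⟨_, single_mem_stdSimplex ℝ ⟨0, hn⟩⟩
    have h2 := hfu _ (mem_image_of_mem T hc)
    rw [hfy] at h2
    simp only [h1, mul_zero, Finset.sum_const_zero] at h2
    linarith
  -- The normalised separating functional is itself a strategy. Played against itself it has
  -- nonnegative payoff, because only the symmetric part of `a` matters, while separation makes the
  -- payoff negative.
  have hmem : (fun k => y k / S) ∈ stdSimplex ℝ (Fin n) :=
    ⟨fun k => div_nonneg (hy0 k) hS0.le, by rw [← Finset.sum_div]; exact div_self hS0.ne'⟩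
  have h1 := hfu _ (mem_image_of_mem T hmem)
  rw [hfy] at h1
  have h2 : ∑ k, T (fun k => y k / S) k * y k = (∑ k, ∑ l, y k * y l * a k l) / S := by
    rw [Finset.sum_div]
    refine Finset.sum_congr rfl fun k _ => ?_
    change (∑ l, y l / S * a k l) * y k = _
    rw [Finset.sum_mul, Finset.sum_div]
    refine Finset.sum_congr rfl fun l _ => ?_
    ring
  have h3 : 0 ≤ ∑ k, ∑ l, y k * y l * a k l := by
    have h4 : ∑ k, ∑ l, y k * y l * a k l = ∑ k, ∑ l, y k * y l * a l k := by
      rw [Finset.sum_comm]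
      refine Finset.sum_congr rfl fun k _ => Finset.sum_congr rfl fun l _ => ?_
      ring
    have h5 : 0 ≤ ∑ k, ∑ l, y k * y l * (a k l + a l k) :=
      Finset.sum_nonneg fun k _ => Finset.sum_nonneg fun l _ =>
        mul_nonneg (mul_nonneg (hy0 k) (hy0 l)) (ha k l)
    simp only [mul_add, Finset.sum_add_distrib] at h5
    linarith
  rw [h2] at h1
  have := div_nonneg h3 hS0.le
  linarith

section Minty

variable {X : Type*} [AddCommGroup X] [Module ℝ X]

/-- Minty's variational inequality on the convex hull of finitely many points. -/
lemma exists_minty {n : ℕ} (hn : 0 < n) (w : Fin n → X) (A : X → X →ₗ[ℝ] ℝ)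
    (hA : ∀ x ∈ convexHull ℝ (range w), ∀ y ∈ convexHull ℝ (range w), 0 ≤ A x (x - y) - A y (x - y)) :
    ∃ x ∈ convexHull ℝ (range w), ∀ y ∈ convexHull ℝ (range w), 0 ≤ A y (y - x) := by
  set K := convexHull ℝ (range w) with hK
  let z : (Fin n → ℝ) →ₗ[ℝ] X := Fintype.linearCombination ℝ w
  have hKz : K = z '' stdSimplex ℝ (Fin n) := by
    rw [← convexHull_rangle_single_eq_stdSimplex, LinearMap.image_convexHull, ← Set.range_comp, hK]
    congr 2
    funext k
    simp [z]
  have hcl : ∀ y : K, IsClosed {c : Fin n → ℝ | 0 ≤ A y (y - z c)} := by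
    intro y
    refine isClosed_le continuous_const ?_
    rw [show (fun c => A y (y - z c)) = fun c => A y y - (A y ∘ₗ z) c by funext c; simp]
    exact continuous_const.sub (LinearMap.continuous_of_finiteDimensional _)
  -- Minty's condition at each `y` is closed and affine in the coefficients `c`, so compactness
  -- reduces the claim to finitely many `y`.
  have hne := (isCompact_stdSimplex ℝ (Fin n)).inter_iInter_nonempty
    (fun y : K => {c : Fin n → ℝ | 0 ≤ A y (y - z c)}) hcl ?_
  · obtain ⟨c, hc, hc'⟩ := hne
    refine ⟨z c, hKz ▸ mem_image_of_mem z hc, fun y hy => ?_⟩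
    exact mem_iInter.1 hc' ⟨y, hy⟩
  · intro s
    rcases s.eq_empty_or_nonempty with rfl | hs
    · exact ⟨_, single_mem_stdSimplex ℝ ⟨0, hn⟩, by simp⟩
    let y : Fin s.card → X := fun k => ((s.equivFin.symm k : K) : X)
    have hyK : ∀ k, y k ∈ K := fun k => (s.equivFin.symm k : K).2
    -- For the game with entries `A (y k) (y k - y l)`, nonnegativity of the symmetric part is
    -- exactly monotonicity.
    obtain ⟨c', hc', hpos⟩ := exists_stdSimplex_nonneg (Finset.card_pos.2 hs)
      (fun k l => A (y k) (y k - y l)) (by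
        intro k l
        have h1 := hA _ (hyK k) _ (hyK l)
        have h2 : A (y l) (y l - y k) = - A (y l) (y k - y l) := by
          rw [← map_neg, neg_sub]
        rw [h2]
        linarith)
    have hxK : ∑ l, c' l • y l ∈ K :=
      (convex_convexHull ℝ _).sum_mem (fun l _ => hc'.1 l) hc'.2 fun l _ => hyK l
    obtain ⟨c, hc, hcx⟩ := hKz.subset hxK
    refine ⟨c, hc, mem_iInter₂.2 fun p hp => ?_⟩
    have hp' : y (s.equivFin ⟨p, hp⟩) = p := by simp [y]
    have h3 := hpos (s.equivFin ⟨p, hp⟩)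
    simp only [hp'] at h3
    have h4 : A p (p - z c) = ∑ l, c' l * A p (p - y l) := by
      rw [hcx]
      simp only [map_sub, map_sum, map_smul, smul_eq_mul, mul_sub, Finset.sum_sub_distrib,
        ← Finset.sum_mul, hc'.2, one_mul]
    simp only [mem_ofPred_eq]
    rw [h4]
    exact h3

/-- Minty's lemma: a hemicontinuous monotone operator has a Stampacchia solution. -/
lemma exists_stampacchia {n : ℕ} (hn : 0 < n) (w : Fin n → X) (A : X → X →ₗ[ℝ] ℝ)
    (hA : ∀ x ∈ convexHull ℝ (range w), ∀ y ∈ convexHull ℝ (range w), 0 ≤ A x (x - y) - A y (x - y))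
    (hc : ∀ x ∈ convexHull ℝ (range w), ∀ y ∈ convexHull ℝ (range w),
      Tendsto (fun t : ℝ => A (x + t • (y - x)) (y - x)) (𝓝[>] 0) (𝓝 (A x (y - x)))) :
    ∃ x ∈ convexHull ℝ (range w), ∀ y ∈ convexHull ℝ (range w), 0 ≤ A x (y - x) := by
  obtain ⟨x, hx, hxy⟩ := exists_minty hn w A hA
  refine ⟨x, hx, fun y hy => ge_of_tendsto (hc x hx y hy) ?_⟩
  filter_upwards [Ioo_mem_nhdsGT (zero_lt_one' ℝ)] with t ht
  have hm : x + t • (y - x) ∈ convexHull ℝ (range w) :=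
    (convex_convexHull ℝ _).add_smul_sub_mem hx hy ⟨ht.1.le, ht.2.le⟩
  have h1 := hxy _ hm
  -- Minty's inequality at the point a fraction `t` of the way to `y` carries a factor `t`; it is
  -- divided out before `t → 0`.
  rw [add_sub_cancel_left, map_smul, smul_eq_mul] at h1
  exact nonneg_of_mul_nonneg_right h1 ht.1

end Minty

/-! ### Convex combinations converging in `L¹` -/

/-- Deficit in the midpoint inequality of `t ↦ √(1 + t²)`. -/
def midDeficit (a b : ℝ) : ℝ :=
  √(1 + a ^ 2) + √(1 + b ^ 2) - 2 * √(1 + ((a + b) / 2) ^ 2)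

/-- Quantitative strict convexity. With `p`, `q` the two square roots and `r` twice the one at the
midpoint, `(pq)² - (1 + ab)² = (a - b)²` and `(p + q)² - r² = 2(pq - (1 + ab))`; factoring both
differences of squares gives the bound. -/
lemma midDeficit_spec (a b : ℝ) : 0 ≤ midDeficit a b ∧
    (a - b) ^ 2 ≤ 2 * √(1 + a ^ 2) * √(1 + b ^ 2) * (√(1 + a ^ 2) + √(1 + b ^ 2)) * midDeficit a b := by
  set p := √(1 + a ^ 2) with hp
  set q := √(1 + b ^ 2) with hq
  set r := 2 * √(1 + ((a + b) / 2) ^ 2) with hr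
  have hp2 : p ^ 2 = 1 + a ^ 2 := Real.sq_sqrt (by positivity)
  have hq2 : q ^ 2 = 1 + b ^ 2 := Real.sq_sqrt (by positivity)
  have hr2 : r ^ 2 = 4 + (a + b) ^ 2 := by
    rw [hr, mul_pow, Real.sq_sqrt (by positivity)]; ring
  have hp0 : 0 < p := Real.sqrt_pos.2 (by positivity)
  have hq0 : 0 < q := Real.sqrt_pos.2 (by positivity)
  have hr0 : 0 < r := mul_pos two_pos (Real.sqrt_pos.2 (by positivity))
  have hpq : 0 < p * q := mul_pos hp0 hq0
  have h1 : (p * q) ^ 2 - (1 + a * b) ^ 2 = (a - b) ^ 2 := by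
    rw [mul_pow, hp2, hq2]; ring
  have h2 : |1 + a * b| ≤ p * q := abs_le_of_sq_le_sq (by nlinarith [sq_nonneg (a - b)]) hpq.le
  have h3 : (p + q) ^ 2 - r ^ 2 = 2 * (p * q - (1 + a * b)) := by
    rw [hr2]; nlinarith
  have h4 : 0 ≤ p * q - (1 + a * b) := by linarith [(abs_le.1 h2).2]
  have h5 : r ≤ p + q := abs_le_of_sq_le_sq' (by linarith) (by positivity) |>.2
  have hD : midDeficit a b = p + q - r := rfl
  rw [hD]
  refine ⟨by linarith, ?_⟩
  have h6 : (a - b) ^ 2 ≤ (p * q - (1 + a * b)) * (2 * (p * q)) := by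
    rw [← h1]
    have : (p * q) ^ 2 - (1 + a * b) ^ 2 = (p * q - (1 + a * b)) * (p * q + (1 + a * b)) := by ring
    rw [this]
    gcongr
    linarith [(abs_le.1 h2).2]
  have h7 : 2 * (p * q - (1 + a * b)) ≤ (p + q - r) * (2 * (p + q)) := by
    rw [← h3]
    have : (p + q) ^ 2 - r ^ 2 = (p + q - r) * (p + q + r) := by ring
    rw [this]
    exact mul_le_mul_of_nonneg_left (by linarith) (by linarith)
  calc (a - b) ^ 2 ≤ (2 * (p * q - (1 + a * b))) * (p * q) := by linarith
    _ ≤ ((p + q - r) * (2 * (p + q))) * (p * q) := by gcongr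
    _ = _ := by ring

/-- For `|a|, |b| ≤ K` strict convexity is uniform and Young's inequality turns the square into a
first power. Otherwise the larger value exceeds `K`, and `|s| ≤ K ^ (1 - γ) |s| ^ γ` makes it
negligible for large `K`. -/
lemma abs_sub_le_midDeficit {γ : ℝ} (hγ : 1 < γ) {ε K : ℝ} (hε : 0 < ε) (hK : 1 ≤ K) (a b : ℝ) :
    |a - b| ≤ ε + 4 * (1 + K) ^ 3 / ε * midDeficit a b + 2 * K ^ (1 - γ) * (|a| ^ γ + |b| ^ γ) := by
  obtain ⟨hD0, hD⟩ := midDeficit_spec a b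
  have hK0 : 0 < K := by linarith
  have hapow : 0 ≤ |a| ^ γ := Real.rpow_nonneg (abs_nonneg _) _
  have hbpow : 0 ≤ |b| ^ γ := Real.rpow_nonneg (abs_nonneg _) _
  have hKpow : 0 ≤ K ^ (1 - γ) := Real.rpow_nonneg hK0.le _
  have hterm2 : 0 ≤ 4 * (1 + K) ^ 3 / ε * midDeficit a b := by positivity
  have hbig : ∀ s : ℝ, K ≤ |s| → |s| ≤ K ^ (1 - γ) * |s| ^ γ := by
    intro s hs
    have hs0 : 0 < |s| := by linarith
    have h1 : |s| = |s| ^ (1 - γ) * |s| ^ γ := by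
      rw [← Real.rpow_add hs0]; simp
    have h2 : |s| ^ (1 - γ) ≤ K ^ (1 - γ) :=
      Real.rpow_le_rpow_of_nonpos hK0 hs (by linarith)
    calc |s| = |s| ^ (1 - γ) * |s| ^ γ := h1
      _ ≤ _ := by gcongr
  have htri := abs_sub a b
  by_cases hab : |a| ≤ K ∧ |b| ≤ K
  · have hs : ∀ s : ℝ, |s| ≤ K → √(1 + s ^ 2) ≤ 1 + K := by
      intro s hs
      rw [Real.sqrt_le_left (by linarith)]
      nlinarith [sq_abs s, abs_nonneg s]
    have e1 := hs a hab.1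
    have e2 := hs b hab.2
    have h1 : (a - b) ^ 2 ≤ 4 * (1 + K) ^ 3 * midDeficit a b := by
      refine hD.trans (mul_le_mul_of_nonneg_right ?_ hD0)
      calc 2 * √(1 + a ^ 2) * √(1 + b ^ 2) * (√(1 + a ^ 2) + √(1 + b ^ 2))
          ≤ 2 * (1 + K) * (1 + K) * ((1 + K) + (1 + K)) := by gcongr
        _ = _ := by ring
    have h2 : |a - b| ≤ ε + (a - b) ^ 2 / ε := by
      rw [← sub_le_iff_le_add', le_div_iff₀ hε, ← sq_abs (a - b)]
      nlinarith [sq_nonneg (|a - b| - ε), abs_nonneg (a - b)]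
    have h3 : (a - b) ^ 2 / ε ≤ 4 * (1 + K) ^ 3 / ε * midDeficit a b := by
      rw [div_mul_eq_mul_div]; gcongr
    have : 0 ≤ 2 * K ^ (1 - γ) * (|a| ^ γ + |b| ^ γ) := by positivity
    linarith
  · have h4 : |a - b| ≤ 2 * K ^ (1 - γ) * (|a| ^ γ + |b| ^ γ) := by
      have h5 : |a - b| ≤ 2 * max |a| |b| := by
        linarith [le_max_left |a| |b|, le_max_right |a| |b|, abs_sub a b]
      have h6 : K ≤ max |a| |b| := by
        rw [not_and_or, not_le, not_le] at hab
        rcases hab with h | h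
        · exact h.le.trans (le_max_left _ _)
        · exact h.le.trans (le_max_right _ _)
      have h7 : max |a| |b| ≤ K ^ (1 - γ) * (|a| ^ γ + |b| ^ γ) := by
        rcases max_choice |a| |b| with h | h
        · rw [h] at h6 ⊢
          nlinarith [hbig a h6, mul_nonneg hKpow hbpow]
        · rw [h] at h6 ⊢
          nlinarith [hbig b h6, mul_nonneg hKpow hapow]
      linarith
    linarith

/-- The strictly convex functional `∫ √(1 + f²)`. -/
def sqrtEnergy (f : C(Torus d, ℝ)) : ℝ := ∫ x, √(1 + f x ^ 2)

lemma continuous_sqrt_one_add_sq (f : C(Torus d, ℝ)) : Continuous fun x => √(1 + f x ^ 2) :=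
  (continuous_const.add (f.continuous.pow 2)).sqrt

lemma integral_midDeficit (f g : C(Torus d, ℝ)) :
    Integrable (fun x => midDeficit (f x) (g x)) ∧
    ∫ x, midDeficit (f x) (g x) =
      sqrtEnergy f + sqrtEnergy g - 2 * sqrtEnergy ((1 / 2 : ℝ) • f + (1 / 2 : ℝ) • g) := by
  have hf := integrable_of_continuous (continuous_sqrt_one_add_sq f)
  have hg := integrable_of_continuous (continuous_sqrt_one_add_sq g)
  have hm := (integrable_of_continuous
    (continuous_sqrt_one_add_sq ((1 / 2 : ℝ) • f + (1 / 2 : ℝ) • g))).const_mul 2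
  have e : (fun x => midDeficit (f x) (g x)) = fun x => √(1 + f x ^ 2) + √(1 + g x ^ 2) -
      2 * √(1 + ((1 / 2 : ℝ) • f + (1 / 2 : ℝ) • g) x ^ 2) := by
    funext x
    simp only [midDeficit, ContinuousMap.add_apply, ContinuousMap.smul_apply, smul_eq_mul]
    congr 4
    ring
  rw [e]
  have hfg : Integrable fun x => √(1 + f x ^ 2) + √(1 + g x ^ 2) := hf.add hg
  refine ⟨hfg.sub hm, ?_⟩
  rw [integral_sub hfg hm, integral_add hf hg, integral_const_mul]
  rfl

lemma continuous_abs_rpow {γ : ℝ} (hγ : 1 < γ) (f : C(Torus d, ℝ)) :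
    Continuous fun x => |f x| ^ γ :=
  f.continuous.abs.rpow_const fun _ => Or.inr (by linarith)

lemma integral_abs_sub_le_deficit {γ : ℝ} (hγ : 1 < γ) {ε K B : ℝ} (hε : 0 < ε) (hK : 1 ≤ K)
    (f g : C(Torus d, ℝ)) (hf : ∫ x, |f x| ^ γ ≤ B) (hg : ∫ x, |g x| ^ γ ≤ B) :
    ∫ x, |f x - g x| ≤ ε + 4 * (1 + K) ^ 3 / ε * (∫ x, midDeficit (f x) (g x)) +
      4 * K ^ (1 - γ) * B := by
  have i1 := (integral_midDeficit f g).1.const_mul (4 * (1 + K) ^ 3 / ε)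
  have i2 := integrable_of_continuous (continuous_abs_rpow hγ f)
  have i3 := integrable_of_continuous (continuous_abs_rpow hγ g)
  have i23 : Integrable fun x => |f x| ^ γ + |g x| ^ γ := i2.add i3
  have i4 := i23.const_mul (2 * K ^ (1 - γ))
  have i0 : Integrable fun _ : Torus d => ε := integrable_const _
  have i01 : Integrable fun x => ε + 4 * (1 + K) ^ 3 / ε * midDeficit (f x) (g x) := i0.add i1
  have h1 : ∫ x, |f x - g x| ≤ ∫ x, (ε + 4 * (1 + K) ^ 3 / ε * midDeficit (f x) (g x) +
      2 * K ^ (1 - γ) * (|f x| ^ γ + |g x| ^ γ)) :=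
    integral_mono (integrable_of_continuous (f.continuous.sub g.continuous).abs) (i01.add i4)
      fun x => abs_sub_le_midDeficit hγ hε hK (f x) (g x)
  rw [integral_add i01 i4, integral_add i0 i1, integral_const_mul, integral_const_mul,
    integral_add i2 i3] at h1
  simp only [integral_const, probReal_univ, one_smul] at h1
  have hKp : 0 ≤ K ^ (1 - γ) := Real.rpow_nonneg (by linarith) _
  nlinarith

/-- Completeness of `L¹` gives the limit; Fatou along an almost everywhere convergent subsequence
puts it in `L^γ`. -/
lemma exists_L1_limit {γ : ℝ} (hγ : 1 < γ) {B : ℝ} (f : ℕ → C(Torus d, ℝ))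
    (hB : ∀ n, ∫ x, |f n x| ^ γ ≤ B)
    (hf : ∀ ε > 0, ∃ N, ∀ n ≥ N, ∀ m ≥ N, ∫ x, |f n x - f m x| < ε) :
    ∃ F : Torus d → ℝ, MemLp F (ENNReal.ofReal γ) ∧
      Tendsto (fun n => ∫ x, |f n x - F x|) atTop (𝓝 0) := by
  let T : C(Torus d, ℝ) →L[ℝ] Lp ℝ 1 (volume : Measure (Torus d)) := ContinuousMap.toLp 1 volume ℝ
  have hT : ∀ g, T g =ᵐ[volume] g := fun g => ContinuousMap.coeFn_toLp volume g
  have hnorm : ∀ (G : Lp ℝ 1 (volume : Measure (Torus d))) (g : C(Torus d, ℝ)),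
      ‖T g - G‖ = ∫ x, |g x - G x| := by
    intro G g
    rw [L1.norm_eq_integral_norm]
    refine integral_congr_ae ?_
    filter_upwards [Lp.coeFn_sub (T g) G, hT g] with x h1 h2
    rw [h1, Pi.sub_apply, h2, Real.norm_eq_abs]
  have hcau : CauchySeq fun n => T (f n) := by
    rw [Metric.cauchySeq_iff]
    intro ε hε
    obtain ⟨N, hN⟩ := hf ε hε
    refine ⟨N, fun n hn m hm => ?_⟩
    rw [dist_eq_norm, hnorm]
    refine lt_of_eq_of_lt (integral_congr_ae ?_) (hN n hn m hm)
    filter_upwards [hT (f m)] with x hx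
    rw [hx]
  obtain ⟨G, hG⟩ := cauchySeq_tendsto_of_complete hcau
  refine ⟨G, ?_, ?_⟩
  · have h1 := tendstoInMeasure_of_tendsto_Lp hG
    obtain ⟨ns, -, hns⟩ := h1.exists_seq_tendsto_ae
    have hp0 : ENNReal.ofReal γ ≠ 0 := by
      rw [Ne, ENNReal.ofReal_eq_zero, not_le]; linarith
    refine ⟨(Lp.memLp G).1, lt_of_le_of_lt (Lp.eLpNorm_lim_le_liminf_eLpNorm
      (fun n => (Lp.memLp (T (f (ns n)))).1) G hns) ?_⟩
    have h2 : ∀ n, eLpNorm (T (f (ns n))) (ENNReal.ofReal γ) volume ≤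
        ENNReal.ofReal (B ^ γ⁻¹) := by
      intro n
      have hm : MemLp (f (ns n)) (ENNReal.ofReal γ) :=
        (f (ns n)).continuous.memLp_of_hasCompactSupport (HasCompactSupport.of_compactSpace _)
      rw [eLpNorm_congr_ae (hT _), hm.eLpNorm_eq_integral_rpow_norm hp0 ENNReal.ofReal_ne_top,
        ENNReal.toReal_ofReal (by linarith)]
      refine ENNReal.ofReal_le_ofReal (Real.rpow_le_rpow ?_ (hB (ns n)) (by
        rw [inv_nonneg]; linarith))
      exact integral_nonneg fun x => Real.rpow_nonneg (norm_nonneg _) _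
    refine lt_of_le_of_lt ?_ (ENNReal.ofReal_lt_top (r := B ^ γ⁻¹))
    exact (liminf_le_liminf (Eventually.of_forall h2)).trans (by simp)
  · have h1 := tendsto_iff_norm_sub_tendsto_zero.1 hG
    simpa only [hnorm] using h1

/-- A sequence bounded in `L^γ`, `γ > 1`, has convex combinations of its tails that converge
in `L¹`, to a limit in `L^γ`; simultaneously for finitely many linear images. -/
lemma exists_convex_tendsto {V : Type*} [AddCommGroup V] [Module ℝ V] {ι : Type*} [Fintype ι]
    (T : ι → V →ₗ[ℝ] C(Torus d, ℝ)) {γ : ℝ} (hγ : 1 < γ) {B : ℝ} (u : ℕ → V)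
    (hB : ∀ i n, ∫ x, |T i (u n) x| ^ γ ≤ B) :
    ∃ w : ℕ → V, (∀ n, w n ∈ convexHull ℝ (u '' Ici n)) ∧
      ∃ F : ι → Torus d → ℝ, ∀ i, MemLp (F i) (ENNReal.ofReal γ) ∧
        Tendsto (fun n => ∫ x, |T i (w n) x - F i x|) atTop (𝓝 0) := by
  set K : ℕ → Set V := fun n => convexHull ℝ (u '' Ici n) with hK
  have hKanti : ∀ n m, n ≤ m → K m ⊆ K n := fun n m hnm =>
    convexHull_mono (image_mono (Ici_subset_Ici.2 hnm))
  have hKconv : ∀ n, Convex ℝ (K n) := fun n => convex_convexHull ℝ _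
  have huK : ∀ n, u n ∈ K n := fun n => subset_convexHull ℝ _ (mem_image_of_mem u self_mem_Ici)
  have hKB : ∀ i n, ∀ v ∈ K n, ∫ x, |T i v x| ^ γ ≤ B := by
    intro i n v hv
    have hconv : Convex ℝ {v : V | ∫ x, |T i v x| ^ γ ≤ B} := by
      intro v hv w hw a b ha hb hab
      simp only [mem_ofPred_eq] at hv hw ⊢
      have i1 := integrable_of_continuous (continuous_abs_rpow hγ (T i v))
      have i2 := integrable_of_continuous (continuous_abs_rpow hγ (T i w))
      calc ∫ x, |T i (a • v + b • w) x| ^ γ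
          ≤ ∫ x, (a * |T i v x| ^ γ + b * |T i w x| ^ γ) := by
            refine integral_mono (integrable_of_continuous (continuous_abs_rpow hγ _))
              ((i1.const_mul a).add (i2.const_mul b)) fun x => ?_
            have := (convexOn_norm_rpow (F := ℝ) hγ.le).2 (mem_univ (T i v x))
              (mem_univ (T i w x)) ha hb hab
            simpa using this
        _ = a * (∫ x, |T i v x| ^ γ) + b * ∫ x, |T i w x| ^ γ := by
            rw [integral_add (i1.const_mul a) (i2.const_mul b), integral_const_mul,
              integral_const_mul]
        _ ≤ a * B + b * B := by gcongr
        _ = B := by rw [← add_mul, hab, one_mul]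
    exact convexHull_min (by rintro _ ⟨k, -, rfl⟩; exact hB i k) hconv hv
  let J : V → ℝ := fun v => ∑ i, sqrtEnergy (T i v)
  have hJ0 : ∀ v, 0 ≤ J v := fun v => Finset.sum_nonneg fun i _ =>
    integral_nonneg fun x => Real.sqrt_nonneg _
  have hbdd : ∀ n, BddBelow (J '' K n) := fun n => ⟨0, by rintro _ ⟨v, -, rfl⟩; exact hJ0 v⟩
  set j : ℕ → ℝ := fun n => sInf (J '' K n) with hj
  have hjle : ∀ n, ∀ v ∈ K n, j n ≤ J v := fun n v hv => csInf_le (hbdd n) (mem_image_of_mem J hv)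
  have hjmono : Monotone j := fun n m hnm =>
    csInf_le_csInf (hbdd n) ⟨_, mem_image_of_mem J (huK m)⟩ (image_mono (hKanti n m hnm))
  have hJub : ∀ n, J (u n) ≤ ∑ _i : ι, (2 + B) := by
    intro n
    refine Finset.sum_le_sum fun i _ => ?_
    have i1 := integrable_of_continuous (continuous_abs_rpow hγ (T i (u n)))
    have i2 : Integrable fun _ : Torus d => (2 : ℝ) := integrable_const _
    calc sqrtEnergy (T i (u n)) ≤ ∫ x, (2 + |T i (u n) x| ^ γ) := by
          refine integral_mono (integrable_of_continuous (continuous_sqrt_one_add_sq _))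
            (i2.add i1) fun x => ?_
          set s := T i (u n) x
          have h1 : √(1 + s ^ 2) ≤ 1 + |s| := by
            rw [Real.sqrt_le_left (by positivity)]
            nlinarith [sq_abs s, abs_nonneg s]
          have h2 : |s| ≤ 1 + |s| ^ γ := by
            rcases le_total |s| 1 with h | h
            · linarith [Real.rpow_nonneg (abs_nonneg s) γ]
            · have := Real.rpow_le_rpow_of_exponent_le h hγ.le
              rw [Real.rpow_one] at this
              linarith
          simp only
          linarith
      _ ≤ 2 + B := by
          rw [integral_add i2 i1]
          simp only [integral_const, probReal_univ, one_smul]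
          linarith [hB i n]
  have hjbdd : BddAbove (range j) := ⟨∑ _i : ι, (2 + B), by
    rintro _ ⟨n, rfl⟩; exact (hjle n _ (huK n)).trans (hJub n)⟩
  have hjlim := tendsto_atTop_ciSup hjmono hjbdd
  set L := ⨆ n, j n with hL
  have hjL : ∀ n, j n ≤ L := fun n => le_ciSup hjbdd n
  -- Near minimisers of `J` over the shrinking hulls. The infima increase to a finite `L`, and
  -- midpoints of `w n` and `w m` stay in `K n`, so the deficits must vanish.
  have hex : ∀ n : ℕ, ∃ v ∈ K n, J v < j n + 1 / ((n : ℝ) + 1) := by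
    intro n
    obtain ⟨_, ⟨v, hv, rfl⟩, h⟩ := Real.lt_sInf_add_pos (s := J '' K n)
      ⟨_, mem_image_of_mem J (huK n)⟩ (by positivity : (0 : ℝ) < 1 / ((n : ℝ) + 1))
    exact ⟨v, hv, h⟩
  choose w hwK hwJ using hex
  refine ⟨w, hwK, ?_⟩
  -- the deficits of near minimisers tend to zero
  have hdef : ∀ i n m, n ≤ m → ∫ x, midDeficit (T i (w n) x) (T i (w m) x) ≤
      2 * (L - j n + 1 / ((n : ℝ) + 1)) := by
    intro i n m hnm
    have hmid : (1 / 2 : ℝ) • w n + (1 / 2 : ℝ) • w m ∈ K n :=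
      hKconv n (hwK n) (hKanti n m hnm (hwK m)) (by norm_num) (by norm_num) (by norm_num)
    have h1 : ∑ i, ∫ x, midDeficit (T i (w n) x) (T i (w m) x) =
        J (w n) + J (w m) - 2 * J ((1 / 2 : ℝ) • w n + (1 / 2 : ℝ) • w m) := by
      simp only [J, map_add, map_smul, Finset.mul_sum, ← Finset.sum_add_distrib,
        ← Finset.sum_sub_distrib]
      exact Finset.sum_congr rfl fun i _ => (integral_midDeficit _ _).2
    have h2 := Finset.single_le_sum (f := fun i => ∫ x, midDeficit (T i (w n) x) (T i (w m) x))
      (fun i _ => integral_nonneg fun x => (midDeficit_spec _ _).1) (Finset.mem_univ i)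
    have h3 := hjle n _ hmid
    have h4 : 1 / ((m : ℝ) + 1) ≤ 1 / ((n : ℝ) + 1) := by gcongr
    have h5 := hwJ n
    have h6 := hwJ m
    have h7 := hjL m
    have h8 := hjL n
    linarith
  have hlim0 : Tendsto (fun n : ℕ => 2 * (L - j n + 1 / ((n : ℝ) + 1))) atTop (𝓝 0) := by
    have h1 := ((tendsto_const_nhds (x := L)).sub hjlim).add tendsto_one_div_add_atTop_nhds_zero_nat
    simpa using h1.const_mul 2
  have hcau : ∀ i, ∀ ε > 0, ∃ N, ∀ n ≥ N, ∀ m ≥ N, ∫ x, |T i (w n) x - T i (w m) x| < ε := by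
    intro i ε hε
    have hKlim : Tendsto (fun k : ℝ => 4 * k ^ (1 - γ) * B) atTop (𝓝 0) := by
      have h1 := tendsto_rpow_neg_atTop (by linarith : 0 < γ - 1)
      simp only [neg_sub] at h1
      simpa using (h1.const_mul 4).mul_const B
    -- The truncation level is fixed first, to make the large values cost less than `ε / 3`; only
    -- then is `N` chosen so that the deficit, multiplied by `c`, costs less than `ε / 3`.
    obtain ⟨k, hk1, hk2⟩ := ((hKlim.eventually (gt_mem_nhds (by positivity : 0 < ε / 3))).and
      (eventually_ge_atTop 1)).exists
    set c := 4 * (1 + k) ^ 3 / (ε / 3) with hc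
    have hc0 : 0 < c := by positivity
    obtain ⟨N, hN⟩ := eventually_atTop.1
      (hlim0.eventually (gt_mem_nhds (by positivity : 0 < ε / 3 / c)))
    have hwlog : ∀ n m, N ≤ n → n ≤ m → ∫ x, |T i (w n) x - T i (w m) x| < ε := by
      intro n m hn hnm
      have h1 := integral_abs_sub_le_deficit hγ (by positivity : 0 < ε / 3) hk2 (T i (w n))
        (T i (w m)) (hKB i n _ (hwK n)) (hKB i m _ (hwK m))
      have h2 := lt_of_le_of_lt (hdef i n m hnm) (hN n hn)
      rw [lt_div_iff₀ hc0, mul_comm] at h2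
      rw [← hc] at h1
      linarith
    refine ⟨N, fun n hn m hm => ?_⟩
    rcases le_total n m with h | h
    · exact hwlog n m hn h
    · have := hwlog m n hm h
      simpa only [abs_sub_comm] using this
  choose F hF using fun i => exists_L1_limit hγ (fun n => T i (w n))
    (fun n => hKB i n _ (hwK n)) (hcau i)
  exact ⟨F, hF⟩

/-! ### A priori estimates -/

lemma Mac.dens_ofDensity {f : Torus d → ℝ} (hf : Integrable f) (h0 : 0 ≤ᵐ[volume] f) :
    (Mac.ofDensity f hf).dens =ᵐ[volume] f := by
  have h1 := Measure.rnDeriv_withDensity₀ (volume : Measure (Torus d))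
    (f := fun x => ENNReal.ofReal (f x)) hf.1.aemeasurable.ennreal_ofReal
  filter_upwards [h1, h0] with x hx hx0
  have : (Mac.ofDensity f hf).dens x =
    ((volume.withDensity fun x => ENNReal.ofReal (f x)).rnDeriv volume x).toReal := rfl
  rw [this, hx, ENNReal.toReal_ofReal hx0]

lemma dens_smoothMeasure {η : SmoothFun d} (hη : ∀ x, 0 ≤ η x) :
    (smoothMeasure η).dens =ᵐ[volume] η :=
  Mac.dens_ofDensity (integrable_smooth η) (Eventually.of_forall hη)

lemma extIntegral_congr {f g : Torus d → ℝ} (h : f =ᵐ[volume] g) :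
    extIntegral f = extIntegral g := by
  have h1 : ∫⁻ x, ENNReal.ofReal (f x) = ∫⁻ x, ENNReal.ofReal (g x) :=
    lintegral_congr_ae (by filter_upwards [h] with x hx; rw [hx])
  have h2 : ∫⁻ x, ENNReal.ofReal (-f x) = ∫⁻ x, ENNReal.ofReal (-g x) :=
    lintegral_congr_ae (by filter_upwards [h] with x hx; rw [hx])
  rw [extIntegral, extIntegral, h1, h2]

lemma extIntegral_eq_integral {f : Torus d → ℝ} (hf : Integrable f) :
    extIntegral f = ((∫ x, f x : ℝ) : EReal) := by
  have h1 : ∫⁻ x, ENNReal.ofReal (f x) ≠ ⊤ := hf.lintegral_lt_top.ne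
  have h2 : ∫⁻ x, ENNReal.ofReal (-f x) ≠ ⊤ := hf.neg.lintegral_lt_top.ne
  rw [integral_eq_lintegral_pos_part_sub_lintegral_neg_part hf, extIntegral, EReal.coe_sub,
    EReal.coe_ennreal_toReal h1, EReal.coe_ennreal_toReal h2]

lemma isSobolevOne_smooth {γ : ℝ} (u : SmoothFun d) : IsSobolevOne γ u (grad u) where
  memLp := (continuous_smooth u).memLp_of_hasCompactSupport (HasCompactSupport.of_compactSpace _)
  memLp_grad i := (continuous_smooth (dpartial i u)).memLp_of_hasCompactSupport
    (HasCompactSupport.of_compactSpace _)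
  weak i := isWeakDeriv_smooth [i] u

/-- If `0 ∈ E` then smoothness of `H` up to `m = 0` forces `τ = 0`. -/
lemma tau_eq_zero (hd : 0 < d) {E : Set ℝ} (hE : IsHalfLine E) (h0 : (0 : ℝ) ∈ E)
    {H : Hamiltonian d} (hH : ContDiffOn ℝ ∞ (liftH H) (jetDomain d E))
    {g : Torus d → ℝ → ℝ → ℝ}
    (hg : ContinuousOn (fun z : Torus d × ℝ × ℝ => g z.1 z.2.1 z.2.2) {z | z.2.1 ∈ E})
    {γ τ C₁ C₂ : ℝ} (hτ : 0 ≤ τ) (hC₁ : 0 < C₁)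
    (hpt : ∀ x p M, ∀ m ∈ E, ∀ θ,
      1 / C₁ * (m ^ (-τ) * ‖p‖ ^ γ) + C₂ * g x m θ - C₁ ≤
        -H x p M m θ + ∑ i, DpH H i x p M m θ * p i + ∑ i, ∑ j, DMH H i j x p M m θ * M i j) :
    τ = 0 := by
  by_contra hne
  have hτ0 : 0 < τ := lt_of_le_of_ne hτ (Ne.symm hne)
  let p : EuclideanSpace ℝ (Fin d) := EuclideanSpace.single ⟨0, hd⟩ 1
  have hp : ‖p‖ = 1 := by simp [p]
  -- At a unit vector `p` and `M = 0`, (H1) reads `m ^ (-τ) ≤ Q m`. The function `Q` is continuous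
  -- up to `m = 0`, whereas the left side blows up if `τ > 0`.
  let Q : ℝ → ℝ := fun m => C₁ * (-H (proj 0) p 0 m 0 + ∑ i, DpH H i (proj 0) p 0 m 0 * p i
    - C₂ * g (proj 0) m 0 + C₁)
  have hjet : ∀ K : Hamiltonian d, ContDiffOn ℝ ∞ (liftH K) (jetDomain d E) →
      ContinuousOn (fun m => K (proj 0) p 0 m 0) E := fun K hK =>
    hK.continuousOn.comp (f := fun m : ℝ => ((0, p, 0, m, 0) : JetSpace d))
      (Continuous.continuousOn (by fun_prop)) fun m hm => hm
  have hQ : ContinuousOn Q E := by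
    refine continuousOn_const.mul (((((hjet H hH).neg).add ?_).sub (continuousOn_const.mul ?_)).add
      continuousOn_const)
    · exact continuousOn_finsetSum _ fun i _ => (hjet _ (contDiffOn_DpH hE hH i)).mul
        continuousOn_const
    · exact hg.comp (f := fun m : ℝ => ((proj 0, m, 0) : Torus d × ℝ × ℝ))
        (Continuous.continuousOn (by fun_prop)) fun m hm => hm
  have hsub : Ioi (0 : ℝ) ⊆ E := fun r hr => hE.pos_mem hr
  have hlim : Tendsto Q (𝓝[>] 0) (𝓝 (Q 0)) :=
    (hQ 0 h0).mono_left (nhdsWithin_mono 0 hsub)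
  have hinf : Tendsto (fun m : ℝ => m ^ (-τ)) (𝓝[>] 0) atTop := by
    refine ((tendsto_rpow_atTop hτ0).comp tendsto_inv_nhdsGT_zero).congr' ?_
    filter_upwards [self_mem_nhdsWithin] with m hm
    rw [Function.comp_apply, Real.inv_rpow (le_of_lt hm), Real.rpow_neg (le_of_lt hm)]
  have hle : ∀ᶠ m in 𝓝[>] (0 : ℝ), m ^ (-τ) ≤ Q m := by
    filter_upwards [self_mem_nhdsWithin] with m hm
    have h1 := hpt (proj 0) p 0 m (hsub hm) 0
    rw [hp, Real.one_rpow, mul_one] at h1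
    simp only [Pi.zero_apply, mul_zero, Finset.sum_const_zero, add_zero] at h1
    have h2 : m ^ (-τ) = C₁ * (1 / C₁ * m ^ (-τ)) := by field_simp
    rw [h2]
    refine mul_le_mul_of_nonneg_left ?_ hC₁.le
    linarith
  exact not_tendsto_nhds_of_tendsto_atTop (tendsto_atTop_mono' _ hle hinf) _ hlim

/-- The arithmetic of the a priori estimate. -/
lemma apriori_arith {C₁ C₂ C₃ c R δ Cδ : ℝ} (hC₁ : 0 < C₁) (hC₂ : 0 < C₂) (hC₃ : 0 < C₃)
    (hc : 0 < c) (hR : 0 ≤ R) (hδ : δ = C₂ / (2 * (C₃ + C₃ * c + C₁))) (hCδ : 0 < Cδ) :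
    ∃ B : ℝ, ∀ U HH ML G MG I₁ J Mm D₁ D₂ D : ℝ,
      0 ≤ -HH - ML → 0 ≤ -U - 2 * HH - ML → 0 ≤ 1 / 2 * U - 1 / 2 * HH - ML →
      -C₃ * G + 1 / C₁ * D₁ - C₁ ≤ HH → 1 / C₁ * D₂ + C₂ * MG - C₁ * Mm ≤ ML →
      J ≤ MG → G ≤ I₁ + c * (1 + Mm) → -R ≤ J → I₁ ≤ δ * J + Cδ → Mm ≤ δ * J + Cδ →
      D ≤ D₁ + D₂ → 0 ≤ D₁ → 0 ≤ D₂ → J ≤ B ∧ D ≤ B ∧ |U| ≤ B := by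
  set S := C₃ + C₃ * c + C₁ with hS
  have hS0 : 0 < S := by positivity
  have hδ0 : 0 < δ := by rw [hδ]; positivity
  -- `S` collects every coefficient with which `δ * J + Cδ` enters, so this `δ` lets half of `C₂ *
  -- J` absorb the right-hand side.
  have hSδ : S * δ = C₂ / 2 := by rw [hδ]; field_simp
  set κ := S * Cδ + C₃ * c + C₁ with hκ
  have hκ0 : 0 < κ := by positivity
  set N := δ * (2 * κ / C₂) + Cδ with hN
  have hN0 : 0 < N := by positivity
  set GG := N + c * (1 + N) with hGG
  have hGG0 : 0 < GG := by positivity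
  refine ⟨2 * κ / C₂ + C₁ * (κ + C₂ * R) + (2 * C₃ * GG + 2 * C₁ + 2 * C₂ * R + 2 * C₁ * N), ?_⟩
  intro U HH ML G MG I₁ J Mm D₁ D₂ D a1 a2 a3 a4 a5 a6 a7 a8 a9 a10 a11 a12 a13
  have e1 : 0 ≤ 1 / C₁ * D₁ := by positivity
  have e2 : 0 ≤ 1 / C₁ * D₂ := by positivity
  have f1 : C₂ * J ≤ C₂ * MG := by gcongr
  have f2 : C₃ * G ≤ C₃ * (I₁ + c * (1 + Mm)) := by gcongr
  have f3 : C₃ * I₁ ≤ C₃ * (δ * J + Cδ) := by gcongr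
  have f4 : (C₃ * c + C₁) * Mm ≤ (C₃ * c + C₁) * (δ * J + Cδ) := by gcongr
  have f5 : C₃ * (δ * J + Cδ) + (C₃ * c + C₁) * (δ * J + Cδ) = C₂ / 2 * J + S * Cδ := by
    rw [← hSδ, hS]; ring
  -- This is the test `c = 1`, where the mean of `u` drops out. The tests `c = 2` and `c = 1 / 2`
  -- are then used only to bound that mean from above and from below.
  have key : C₂ / 2 * J + 1 / C₁ * D₁ + 1 / C₁ * D₂ ≤ κ := by
    rw [hκ]; linarith
  have hJ : J ≤ 2 * κ / C₂ := by
    rw [le_div_iff₀ hC₂]; linarith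
  have hJN : δ * J + Cδ ≤ N := by rw [hN]; gcongr
  have hMN : Mm ≤ N := a10.trans hJN
  have hIN : I₁ ≤ N := a9.trans hJN
  have hcM : c * (1 + Mm) ≤ c * (1 + N) := by gcongr
  have hGG' : G ≤ GG := by rw [hGG]; linarith
  have hCG : C₃ * G ≤ C₃ * GG := by gcongr
  have hCM : C₁ * Mm ≤ C₁ * N := by gcongr
  have hCJ : C₂ * (-R) ≤ C₂ * J := by gcongr
  have hD : D₁ + D₂ ≤ C₁ * (κ + C₂ * R) := by
    have h1 : D₁ + D₂ = C₁ * (1 / C₁ * D₁ + 1 / C₁ * D₂) := by field_simp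
    rw [h1]
    refine mul_le_mul_of_nonneg_left ?_ hC₁.le
    linarith [mul_nonneg hC₂.le hR]
  have p1 : 0 ≤ 2 * κ / C₂ := by positivity
  have p2 : 0 ≤ C₁ * (κ + C₂ * R) := by positivity
  have p3 : 0 ≤ C₃ * GG := by positivity
  have p4 : 0 ≤ C₂ * R := by positivity
  have p5 : 0 ≤ C₁ * N := by positivity
  refine ⟨by linarith, by linarith, abs_le.2 ⟨by linarith, by linarith⟩⟩

/-- Testing `A(m, u)` with `(c, 0) - (m, u)`, where `c` is a constant. -/
lemma weakIntegrand_const_sub (H : Hamiltonian d) (h : Mac d → C(Torus d, ℝ)) (m u : SmoothFun d)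
    (c : ℝ) (x : Torus d) :
    Regular.weakIntegrand H h m u (smoothConst d c - m) (0 - u) x =
      (1 - c) * u x - c * alongJet H m u (h (smoothMeasure m)) x
      - m x * (-alongJet H m u (h (smoothMeasure m)) x
        + ∑ i, alongJet (DpH H i) m u (h (smoothMeasure m)) x * grad u x i
        + ∑ i, ∑ j, alongJet (DMH H i j) m u (h (smoothMeasure m)) x * hess u x i j) := by
  have h1 : ∀ i, pderiv i (0 - u : SmoothFun d) x = - grad u x i := by
    intro i
    have := congrArg (fun k : SmoothFun d => k x) ((dpartialₗ i).map_neg u)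
    rw [zero_sub]
    exact this
  have h2 : ∀ i j, hess (0 - u : SmoothFun d) x i j = - hess u x i j := by
    intro i j
    have := congrArg (fun k : SmoothFun d => k x) ((dpartialₗ i ∘ₗ dpartialₗ j).map_neg u)
    rw [zero_sub]
    exact this
  simp only [Regular.weakIntegrand, h1, h2, SmoothFun.sub_apply, smoothConst_apply,
    SmoothFun.zero_apply]
  have e1 : ∑ i, -grad u x i * (m x * alongJet (DpH H i) m u (h (smoothMeasure m)) x) =
      -(m x * ∑ i, alongJet (DpH H i) m u (h (smoothMeasure m)) x * grad u x i) := by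
    rw [Finset.mul_sum, ← Finset.sum_neg_distrib]
    exact Finset.sum_congr rfl fun i _ => by ring
  have e2 : ∑ i, ∑ j, -hess u x i j * (m x * alongJet (DMH H i j) m u (h (smoothMeasure m)) x) =
      -(m x * ∑ i, ∑ j, alongJet (DMH H i j) m u (h (smoothMeasure m)) x * hess u x i j) := by
    rw [Finset.mul_sum, ← Finset.sum_neg_distrib]
    refine Finset.sum_congr rfl fun i _ => ?_
    rw [Finset.mul_sum, ← Finset.sum_neg_distrib]
    exact Finset.sum_congr rfl fun j _ => by ring
  rw [e1, e2]
  ring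

/-- On smooth densities the extended integrals in (g) are finite, so the hypotheses become
inequalities between real numbers. -/
lemma HypG.bounds_smooth {E : Set ℝ} {H : Hamiltonian d} {h : Mac d → C(Torus d, ℝ)}
    {g g₁ g₂ : Torus d → ℝ → ℝ → ℝ} (R : Regular E H h) (hyp : HypG E h g g₁ g₂) :
    ∃ c r : ℝ, 0 < c ∧ 0 ≤ r ∧ ∀ δ : ℝ, 0 < δ → ∃ Cδ : ℝ, 0 < Cδ ∧
      ∀ m : SmoothFun d, (∀ x, m x ∈ E) → ∃ I₁ J : ℝ,
        (extIntegral fun x => (smoothMeasure m).dens x *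
          g₁ x ((smoothMeasure m).dens x) (h (smoothMeasure m) x)) = (J : EReal) ∧
        J ≤ ∫ x, m x * g x (m x) (h (smoothMeasure m) x) ∧
        ∫ x, g x (m x) (h (smoothMeasure m) x) ≤ I₁ + c * (1 + ∫ x, m x) ∧
        -r ≤ J ∧ I₁ ≤ δ * J + Cδ ∧ ∫ x, m x ≤ δ * J + Cδ := by
  obtain ⟨c, hc, hbound⟩ := hyp.bound₂
  obtain ⟨r, hr, hlow⟩ := hyp.lower
  refine ⟨c, r, hc, hr, fun δ hδ => ?_⟩
  obtain ⟨Cδ, hCδ, hup⟩ := hyp.upper δ hδ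
  refine ⟨Cδ, hCδ, fun m hm => ?_⟩
  set μ := smoothMeasure m with hμ
  have hm0 : ∀ x, 0 ≤ m x := fun x => R.half.nonneg (hm x)
  have hdens : μ.dens =ᵐ[volume] m := dens_smoothMeasure hm0
  have hval : μ.ValuedIn E := by
    filter_upwards [hdens] with x hx
    rw [hx]; exact hm x
  have hmeas : Measurable fun x : Torus d => ((x, ⟨m x, hm x⟩, h μ x) : Torus d × E × ℝ) :=
    measurable_id.prodMk (((continuous_smooth m).measurable.subtype_mk).prodMk
      (h μ).continuous.measurable)
  have hG2m : Measurable fun x => g₂ x (m x) (h μ x) := hyp.measurable₂.comp hmeas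
  have hgc : Continuous fun x => g x (m x) (h μ x) :=
    hyp.continuousOn.comp_continuous (f := fun x => ((x, m x, h μ x) : Torus d × ℝ × ℝ))
      (continuous_id.prodMk ((continuous_smooth m).prodMk (h μ).continuous)) hm
  have hgi := integrable_of_continuous hgc
  have hg2nn : 0 ≤ᵐ[volume] fun x => g₂ x (m x) (h μ x) := by
    filter_upwards [hdens, hyp.nonneg μ hval] with x hx h2
    rwa [hx] at h2
  have hmass : ∫ x, μ.dens x = ∫ x, m x := integral_congr_ae hdens
  have hlin : ∫⁻ x, ENNReal.ofReal (g₂ x (m x) (h μ x)) ≤ ENNReal.ofReal (c * (1 + ∫ x, m x)) := by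
    have h1 := hbound μ hval
    rw [hmass] at h1
    refine le_of_eq_of_le (lintegral_congr_ae ?_) h1
    filter_upwards [hdens] with x hx
    rw [hx]
  have hg2i : Integrable fun x => g₂ x (m x) (h μ x) :=
    ⟨hG2m.aestronglyMeasurable, (hasFiniteIntegral_iff_ofReal hg2nn).2
      (hlin.trans_lt ENNReal.ofReal_lt_top)⟩
  have hMm0 : 0 ≤ ∫ x, m x := integral_nonneg hm0
  have hI2 : ∫ x, g₂ x (m x) (h μ x) ≤ c * (1 + ∫ x, m x) := by
    rw [integral_eq_lintegral_of_nonneg_ae hg2nn hG2m.aestronglyMeasurable]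
    exact ENNReal.toReal_le_of_le_ofReal (by positivity) hlin
  have hsum : ∀ x, g x (m x) (h μ x) = g₁ x (m x) (h μ x) + g₂ x (m x) (h μ x) := fun x =>
    hyp.sum x _ (hm x) _
  -- `g₁` and `g₂` are merely Borel: `g` is continuous, `g₂ ≥ 0` is integrable by its upper bound,
  -- and `g₁` is the difference.
  have hg1i : Integrable fun x => g₁ x (m x) (h μ x) := by
    refine (hgi.sub hg2i).congr (Eventually.of_forall fun x => ?_)
    simp only [Pi.sub_apply, hsum]
    ring
  obtain ⟨K, hK⟩ := (isCompact_univ (X := Torus d)).exists_bound_of_continuousOn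
    (continuous_smooth m).continuousOn
  have hmul : ∀ f : Torus d → ℝ, Integrable f → Integrable fun x => m x * f x := fun f hf =>
    hf.bdd_mul (continuous_smooth m).aestronglyMeasurable
      (Eventually.of_forall fun x => hK x (mem_univ x))
  have hJi := hmul _ hg1i
  have hJeq : (extIntegral fun x => μ.dens x * g₁ x (μ.dens x) (h μ x)) =
      ((∫ x, m x * g₁ x (m x) (h μ x) : ℝ) : EReal) := by
    rw [← extIntegral_eq_integral hJi]
    refine extIntegral_congr ?_
    filter_upwards [hdens] with x hx
    rw [hx]
  have hI1eq : (extIntegral fun x => g₁ x (μ.dens x) (h μ x)) =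
      ((∫ x, g₁ x (m x) (h μ x) : ℝ) : EReal) := by
    rw [← extIntegral_eq_integral hg1i]
    refine extIntegral_congr ?_
    filter_upwards [hdens] with x hx
    rw [hx]
  have hu := hup μ hval
  have hl := hlow μ hval
  rw [hJeq, EReal.coe_le_coe_iff] at hl
  rw [hJeq, hI1eq, hmass, max_le_iff, ← EReal.coe_mul, ← EReal.coe_add, EReal.coe_le_coe_iff,
    EReal.coe_le_coe_iff] at hu
  refine ⟨∫ x, g₁ x (m x) (h μ x), ∫ x, m x * g₁ x (m x) (h μ x), hJeq, ?_, ?_, hl, hu.1, hu.2⟩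
  · refine integral_mono_ae hJi (hmul _ hgi) ?_
    filter_upwards [hg2nn] with x hx
    rw [hsum]
    exact mul_le_mul_of_nonneg_left (le_add_of_nonneg_right hx) (hm0 x)
  · simp_rw [hsum]
    rw [integral_add hg1i hg2i]
    linarith

/-- Uniform bounds for solutions of the variational inequality tested with constants. -/
lemma apriori (hd : 0 < d) {E : Set ℝ} {H : Hamiltonian d} {h : Mac d → C(Torus d, ℝ)}
    {g g₁ g₂ : Torus d → ℝ → ℝ → ℝ} {γ : ℝ} (R : Regular E H h) (hyp_g : HypG E h g g₁ g₂)
    (hyp : HypGrowth E H h g γ) :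
    ∃ B : ℝ, ∀ m u : SmoothFun d, (∀ x, m x ∈ E) →
      (∀ c : ℝ, c = 1 ∨ c = 2 ∨ c = 1 / 2 →
        0 ≤ ∫ x, Regular.weakIntegrand H h m u (smoothConst d c - m) (0 - u) x) →
      (extIntegral fun x => (smoothMeasure m).dens x *
          g₁ x ((smoothMeasure m).dens x) (h (smoothMeasure m) x)) ≤ (B : EReal) ∧
        ∫ x, ‖grad u x‖ ^ γ ≤ B ∧ |∫ x, u x| ≤ B := by
  obtain ⟨hγ, τ, C₁, C₂, C₃, C₄, hτ0, hτ1, hC₁, hC₂, hC₃, hC₄, hpt, hint⟩ := hyp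
  obtain ⟨c, r, hc, hr, hG⟩ := hyp_g.bounds_smooth R
  obtain ⟨Cδ, hCδ, hG⟩ := hG (C₂ / (2 * (C₃ + C₃ * c + C₁))) (by positivity)
  obtain ⟨B, hB⟩ := apriori_arith hC₁ hC₂ hC₃ hc hr rfl hCδ
  refine ⟨B, fun m u hm htest => ?_⟩
  obtain ⟨I₁, J, hJeq, hJ, hGI, hJr, hI₁, hMm⟩ := hG m hm
  set μ := smoothMeasure m with hμ
  have hγ0 : (0 : ℝ) ≤ γ := by linarith
  have hm0 : ∀ x, 0 ≤ m x := fun x => R.half.nonneg (hm x)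
  have hmc := continuous_smooth m
  have hdens : μ.dens =ᵐ[volume] m := dens_smoothMeasure hm0
  have hval : μ.ValuedIn E := by
    filter_upwards [hdens] with x hx
    rw [hx]; exact hm x
  -- Where `m` vanishes, `0 ∈ E` and hence `τ = 0`, so the weight `m ^ (-τ)` is continuous in either
  -- case.
  have hτm : ∀ x, 0 < m x ∨ τ = 0 := by
    intro x
    rcases (hm0 x).lt_or_eq with h0 | h0
    · exact Or.inl h0
    · exact Or.inr (tau_eq_zero hd R.half (h0 ▸ hm x) R.contDiffOn hyp_g.continuousOn hτ0 hC₁ hpt)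
  have hmτ : Continuous fun x => m x ^ (-τ) := by
    refine hmc.rpow_const fun x => ?_
    rcases hτm x with h0 | h0
    · exact Or.inl h0.ne'
    · exact Or.inr (by rw [h0]; simp)
  have hDc : Continuous fun x => ‖grad u x‖ ^ γ :=
    (continuous_grad u).norm.rpow_const fun _ => Or.inr hγ0
  have hgc : Continuous fun x => g x (m x) (h μ x) :=
    hyp_g.continuousOn.comp_continuous (f := fun x => ((x, m x, h μ x) : Torus d × ℝ × ℝ))
      (continuous_id.prodMk (hmc.prodMk (h μ).continuous)) hm
  have hHc : Continuous fun x => alongJet H m u (h μ) x :=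
    continuous_smooth (R.jet R.contDiffOn hm u)
  have hLc : Continuous fun x => -alongJet H m u (h μ) x
        + ∑ i, alongJet (DpH H i) m u (h μ) x * grad u x i
        + ∑ i, ∑ j, alongJet (DMH H i j) m u (h μ) x * hess u x i j := by
    refine (hHc.neg.add ?_).add ?_
    · exact continuous_finsetSum _ fun i _ =>
        (continuous_smooth (R.jet (contDiffOn_DpH R.half R.contDiffOn i) hm u)).mul
          (continuous_smooth (dpartial i u))
    · exact continuous_finsetSum _ fun i _ => continuous_finsetSum _ fun j _ =>
        (continuous_smooth (R.jet (contDiffOn_DMH R.half R.contDiffOn i j) hm u)).mul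
          (continuous_smooth (dpartial i (dpartial j u)))
  set Lf : Torus d → ℝ := fun x => -alongJet H m u (h μ) x
        + ∑ i, alongJet (DpH H i) m u (h μ) x * grad u x i
        + ∑ i, ∑ j, alongJet (DMH H i j) m u (h μ) x * hess u x i j with hLf
  have hptL : ∀ x, 1 / C₁ * (m x ^ (-τ) * ‖grad u x‖ ^ γ) + C₂ * g x (m x) (h μ x) - C₁ ≤ Lf x :=
    fun x => hpt x (grad u x) (hess u x) (m x) (hm x) (h μ x)
  have iu := integrable_smooth u
  have iH := integrable_of_continuous hHc
  have imL : Integrable fun x => m x * Lf x := integrable_of_continuous (hmc.mul hLc)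
  have htest' : ∀ c : ℝ, c = 1 ∨ c = 2 ∨ c = 1 / 2 →
      0 ≤ (1 - c) * (∫ x, u x) - c * (∫ x, alongJet H m u (h μ) x) - ∫ x, m x * Lf x := by
    intro c hc
    have h1 := htest c hc
    simp_rw [weakIntegrand_const_sub] at h1
    have i1 : Integrable fun x => (1 - c) * u x - c * alongJet H m u (h μ) x :=
      (iu.const_mul _).sub (iH.const_mul _)
    have h2 : 0 ≤ ∫ x, ((1 - c) * u x - c * alongJet H m u (h μ) x - m x * Lf x) := h1
    rwa [integral_sub i1 imL, integral_sub (iu.const_mul _) (iH.const_mul _), integral_const_mul,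
      integral_const_mul] at h2
  have iD1 : Integrable fun x => ‖grad u x‖ ^ γ * m x ^ (-τ) :=
    integrable_of_continuous (hDc.mul hmτ)
  have hgrow := (hint μ u (grad u) (hess u) hval (isSobolevOne_smooth u)
    (fun i j => ⟨integrable_smooth (dpartial i (dpartial j u)),
      isWeakDeriv_smooth [i] (dpartial j u)⟩)
    ((integrable_of_continuous hgc).congr (by filter_upwards [hdens] with x hx; rw [hx]))
    (iD1.congr (by filter_upwards [hdens] with x hx; rw [hx]))
    (iH.congr (by filter_upwards [hdens] with x hx; rw [hx]; rfl))).1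
  have eG : ∫ x, g x (μ.dens x) (h μ x) = ∫ x, g x (m x) (h μ x) :=
    integral_congr_ae (by filter_upwards [hdens] with x hx; rw [hx])
  have eD : ∫ x, ‖grad u x‖ ^ γ * μ.dens x ^ (-τ) = ∫ x, ‖grad u x‖ ^ γ * m x ^ (-τ) :=
    integral_congr_ae (by filter_upwards [hdens] with x hx; rw [hx])
  have eH : ∫ x, H x (grad u x) (hess u x) (μ.dens x) (h μ x) = ∫ x, alongJet H m u (h μ) x :=
    integral_congr_ae (by filter_upwards [hdens] with x hx; rw [hx]; rfl)
  rw [eG, eD, eH] at hgrow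
  have iD2 : Integrable fun x => m x * (m x ^ (-τ) * ‖grad u x‖ ^ γ) :=
    integrable_of_continuous (hmc.mul (hmτ.mul hDc))
  have iMG : Integrable fun x => m x * g x (m x) (h μ x) :=
    integrable_of_continuous (hmc.mul hgc)
  have hML : 1 / C₁ * (∫ x, m x * (m x ^ (-τ) * ‖grad u x‖ ^ γ)) +
      C₂ * (∫ x, m x * g x (m x) (h μ x)) - C₁ * ∫ x, m x ≤ ∫ x, m x * Lf x := by
    have i12 : Integrable fun x => 1 / C₁ * (m x * (m x ^ (-τ) * ‖grad u x‖ ^ γ)) +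
        C₂ * (m x * g x (m x) (h μ x)) := (iD2.const_mul _).add (iMG.const_mul _)
    rw [← integral_const_mul, ← integral_const_mul, ← integral_const_mul,
      ← integral_add (iD2.const_mul _) (iMG.const_mul _),
      ← integral_sub i12 ((integrable_smooth m).const_mul _)]
    refine integral_mono (i12.sub ((integrable_smooth m).const_mul _)) imL fun x => ?_
    have := mul_le_mul_of_nonneg_left (hptL x) (hm0 x)
    refine le_trans (le_of_eq ?_) this
    ring
  have hDD : ∫ x, ‖grad u x‖ ^ γ ≤ (∫ x, ‖grad u x‖ ^ γ * m x ^ (-τ)) +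
      ∫ x, m x * (m x ^ (-τ) * ‖grad u x‖ ^ γ) := by
    rw [← integral_add iD1 iD2]
    refine integral_mono (integrable_of_continuous hDc) (iD1.add iD2) fun x => ?_
    have hq : 0 ≤ ‖grad u x‖ ^ γ := Real.rpow_nonneg (norm_nonneg _) _
    -- The first weight controls the gradient where `m ≤ 1` and the second where `m ≥ 1`, thanks to
    -- `τ < 1`. This removes the degenerate weight from the gradient bound.
    have hw : 1 ≤ m x ^ (-τ) + m x * m x ^ (-τ) := by
      rcases hτm x with h0 | h0
      · have hpos : 0 < m x ^ (-τ) := Real.rpow_pos_of_pos h0 _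
        rcases le_total (m x) 1 with h1 | h1
        · have : 1 ≤ m x ^ (-τ) := Real.one_le_rpow_of_pos_of_le_one_of_nonpos h0 h1 (by linarith)
          nlinarith
        · have h2 : m x * m x ^ (-τ) = m x ^ (1 - τ) := by
            rw [sub_eq_add_neg, Real.rpow_add h0, Real.rpow_one]
          have : 1 ≤ m x ^ (1 - τ) := Real.one_le_rpow h1 (by linarith)
          linarith
      · rw [h0, neg_zero, Real.rpow_zero]
        linarith [hm0 x]
    nlinarith
  have t1 := htest' 1 (Or.inl rfl)
  have t2 := htest' 2 (Or.inr (Or.inl rfl))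
  have t3 := htest' (1 / 2) (Or.inr (Or.inr rfl))
  have hfin := hB (∫ x, u x) (∫ x, alongJet H m u (h μ) x) (∫ x, m x * Lf x)
    (∫ x, g x (m x) (h μ x)) (∫ x, m x * g x (m x) (h μ x)) I₁ J (∫ x, m x)
    (∫ x, ‖grad u x‖ ^ γ * m x ^ (-τ)) (∫ x, m x * (m x ^ (-τ) * ‖grad u x‖ ^ γ))
    (∫ x, ‖grad u x‖ ^ γ) (by linarith) (by linarith) (by linarith) hgrow hML hJ hGI hJr hI₁ hMm
    hDD
    (integral_nonneg fun x => mul_nonneg (Real.rpow_nonneg (norm_nonneg _) _)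
      (Real.rpow_nonneg (hm0 x) _))
    (integral_nonneg fun x => mul_nonneg (hm0 x) (mul_nonneg (Real.rpow_nonneg (hm0 x) _)
      (Real.rpow_nonneg (norm_nonneg _) _)))
  exact ⟨by rw [hJeq]; exact EReal.coe_le_coe_iff.2 hfin.1, hfin.2⟩

/-! ### The variational inequality on finite-dimensional convex sets -/

/-- `φ ↦ ∫ φ a`. -/
def pairing (a : SmoothFun d) : SmoothFun d →ₗ[ℝ] ℝ where
  toFun φ := ∫ x, φ x * a x
  map_add' φ ψ := by
    have h1 : Integrable fun x => φ x * a x := integrable_smooth (smoothMul φ a)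
    have h2 : Integrable fun x => ψ x * a x := integrable_smooth (smoothMul ψ a)
    rw [← integral_add h1 h2]
    congr 1; funext x; simp [add_mul]
  map_smul' c φ := by
    rw [RingHom.id_apply, smul_eq_mul, ← integral_const_mul]
    congr 1; funext x; simp [mul_assoc]

namespace Regular

variable {E : Set ℝ} {H : Hamiltonian d} {h : Mac d → C(Torus d, ℝ)}

open Classical in
/-- `A` as a map into linear functionals (zero outside the domain of `A`). -/
def op (R : Regular E H h) (z : SmoothFun d × SmoothFun d) : SmoothFun d × SmoothFun d →ₗ[ℝ] ℝ :=
  if hz : ∀ x, z.1 x ∈ E then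
    pairing (R.smoothA₁ hz z.2) ∘ₗ LinearMap.fst ℝ _ _
      + pairing (R.smoothA₂ hz z.2) ∘ₗ LinearMap.snd ℝ _ _
  else 0

lemma op_apply (R : Regular E H h) {z : SmoothFun d × SmoothFun d} (hz : ∀ x, z.1 x ∈ E)
    (w : SmoothFun d × SmoothFun d) :
    R.op z w = (∫ x, w.1 x * R.smoothA₁ hz z.2 x) + ∫ x, w.2 x * R.smoothA₂ hz z.2 x := by
  rw [op, dif_pos hz]
  rfl

lemma op_eq_weak (R : Regular E H h) {z : SmoothFun d × SmoothFun d} (hz : ∀ x, z.1 x ∈ E)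
    (w : SmoothFun d × SmoothFun d) :
    R.op z w = ∫ x, weakIntegrand H h z.1 z.2 w.1 w.2 x := by
  rw [R.op_apply hz, R.integral_A hz]

lemma op_monotone (R : Regular E H h) (hmono : HypMonotone E H h)
    {z w : SmoothFun d × SmoothFun d} (hz : ∀ x, z.1 x ∈ E) (hw : ∀ x, w.1 x ∈ E) :
    0 ≤ R.op z (z - w) - R.op w (z - w) := by
  have h1 := hmono z.1 z.2 w.1 w.2 hz hw
  have hint : ∀ f g : SmoothFun d, Integrable fun x => f x * g x := fun f g =>
    integrable_smooth (smoothMul f g)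
  have e : ∀ a b φ : SmoothFun d, ∫ x, (a x - b x) * φ x =
      (∫ x, φ x * a x) - ∫ x, φ x * b x := by
    intro a b φ
    rw [← integral_sub (hint φ a) (hint φ b)]
    congr 1; funext x; ring
  simp only [← R.smoothA₁_apply hz, ← R.smoothA₁_apply hw, ← R.smoothA₂_apply hz,
    ← R.smoothA₂_apply hw] at h1
  have e1 := e (R.smoothA₁ hz z.2) (R.smoothA₁ hw w.2) (z.1 - w.1)
  have e2 := e (R.smoothA₂ hz z.2) (R.smoothA₂ hw w.2) (z.2 - w.2)
  simp only [SmoothFun.sub_apply] at e1 e2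
  rw [e1, e2] at h1
  rw [R.op_apply hz, R.op_apply hw]
  simp only [Prod.fst_sub, Prod.snd_sub, SmoothFun.sub_apply]
  linarith

lemma op_hemicontinuous (R : Regular E H h) {z w : SmoothFun d × SmoothFun d}
    (hz : ∀ x, z.1 x ∈ E) (hw : ∀ x, w.1 x ∈ E) (y : SmoothFun d × SmoothFun d) :
    Tendsto (fun t : ℝ => R.op (z + t • (w - z)) y) (𝓝[>] 0) (𝓝 (R.op z y)) := by
  set F : ℝ → ℝ := fun t =>
    ∫ x, weakIntegrand H h (z.1 + t • (w.1 - z.1)) (z.2 + t • (w.2 - z.2)) y.1 y.2 x with hF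
  have hc : ContinuousOn F (Icc 0 1) := by
    rw [continuousOn_iff_continuous_domRestrict]
    exact R.continuous_integral_weakIntegrand hz hw z.2 (w.2 - z.2) y.1 y.2
  have hmem : ∀ t ∈ Icc (0 : ℝ) 1, R.op (z + t • (w - z)) y = F t := fun t ht =>
    R.op_eq_weak (z := z + t • (w - z)) (R.segment_mem hz hw ht) y
  have h0 := hc 0 (left_mem_Icc.2 zero_le_one)
  have h1 : R.op z y = F 0 := by
    rw [← hmem 0 (left_mem_Icc.2 zero_le_one)]
    simp
  rw [h1]
  have h2 : 𝓝[>] (0 : ℝ) ≤ 𝓝[Icc 0 1] 0 := by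
    rw [← nhdsWithin_Ioc_eq_nhdsGT (zero_lt_one' ℝ)]
    exact nhdsWithin_mono _ Ioc_subset_Icc_self
  refine (Tendsto.mono_left h0 h2).congr' ?_
  filter_upwards [Ioo_mem_nhdsGT (zero_lt_one' ℝ)] with t ht
  exact (hmem t ⟨ht.1.le, ht.2.le⟩).symm

lemma convex_domain (R : Regular E H h) :
    Convex ℝ {z : SmoothFun d × SmoothFun d | ∀ x, z.1 x ∈ E} := by
  intro z hz w hw a b ha hb hab x
  exact R.half.convex (hz x) (hw x) ha hb hab

/-- Solution of the variational inequality on the convex hull of finitely many points. -/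
lemma exists_solution (R : Regular E H h) (hmono : HypMonotone E H h) {n : ℕ} (hn : 0 < n)
    (p : Fin n → SmoothFun d × SmoothFun d) (hp : ∀ k x, (p k).1 x ∈ E) :
    ∃ z : SmoothFun d × SmoothFun d, (∀ x, z.1 x ∈ E) ∧ ∀ k, 0 ≤ R.op z (p k - z) ∧
      0 ≤ R.op (p k) (p k - z) := by
  have hK : convexHull ℝ (range p) ⊆ {z | ∀ x, z.1 x ∈ E} :=
    convexHull_min (by rintro _ ⟨k, rfl⟩; exact hp k) R.convex_domain
  obtain ⟨z, hz, hzp⟩ := exists_stampacchia hn p R.op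
    (fun x hx y hy => R.op_monotone hmono (hK hx) (hK hy))
    (fun x hx y hy => R.op_hemicontinuous (hK hx) (hK hy) _)
  refine ⟨z, hK hz, fun k => ?_⟩
  have h1 := hzp (p k) (subset_convexHull ℝ _ (mem_range_self k))
  have h2 := R.op_monotone hmono (hp k) (hK hz)
  exact ⟨h1, by linarith⟩

end Regular

/-! ### Passage to the limit -/

lemma integrable_mul_continuousMap {f : Torus d → ℝ} (hf : Integrable f) (b : C(Torus d, ℝ)) :
    Integrable fun x => f x * b x :=
  hf.mul_bdd b.continuous.aestronglyMeasurable
    (Eventually.of_forall fun x => b.norm_coe_le_norm x)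

lemma abs_integral_mul_le {f : Torus d → ℝ} (hf : Integrable f) (b : C(Torus d, ℝ)) {K : ℝ}
    (hK : ∀ x, |b x| ≤ K) : |∫ x, f x * b x| ≤ (∫ x, |f x|) * K := by
  rw [← integral_mul_const]
  refine abs_integral_le_integral_abs.trans ?_
  refine integral_mono (integrable_mul_continuousMap hf b).abs (hf.abs.mul_const K) fun x => ?_
  simp only [abs_mul]
  exact mul_le_mul_of_nonneg_left (hK x) (abs_nonneg _)

/-- `b ↦ ∫ f b` on continuous functions. -/
def integralCLM (f : Torus d → ℝ) (hf : Integrable f) : C(Torus d, ℝ) →L[ℝ] ℝ :=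
  LinearMap.mkContinuous
    { toFun := fun b => ∫ x, f x * b x
      map_add' := fun b c => by
        rw [← integral_add (integrable_mul_continuousMap hf b) (integrable_mul_continuousMap hf c)]
        congr 1; funext x; simp [mul_add]
      map_smul' := fun r b => by
        rw [RingHom.id_apply, smul_eq_mul, ← integral_const_mul]
        congr 1; funext x; simp only [ContinuousMap.smul_apply, smul_eq_mul]; ring }
    (∫ x, |f x|) fun b => abs_integral_mul_le hf b fun x => b.norm_coe_le_norm x

/-- The distribution given by an integrable function. -/
def distOf (f : Torus d → ℝ) (hf : Integrable f) : TorusDistribution d where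
  toFun := (integralCLM f hf).toLinearMap ∘ₗ (SmoothFun d).subtype
  cont := ⟨0, ∫ x, |f x|, fun φ _ hB => abs_integral_mul_le hf φ.1 (hB [] (by simp))⟩

lemma distOf_apply (f : Torus d → ℝ) (hf : Integrable f) (φ : SmoothFun d) :
    (distOf f hf).toFun φ = ∫ x, f x * φ x := rfl

lemma tendsto_integral_mul_of_L1 {f : ℕ → C(Torus d, ℝ)} {F : Torus d → ℝ} (hF : Integrable F)
    (h : Tendsto (fun n => ∫ x, |f n x - F x|) atTop (𝓝 0)) (b : C(Torus d, ℝ)) :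
    Tendsto (fun n => ∫ x, f n x * b x) atTop (𝓝 (∫ x, F x * b x)) := by
  rw [tendsto_iff_norm_sub_tendsto_zero]
  have h1 : Tendsto (fun n => (∫ x, |f n x - F x|) * ‖b‖) atTop (𝓝 0) := by
    simpa using h.mul_const ‖b‖
  refine squeeze_zero (fun _ => norm_nonneg _) (fun n => ?_) h1
  have hfn := integrable_of_continuous (f n).continuous
  have h2 : (∫ x, f n x * b x) - ∫ x, F x * b x = ∫ x, (f n x - F x) * b x := by
    rw [← integral_sub (integrable_mul_continuousMap hfn b) (integrable_mul_continuousMap hF b)]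
    congr 1; funext x; ring
  rw [h2, Real.norm_eq_abs]
  exact abs_integral_mul_le (hfn.sub hF) b fun x => b.norm_coe_le_norm x

lemma rpow_add_le {γ : ℝ} (hγ : 1 < γ) {a b : ℝ} (ha : 0 ≤ a) (hb : 0 ≤ b) :
    (a + b) ^ γ ≤ 2 ^ γ * (a ^ γ + b ^ γ) := by
  have hγ0 : (0 : ℝ) ≤ γ := by linarith
  have h1 : a + b ≤ 2 * max a b := by linarith [le_max_left a b, le_max_right a b]
  have h2 : (max a b) ^ γ ≤ a ^ γ + b ^ γ := by
    rcases max_choice a b with h | h <;> rw [h]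
    · linarith [Real.rpow_nonneg hb γ]
    · linarith [Real.rpow_nonneg ha γ]
  calc (a + b) ^ γ ≤ (2 * max a b) ^ γ := Real.rpow_le_rpow (by positivity) h1 hγ0
    _ = 2 ^ γ * (max a b) ^ γ := Real.mul_rpow zero_le_two (le_max_of_le_left ha)
    _ ≤ _ := by gcongr

/-- Bounds on the gradient and the mean bound a smooth function in `L^γ`. -/
lemma integral_abs_rpow_le {γ : ℝ} (hγ : 1 < γ) {B : ℝ} (u : SmoothFun d)
    (h1 : ∫ x, ‖grad u x‖ ^ γ ≤ B) (h2 : |∫ x, u x| ≤ B) :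
    ∫ x, |u x| ^ γ ≤ 2 ^ γ * ((d : ℝ) ^ γ * B + B ^ γ) := by
  have hγ0 : (0 : ℝ) ≤ γ := by linarith
  have hcu := continuous_smooth u
  have i1 : Integrable fun x => |u x - ∫ y, u y| ^ γ :=
    integrable_of_continuous ((hcu.sub continuous_const).abs.rpow_const fun _ => Or.inr hγ0)
  have i2 : Integrable fun _ : Torus d => |∫ y, u y| ^ γ := integrable_const _
  have i12 : Integrable fun x => |u x - ∫ y, u y| ^ γ + |∫ y, u y| ^ γ := i1.add i2
  calc ∫ x, |u x| ^ γ ≤ ∫ x, 2 ^ γ * (|u x - ∫ y, u y| ^ γ + |∫ y, u y| ^ γ) := by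
        refine integral_mono (integrable_of_continuous (hcu.abs.rpow_const fun _ => Or.inr hγ0))
          (i12.const_mul _) fun x => ?_
        refine le_trans (Real.rpow_le_rpow (abs_nonneg _) ?_ hγ0)
          (rpow_add_le hγ (abs_nonneg _) (abs_nonneg _))
        have := abs_add_le (u x - ∫ y, u y) (∫ y, u y)
        rwa [sub_add_cancel] at this
    _ = 2 ^ γ * ((∫ x, |u x - ∫ y, u y| ^ γ) + |∫ y, u y| ^ γ) := by
        rw [integral_const_mul, integral_add i1 i2]
        simp
    _ ≤ 2 ^ γ * ((d : ℝ) ^ γ * B + B ^ γ) := by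
        have h3 := integral_rpow_sub_mean_le hγ u
        gcongr
        refine h3.trans ?_
        gcongr

lemma grad_smoothConst (c : ℝ) : grad (smoothConst d c) = fun _ => 0 := by
  funext x
  ext i
  exact congrArg (fun k : SmoothFun d => k x) (dpartial_const i c)

lemma hess_smoothConst (c : ℝ) : hess (smoothConst d c) = fun _ => 0 := by
  funext x i j
  have h1 : dpartial i (dpartial j (smoothConst d c)) = 0 := by
    rw [dpartial_const]
    exact (dpartialₗ i).map_zero
  exact congrArg (fun k : SmoothFun d => k x) h1

/-- Every family of points of a second countable space has a countable dense subfamily. -/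
lemma exists_dense_subfamily {Y Z : Type*} [Nonempty Y] [TopologicalSpace Z]
    [SecondCountableTopology Z] (Θ : Y → Z) :
    ∃ W : ℕ → Y, ∀ y, Θ y ∈ closure (range fun n => Θ (W n)) := by
  have : Nonempty (range Θ) := (range_nonempty Θ).to_subtype
  choose W hW using fun n : ℕ => (TopologicalSpace.denseSeq (range Θ) n).2
  refine ⟨W, fun y => ?_⟩
  have h1 := TopologicalSpace.denseRange_denseSeq (range Θ) ⟨Θ y, mem_range_self y⟩
  have h2 := (image_closure_subset_closure_image continuous_subtype_val)
    (mem_image_of_mem Subtype.val h1)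
  rw [← range_comp] at h2
  have h3 : (fun n => Θ (W n)) = Subtype.val ∘ TopologicalSpace.denseSeq (range Θ) := funext hW
  rw [h3]
  exact h2

/-- The mass of a solution of the weak inequality is one. -/
lemma Regular.mass_eq_one {E : Set ℝ} {H : Hamiltonian d} {h : Mac d → C(Torus d, ℝ)}
    (R : Regular E H h) {m w : Torus d → ℝ} (hm : Integrable m)
    (hmin : ∀ (z : SmoothFun d × SmoothFun d) (hz : ∀ x, z.1 x ∈ E),
      (∫ x, m x * R.smoothA₁ hz z.2 x) + ∫ x, w x * R.smoothA₂ hz z.2 x ≤ R.op z z) :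
    ∫ x, m x = 1 := by
  have h1E : ∀ x : Torus d, smoothConst d 1 x ∈ E := fun x => R.half.pos_mem one_pos
  set h0 : SmoothFun d := R.jet R.contDiffOn h1E (smoothConst d 0) with hh0
  set b : SmoothFun d := R.smoothA₂ h1E (smoothConst d 0) with hb
  -- Constants `v = c` have zero derivatives: the first component of `A` is affine in `c`, and the
  -- second does not depend on `c`.
  have eA1 : ∀ (c : ℝ) (x : Torus d), R.smoothA₁ h1E (smoothConst d c) x = -c - h0 x := by
    intro c x
    rw [R.smoothA₁_apply, hh0, R.jet_apply, A₁, grad_smoothConst, hess_smoothConst,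
      grad_smoothConst, hess_smoothConst]
    rfl
  have eA2 : ∀ (c : ℝ) (x : Torus d), R.smoothA₂ h1E (smoothConst d c) x = b x := by
    intro c x
    rw [hb, R.smoothA₂_apply, R.smoothA₂_apply, A₂, A₂, grad_smoothConst, hess_smoothConst,
      grad_smoothConst, hess_smoothConst]
  have hb0 : ∫ x, b x = 0 := by
    have h2 := R.integral_A h1E (smoothConst d 0) 0 (smoothConst d 1)
    have h3 : ∀ x, Regular.weakIntegrand H h (smoothConst d 1) (smoothConst d 0) 0
        (smoothConst d 1) x = 0 := by
      intro x
      have e1 : ∀ i, pderiv i (smoothConst d 1) x = 0 := fun i =>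
        congrArg (fun k : SmoothFun d => k x) (dpartial_const i 1)
      simp [Regular.weakIntegrand, e1, hess_smoothConst]
    simp_rw [h3] at h2
    simpa using h2
  have key : ∀ c : ℝ, 0 ≤ c * ((∫ x, m x) - 1) +
      ((∫ x, m x * h0 x) - (∫ x, h0 x) - ∫ x, w x * b x) := by
    intro c
    have h2 := hmin (smoothConst d 1, smoothConst d c) h1E
    rw [R.op_apply (z := (smoothConst d 1, smoothConst d c)) h1E] at h2
    simp only [eA1, eA2, smoothConst_apply, one_mul] at h2
    have i1 : Integrable fun x => m x * h0 x := integrable_mul_continuousMap hm h0.1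
    have e1 : ∫ x, m x * (-c - h0 x) = -c * (∫ x, m x) - ∫ x, m x * h0 x := by
      rw [← integral_const_mul, ← integral_sub (hm.const_mul _) i1]
      congr 1; funext x; ring
    have e2 : ∫ x, (-c - h0 x) = -c - ∫ x, h0 x := by
      rw [integral_sub (integrable_const _) (integrable_smooth h0)]
      simp
    rw [e1, e2, integral_const_mul, hb0] at h2
    linarith
  set P := (∫ x, m x) - 1 with hP
  set Q := (∫ x, m x * h0 x) - (∫ x, h0 x) - ∫ x, w x * b x with hQ
  have hP0 : P = 0 := by
    by_contra hne
    -- An affine function of `c` that is nonnegative on all of `ℝ` has zero slope; at this `c` it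
    -- would equal `-1`.
    have h2 := key (-(Q + 1) / P)
    rw [div_mul_cancel₀ _ hne] at h2
    linarith
  linarith

/-- Approximate solutions: they satisfy the a priori bounds, and the inequality of the weak
formulation at any given finite number of test pairs. -/
lemma Regular.exists_approx (hd : 0 < d) {E : Set ℝ} {H : Hamiltonian d}
    {h : Mac d → C(Torus d, ℝ)} {g g₁ g₂ : Torus d → ℝ → ℝ → ℝ} {γ : ℝ} (R : Regular E H h)
    (hyp_g : HypG E h g g₁ g₂) (hyp : HypGrowth E H h g γ) (hmono : HypMonotone E H h)
    (W : ℕ → SmoothFun d × SmoothFun d) (hW : ∀ k x, (W k).1 x ∈ E) :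
    ∃ (B : ℝ) (z : ℕ → SmoothFun d × SmoothFun d), ∀ n, (∀ x, (z n).1 x ∈ E) ∧
      (extIntegral fun x => (smoothMeasure (z n).1).dens x *
          g₁ x ((smoothMeasure (z n).1).dens x) (h (smoothMeasure (z n).1) x)) ≤ (B : EReal) ∧
      ∫ x, ‖grad (z n).2 x‖ ^ γ ≤ B ∧ |∫ x, (z n).2 x| ≤ B ∧
      ∀ k < n, 0 ≤ R.op (W k) (W k - z n) := by
  obtain ⟨B, hB⟩ := apriori hd R hyp_g hyp
  -- The three constants needed for the a priori bounds are vertices of every hull; the test pairs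
  -- follow with index shifted by three.
  let q : ℕ → SmoothFun d × SmoothFun d
    | 0 => (smoothConst d 1, 0)
    | 1 => (smoothConst d 2, 0)
    | 2 => (smoothConst d (1 / 2), 0)
    | k + 3 => W k
  have hq : ∀ k x, (q k).1 x ∈ E := fun k x => match k with
    | 0 => R.half.pos_mem one_pos
    | 1 => R.half.pos_mem two_pos
    | 2 => R.half.pos_mem one_half_pos
    | k + 3 => hW k x
  choose z hz hzq using fun n : ℕ => R.exists_solution hmono (Nat.succ_pos (n + 2))
    (fun k : Fin (n + 3) => q k) fun k x => hq k x
  refine ⟨B, z, fun n => ?_⟩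
  have h1 : ∀ c : ℝ, c = 1 ∨ c = 2 ∨ c = 1 / 2 → 0 ≤ ∫ x, Regular.weakIntegrand H h (z n).1 (z n).2
      (smoothConst d c - (z n).1) (0 - (z n).2) x := by
    intro c hc
    rw [← R.op_eq_weak (hz n) (smoothConst d c - (z n).1, 0 - (z n).2)]
    rcases hc with rfl | rfl | rfl
    · exact (hzq n ⟨0, by lia⟩).1
    · exact (hzq n ⟨1, by lia⟩).1
    · exact (hzq n ⟨2, by lia⟩).1
  obtain ⟨b1, b2, b3⟩ := hB _ _ (hz n) h1
  exact ⟨hz n, b1, b2, b3, fun k hk => (hzq n ⟨k + 3, by lia⟩).2⟩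

lemma abs_pderiv_le_norm_grad (i : Fin d) (u : SmoothFun d) (x : Torus d) :
    |pderiv i u x| ≤ ‖grad u x‖ :=
  PiLp.norm_apply_le (grad u x) i

/-- A sequence of smooth functions bounded in `W^{1,γ}` has a limit, along convex combinations,
in `W^{1,γ}`. -/
lemma exists_sobolev_limit {γ : ℝ} (hγ : 1 < γ) {B : ℝ} (u : ℕ → SmoothFun d)
    (h1 : ∀ n, ∫ x, ‖grad (u n) x‖ ^ γ ≤ B) (h2 : ∀ n, |∫ x, u n x| ≤ B) :
    ∃ (w : Torus d → ℝ) (Dw : Torus d → EuclideanSpace ℝ (Fin d)), IsSobolevOne γ w Dw ∧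
      ∃ v : ℕ → SmoothFun d, (∀ n, v n ∈ convexHull ℝ (u '' Ici n)) ∧
        ∀ b : C(Torus d, ℝ), Tendsto (fun n => ∫ x, v n x * b x) atTop (𝓝 (∫ x, w x * b x)) := by
  have hγ0 : (0 : ℝ) ≤ γ := by linarith
  have hγ1 : 1 ≤ ENNReal.ofReal γ := by simpa using hγ.le
  -- `none` stands for the function and `some i` for its `i`-th derivative, so one convex
  -- combination serves them all.
  let T : Option (Fin d) → SmoothFun d →ₗ[ℝ] C(Torus d, ℝ) := fun o =>
    o.elim (SmoothFun d).subtype fun i => (SmoothFun d).subtype ∘ₗ dpartialₗ i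
  have hT : ∀ o n, ∫ x, |T o (u n) x| ^ γ ≤ max B (2 ^ γ * ((d : ℝ) ^ γ * B + B ^ γ)) := by
    rintro (_ | i) n
    · exact (integral_abs_rpow_le hγ (u n) (h1 n) (h2 n)).trans (le_max_right _ _)
    · refine le_trans (integral_mono ?_ ?_ fun x => ?_) ((h1 n).trans (le_max_left _ _))
      · exact integrable_of_continuous
          ((continuous_smooth (dpartial i (u n))).abs.rpow_const fun _ => Or.inr hγ0)
      · exact integrable_of_continuous
          ((continuous_grad (u n)).norm.rpow_const fun _ => Or.inr hγ0)
      · exact Real.rpow_le_rpow (abs_nonneg _) (abs_pderiv_le_norm_grad i (u n) x) hγ0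
  obtain ⟨v, hv, F, hF⟩ := exists_convex_tendsto T hγ u hT
  have hFi : ∀ o, Integrable (F o) := fun o => (hF o).1.integrable hγ1
  have hlim : ∀ o (b : C(Torus d, ℝ)),
      Tendsto (fun n => ∫ x, T o (v n) x * b x) atTop (𝓝 (∫ x, F o x * b x)) := fun o b =>
    tendsto_integral_mul_of_L1 (hFi o) (hF o).2 b
  refine ⟨F none, fun x => WithLp.toLp 2 fun i => F (some i) x,
    ⟨(hF none).1, fun i => (hF (some i)).1, fun i φ => ?_⟩, v, hv, hlim none⟩
  have l1 := hlim none (dpartial i φ).1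
  have l2 := (hlim (some i) φ.1).neg
  have h3 := tendsto_nhds_unique (l1.congr fun n => integral_mul_pderiv i (v n) φ) l2
  simpa [iterPartial] using h3

/-- Linear upper bounds pass to limits of convex combinations. -/
lemma integral_mul_le_of_convexHull {u v : ℕ → SmoothFun d} {w : Torus d → ℝ}
    (hv : ∀ n, v n ∈ convexHull ℝ (u '' Ici n)) (b : SmoothFun d)
    (hw : Tendsto (fun n => ∫ x, v n x * b x) atTop (𝓝 (∫ x, w x * b x))) {r : ℕ → ℝ} {r₀ : ℝ}
    (hr : Tendsto r atTop (𝓝 r₀)) (hu : ∀ᶠ n in atTop, ∫ x, u n x * b x ≤ r n) :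
    ∫ x, w x * b x ≤ r₀ := by
  -- For `s > r₀` a whole tail of `u` lies in the half-space `pairing b ≤ s`, hence so does the
  -- convex hull of that tail.
  refine le_of_forall_gt_imp_ge_of_dense fun s hs => ?_
  obtain ⟨N, hN⟩ := eventually_atTop.1 (hu.and (hr.eventually_lt_const hs))
  refine le_of_tendsto hw (eventually_atTop.2 ⟨N, fun n hn => ?_⟩)
  have hc : Convex ℝ {φ : SmoothFun d | pairing b φ ≤ s} :=
    convex_halfSpace_le (pairing b).isLinear s
  refine convexHull_min ?_ hc (hv n)
  rintro _ ⟨k, hk, rfl⟩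
  obtain ⟨h1, h2⟩ := hN k (hn.trans hk)
  exact h1.trans h2.le

/-- Weak limits in `L¹` of nonnegative functions are nonnegative. -/
lemma ae_nonneg_of_weak_limit {f : ℕ → Torus d → ℝ} (hf : ∀ n x, 0 ≤ f n x) {m : Torus d → ℝ}
    (hm : Integrable m)
    (hlim : ∀ φ : Torus d → ℝ, Measurable φ → (∃ K : ℝ, ∀ x, |φ x| ≤ K) →
      Tendsto (fun n => ∫ x, f n x * φ x) atTop (𝓝 (∫ x, m x * φ x))) :
    0 ≤ᵐ[volume] m := by
  refine ae_nonneg_of_forall_setIntegral_nonneg hm fun s hs _ => ?_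
  have h1 := hlim (s.indicator 1) (measurable_one.indicator hs) ⟨1, fun x => by
    by_cases hx : x ∈ s <;> simp [hx]⟩
  have h2 : ∫ x, m x * s.indicator 1 x = ∫ x in s, m x := by
    rw [← integral_indicator hs]
    congr 1; funext x
    by_cases hx : x ∈ s <;> simp [hx]
  rw [h2] at h1
  exact ge_of_tendsto' h1 fun n => integral_nonneg fun x =>
    mul_nonneg (hf n x) (indicator_nonneg (fun _ _ => zero_le_one) x)

/-- Weak limits of the approximate solutions satisfy the weak inequality. -/
lemma Regular.exists_weak_limit (hd : 0 < d) {E : Set ℝ} {H : Hamiltonian d}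
    {h : Mac d → C(Torus d, ℝ)} {g g₁ g₂ : Torus d → ℝ → ℝ → ℝ} {γ : ℝ} (R : Regular E H h)
    (hyp_g : HypG E h g g₁ g₂) (hyp_gei : HypCompact E h g₁) (hyp : HypGrowth E H h g γ)
    (hmono : HypMonotone E H h) :
    ∃ m w : Torus d → ℝ, Integrable m ∧ 0 ≤ᵐ[volume] m ∧ (∃ Dw, IsSobolevOne γ w Dw) ∧
      ∀ (z : SmoothFun d × SmoothFun d) (hz : ∀ x, z.1 x ∈ E),
        (∫ x, m x * R.smoothA₁ hz z.2 x) + ∫ x, w x * R.smoothA₂ hz z.2 x ≤ R.op z z := by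
  have hγ := hyp.1
  let Y := {z : SmoothFun d × SmoothFun d // ∀ x, z.1 x ∈ E}
  have : Nonempty Y := ⟨(smoothConst d 1, 0), fun _ => R.half.pos_mem one_pos⟩
  -- The limit inequality sees a test pair only through these three data, whose space is second
  -- countable in the product of sup norms.
  let Θ : Y → ℝ × C(Torus d, ℝ) × C(Torus d, ℝ) := fun z =>
    (R.op z.1 z.1, (R.smoothA₁ z.2 z.1.2).1, (R.smoothA₂ z.2 z.1.2).1)
  obtain ⟨W, hW⟩ := exists_dense_subfamily Θ
  obtain ⟨B, z, hz⟩ := R.exists_approx hd hyp_g hyp hmono (fun k => (W k).1) fun k => (W k).2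
  have hz0 : ∀ n x, 0 ≤ (z n).1 x := fun n x => R.half.nonneg ((hz n).1 x)
  have hdens : ∀ n, (smoothMeasure (z n).1).dens =ᵐ[volume] (z n).1 := fun n =>
    dens_smoothMeasure (hz0 n)
  obtain ⟨s, hs, m, hm, hmlim⟩ := hyp_gei (fun n => smoothMeasure (z n).1)
    (fun n => (hdens n).mono fun x hx => by rw [hx]; exact (hz n).1 x)
    ⟨B, fun n => (hz n).2.1⟩
  have hmlim' : ∀ φ : Torus d → ℝ, Measurable φ → (∃ K : ℝ, ∀ x, |φ x| ≤ K) →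
      Tendsto (fun n => ∫ x, (z (s n)).1 x * φ x) atTop (𝓝 (∫ x, m x * φ x)) := by
    intro φ hφ hK
    refine (hmlim φ hφ hK).congr fun n => integral_congr_ae ?_
    filter_upwards [hdens (s n)] with x hx
    rw [hx]
  obtain ⟨w, Dw, hwS, v, hv, hvlim⟩ := exists_sobolev_limit hγ (fun n => (z (s n)).2)
    (fun n => (hz (s n)).2.2.1) fun n => (hz (s n)).2.2.2.1
  have hw : Integrable w := hwS.memLp.integrable (by simpa using hγ.le)
  refine ⟨m, w, hm, ae_nonneg_of_weak_limit (fun n => hz0 (s n)) hm hmlim', ⟨Dw, hwS⟩, ?_⟩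
  let S : Set (ℝ × C(Torus d, ℝ) × C(Torus d, ℝ)) :=
    {t | integralCLM m hm t.2.1 + integralCLM w hw t.2.2 ≤ t.1}
  have hS : IsClosed S := isClosed_le (by fun_prop) (by fun_prop)
  have hWS : ∀ k, Θ (W k) ∈ S := by
    intro k
    set a := R.smoothA₁ (W k).2 (W k).1.2
    set b := R.smoothA₂ (W k).2 (W k).1.2
    -- The density converges along the whole subsequence and is placed in the upper bound, so only
    -- `u` is replaced by convex combinations.
    have h1 : Tendsto (fun n => R.op (W k).1 (W k).1 - ∫ x, (z (s n)).1 x * a x) atTop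
        (𝓝 (R.op (W k).1 (W k).1 - ∫ x, m x * a x)) :=
      (hmlim' a (continuous_smooth a).measurable
        ⟨‖a.1‖, fun x => a.1.norm_coe_le_norm x⟩).const_sub _
    have h2 := integral_mul_le_of_convexHull hv b (hvlim b.1) h1 (by
      filter_upwards [eventually_gt_atTop k] with n hn
      -- The `k`-th test pair is a vertex for all later approximations, and `s n ≥ n > k`.
      have h3 := (hz (s n)).2.2.2.2 k (hn.trans_le (hs.id_le n))
      rw [map_sub, R.op_apply (W k).2 (z (s n))] at h3
      linarith)
    change (∫ x, m x * a x) + ∫ x, w x * b x ≤ R.op (W k).1 (W k).1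
    linarith
  intro y hy
  exact closure_minimal (range_subset_iff.2 hWS) hS (hW ⟨y, hy⟩)

end MFG

end

/-! ### Assembly of the weak solution from the limit functions. -/

theorem theorem1p1 {d : ℕ} (hd : 0 < d) (E : Set ℝ) (hE : E = Set.Ioi 0 ∨ E = Set.Ici 0)
    (H : MFG.Hamiltonian d) (h : MFG.Mac d → C(MFG.Torus d, ℝ))
    (g g₁ g₂ : MFG.Torus d → ℝ → ℝ → ℝ) (γ : ℝ)
    (hyp_h : MFG.HypNonlocal h)
    (hyp_g : MFG.HypG E h g g₁ g₂)
    (hyp_gei : MFG.HypCompact E h g₁)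
    (hyp_H1 : MFG.HypGrowth E H h g γ)
    (hyp_H2 : MFG.HypSmooth E H)
    (hyp_H3 : MFG.HypMonotone E H h) :
    ∃ m u : MFG.TorusDistribution d,
      MFG.IsWeakSolution E H h m u ∧
      (∃ μ : MFG.Mac d, m.IsFun μ.dens ∧ ∫ x, μ.dens x = 1) ∧
      (∃ (w : MFG.Torus d → ℝ) (Dw : MFG.Torus d → EuclideanSpace ℝ (Fin d)),
        MFG.IsSobolevOne γ w Dw ∧ u.IsFun w) := by
  have R : MFG.Regular E H h := ⟨hE, hyp_H2, hyp_h⟩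
  obtain ⟨m, w, hm, hm0, ⟨Dw, hwS⟩, hmin⟩ :=
    R.exists_weak_limit hd hyp_g hyp_gei hyp_H1 hyp_H3
  have hw : Integrable w := hwS.memLp.integrable (by simpa using hyp_H1.1.le)
  have hdens := MFG.Mac.dens_ofDensity hm hm0
  refine ⟨MFG.distOf m hm, MFG.distOf w hw, ⟨fun φ hφ => ?_, fun η v hη => ?_⟩,
    ⟨MFG.Mac.ofDensity m hm, ⟨hm.congr hdens.symm, fun φ => ?_⟩, ?_⟩,
    ⟨w, Dw, hwS, hw, fun φ => rfl⟩⟩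
  · exact integral_nonneg_of_ae (hm0.mono fun x hx => mul_nonneg hx (hφ x))
  · refine ⟨R.smoothA₁ hη v, R.smoothA₂ hη v, R.smoothA₁_apply hη v, R.smoothA₂_apply hη v, ?_⟩
    have h1 := hmin (η, v) hη
    rw [R.op_apply (z := (η, v)) hη] at h1
    rw [MFG.distOf_apply, MFG.distOf_apply]
    linarith
  · exact integral_congr_ae (hdens.mono fun x hx => congrArg (· * φ x) hx.symm)
  · rw [integral_congr_ae hdens]
    exact R.mass_eq_one hm hmin
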